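/- Work in the smooth category. Let $\Sigma$ be a closed connected surface and let $F\subset S^4$ be a knotted surface, i.e. $F=f(\Sigma)$ for a smooth embedding $f\colon\Sigma\to S^4$. Let $D$ be a broken surface diagram of $F$: a generic smooth map $\varphi\colon\Sigma\to S^3$ (a self-transverse immersion with double curves and isolated triple points, except for isolated branch points, i.e. Whitney umbrellas) together with over/under information at its self-intersections, such that, for some surface ambient isotopic to $F$ and missing the poles of $S^4$, parametrized by an embedding $e\colon\Sigma\to S^4\setminus\{\text{poles}\}\cong S^3\times(-1,1)$, $\varphi$ is the composition of $e$ with the projection to $S^3$, and the over/under information is given by the $(-1,1)$-coordinate of $e$. Let $\{((\alpha_i,\beta_i),f_i)\}_{i=1}^n$ be the corresponding decker set: $\alpha_i,\beta_i$ are curves on $\Sigma$ (both closed curves, or both arcs ending at branch points), $f_i$ identifies the points of $\alpha_i$ with those of $\beta_i$, and the pairs $(x,f_i(x))$, with $x$ a point of $\alpha_i$ (other than an end point, if $\alpha_i$ is an arc), list exactly once each pair $(x,y)$ of distinct points of $\Sigma$ with $\varphi(x)=\varphi(y)$ and $x$ on the upper sheet. Let $\gamma\subset\Sigma$ be a smooth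 simple closed curve which represents a knot in $S^3$, i.e. $\varphi|_\gamma$ is a smooth embedding, and which separates $\Sigma$; let $F_1,F_2$ be the two components of $\Sigma\setminus\gamma$. Suppose that $f_i(F_1\cap\alpha_i)\subset F_1\cap\beta_i$ for all $i$, or that $f_i^{-1}(F_1\cap\beta_i)\subset F_1\cap\alpha_i$ for all $i$. Then the knot $\varphi(\gamma)\subset S^3$ is a (cross-sectional) slice of $F$: there is an equatorial $S^3$ in $S^4$ (the image of the standard equator under an ambient isotopy of $S^4$) which meets $F$ transversally, and the intersection, as a subset of this $S^3$, is $\varphi(\gamma)$. -/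

import Mathlib

open scoped Manifold ContDiff Topology

namespace SurfaceSlice

/-- The standard `3`-sphere, the unit sphere of `ℝ⁴`. -/
abbrev S3 : Type := Metric.sphere (0 : EuclideanSpace ℝ (Fin 4)) 1

/-- The standard `4`-sphere, the unit sphere of `ℝ⁵`. -/
abbrev S4 : Type := Metric.sphere (0 : EuclideanSpace ℝ (Fin 5)) 1

/-- The last coordinate of a point of `S⁴`. -/
def height (q : S4) : ℝ := (q : EuclideanSpace ℝ (Fin 5)) (Fin.last 4)

/-- The standard equator `S³ → S⁴`, `p ↦ (p, 0)`. -/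
noncomputable def equator (p : S3) : S4 :=
  ⟨WithLp.toLp 2 (Fin.snoc (fun i : Fin 4 => (p : EuclideanSpace ℝ (Fin 4)) i) 0), by
    have hp : ‖(p : EuclideanSpace ℝ (Fin 4))‖ = 1 := by simp
    rw [EuclideanSpace.norm_eq, Real.sqrt_eq_one] at hp
    rw [mem_sphere_zero_iff_norm, EuclideanSpace.norm_eq, Real.sqrt_eq_one, Fin.sum_univ_castSucc]
    simpa [Fin.snoc_castSucc, show (4 : Fin 5) = Fin.last 4 from rfl, -Fin.reduceLast] using hp⟩

/-- `q ∈ S⁴` is not one of the two poles `(0, ±1)` and its image under the projection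
`S⁴ ∖ {poles} ≅ S³ × (-1, 1) → S³` along meridians is `p`: the first four coordinates of `q` are a
positive multiple of `p`. The coordinate along the fibres of this projection is `height`. -/
def LiesOver (q : S4) (p : S3) : Prop :=
  ∃ r : ℝ, 0 < r ∧ ∀ i : Fin 4, (q : EuclideanSpace ℝ (Fin 5)) i.castSucc =
    r * (p : EuclideanSpace ℝ (Fin 4)) i

/-- `Ψ` is the time one map of a smooth ambient isotopy of `S⁴` starting at the identity. The
isotopy is given by its track, a level preserving diffeomorphism `(t, x) ↦ (t, H t x)` of
`ℝ × S⁴`. -/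
def IsIsotopicToId (Ψ : S4 → S4) : Prop :=
  ∃ H : (ℝ × S4) ≃ₘ^∞⟮𝓘(ℝ, ℝ).prod (𝓡 4), 𝓘(ℝ, ℝ).prod (𝓡 4)⟯ (ℝ × S4),
    (∀ t x, (H (t, x)).1 = t) ∧ (∀ x, H (0, x) = (0, x)) ∧ (∀ x, H (1, x) = (1, Ψ x))

/-- `j` parametrizes an equatorial `S³` in `S⁴`: it is the standard equator, moved by an ambient
isotopy. -/
def IsEquatorial (j : S3 → S4) : Prop :=
  ∃ Ψ : S4 → S4, IsIsotopicToId Ψ ∧ j = Ψ ∘ equator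

section Surface

variable {M : Type*} [TopologicalSpace M] [ChartedSpace (EuclideanSpace ℝ (Fin 2)) M]

/-- The tangent plane at `φ x` of the sheet through `x` of a map `φ` from a surface to `S³`. -/
noncomputable def sheet3 (φ : M → S3) (x : M) : Submodule ℝ (EuclideanSpace ℝ (Fin 3)) :=
  LinearMap.range (mfderiv (𝓡 2) (𝓡 3) φ x).toLinearMap

/-- The tangent plane at `f x` of a surface `f : M → S⁴`. -/
noncomputable def sheet4 (f : M → S4) (x : M) : Submodule ℝ (EuclideanSpace ℝ (Fin 4)) :=
  LinearMap.range (mfderiv (𝓡 2) (𝓡 4) f x).toLinearMap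

/-- The tangent space at `j p` of a `3`-sphere `j : S³ → S⁴`. -/
noncomputable def tangent3 (j : S3 → S4) (p : S3) : Submodule ℝ (EuclideanSpace ℝ (Fin 4)) :=
  LinearMap.range (mfderiv (𝓡 3) (𝓡 4) j p).toLinearMap

/-- `K ⊆ S³` is a slice of the knotted surface `f(M) ⊆ S⁴`: some equatorial `S³` meets the surface
transversally, and the intersection, as a subset of that `S³`, is `K`. -/
def IsSlice (f : M → S4) (K : Set S3) : Prop :=
  ∃ j : S3 → S4, IsEquatorial j ∧ j '' K = Set.range f ∩ Set.range j ∧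
    ∀ x p, f x = j p → sheet4 f x ⊔ tangent3 j p = ⊤

/-- `φ` is an immersion at `x`. -/
def ImmersiveAt (φ : M → S3) (x : M) : Prop :=
  Function.Injective (mfderiv (𝓡 2) (𝓡 3) φ x)

/-- `φ` has a branch point (Whitney umbrella, cross-cap) at `x`: in suitable smooth charts around
`x` and `φ x` it is `(u, v) ↦ (u, v², u v)`. -/
def IsBranchPoint [IsManifold (𝓡 2) ∞ M] (φ : M → S3) (x : M) : Prop :=
  ∃ a ∈ IsManifold.maximalAtlas (𝓡 2) ∞ M, ∃ b ∈ IsManifold.maximalAtlas (𝓡 3) ∞ S3,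
    x ∈ a.source ∧ φ x ∈ b.source ∧ a x = 0 ∧
    ∀ᶠ z in 𝓝 x, b (φ z) = !₂[a z 0, a z 1 ^ 2, a z 0 * a z 1]

/-- Generic maps of a surface to `S³`: the map is a self-transverse immersion with at most double
curves and isolated triple points, except for branch points, which are not multiple points. -/
structure IsGeneric [IsManifold (𝓡 2) ∞ M] (φ : M → S3) : Prop where
  smooth : ContMDiff (𝓡 2) (𝓡 3) ∞ φ
  double : ∀ x y, x ≠ y → φ x = φ y → sheet3 φ x ⊔ sheet3 φ y = ⊤
  triple : ∀ x y z, x ≠ y → x ≠ z → y ≠ z → φ x = φ y → φ x = φ z →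
    sheet3 φ x ⊓ sheet3 φ y ⊓ sheet3 φ z = ⊥
  no_quadruple : ∀ p, (φ ⁻¹' {p}).encard ≤ 3
  branch : ∀ x, ¬ ImmersiveAt φ x → IsBranchPoint φ x ∧ ∀ y, φ y = φ x → y = x

end Surface

/-- A broken surface diagram: a generic map of the surface `M` to `S³` together with over/under
information at its self intersections. -/
structure BrokenSurfaceDiagram (M : Type*) [TopologicalSpace M]
    [ChartedSpace (EuclideanSpace ℝ (Fin 2)) M] [IsManifold (𝓡 2) ∞ M] where
  /-- the projection to `S³` -/
  proj : M → S3
  generic : IsGeneric proj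
  /-- `isOver x y`: the points `x ≠ y` have the same projection, and the sheet through `x` is the
  upper one there -/
  isOver : M → M → Prop
  ne_of_isOver : ∀ x y, isOver x y → x ≠ y
  eq_of_isOver : ∀ x y, isOver x y → proj x = proj y
  isOver_xor : ∀ x y, x ≠ y → proj x = proj y → Xor (isOver x y) (isOver y x)

/-- An ordered pair of marked curves `(α, β)` on `M` together with the identification of their
points, which is `α t ↦ β t`: the two curves are parametrized simultaneously. They are either
both closed curves (of period one) or both arcs (parametrized by `[0, 1]`). -/
structure DeckerPair (M : Type*) [TopologicalSpace M]
    [ChartedSpace (EuclideanSpace ℝ (Fin 2)) M] where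
  /-- closed curves, or arcs -/
  closed : Prop
  α : ℝ → M
  β : ℝ → M
  smooth_α : ContMDiff 𝓘(ℝ, ℝ) (𝓡 2) ∞ α
  smooth_β : ContMDiff 𝓘(ℝ, ℝ) (𝓡 2) ∞ β
  immersion_α : ∀ t ∈ Set.Icc (0 : ℝ) 1, mfderiv 𝓘(ℝ, ℝ) (𝓡 2) α t ≠ 0
  immersion_β : ∀ t ∈ Set.Icc (0 : ℝ) 1, mfderiv 𝓘(ℝ, ℝ) (𝓡 2) β t ≠ 0
  periodic_α : closed → Function.Periodic α 1
  periodic_β : closed → Function.Periodic β 1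

section Decker

variable {M : Type*} [TopologicalSpace M] [ChartedSpace (EuclideanSpace ℝ (Fin 2)) M]

/-- The identification `f` of the points of `α` with those of `β`, as a relation. It relates points
of the curves rather than points of `M`, since `α` may pass through a triple point twice. -/
def DeckerPair.Identifies (P : DeckerPair M) (x y : M) : Prop :=
  ∃ t ∈ Set.Icc (0 : ℝ) 1, P.α t = x ∧ P.β t = y

/-- The parameters of the points of the two curves, each listed once, and without the end points in
the case of arcs. -/
def DeckerPair.Param (P : DeckerPair M) (t : ℝ) : Prop :=
  (P.closed ∧ t ∈ Set.Ico (0 : ℝ) 1) ∨ (¬ P.closed ∧ t ∈ Set.Ioo (0 : ℝ) 1)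

variable [IsManifold (𝓡 2) ∞ M]

/-- The finite family `P` is the decker set of the diagram `D`: it lists every pair
(upper point, lower point) over a self intersection exactly once, and the arcs among its curves
end at branch points. -/
structure BrokenSurfaceDiagram.IsDeckerSet (D : BrokenSurfaceDiagram M) {n : ℕ}
    (P : Fin n → DeckerPair M) : Prop where
  isOver : ∀ i t, (P i).Param t → D.isOver ((P i).α t) ((P i).β t)
  exists_unique : ∀ x y, D.isOver x y →
    ∃! q : Fin n × ℝ, (P q.1).Param q.2 ∧ (P q.1).α q.2 = x ∧ (P q.1).β q.2 = y
  ends : ∀ i, ¬ (P i).closed → ∀ t, t = 0 ∨ t = 1 →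
    (P i).α t = (P i).β t ∧ ¬ ImmersiveAt D.proj ((P i).α t)

/-- `D` is a broken surface diagram of the knotted surface `f(M) ⊆ S⁴`: after an ambient isotopy,
the surface is `e(M)` for an embedding `e` which misses the poles, projects to `D.proj`, and
induces the over/under information of `D`. -/
def BrokenSurfaceDiagram.Represents (D : BrokenSurfaceDiagram M) (f : M → S4) : Prop :=
  ∃ (Ψ : S4 → S4) (e : M → S4), IsIsotopicToId Ψ ∧ Manifold.IsSmoothEmbedding (𝓡 2) (𝓡 4) ∞ e ∧
    Set.range e = Ψ '' Set.range f ∧ (∀ x, LiesOver (e x) (D.proj x)) ∧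
    ∀ x y, D.isOver x y ↔ x ≠ y ∧ D.proj x = D.proj y ∧ height (e y) < height (e x)

end Decker

/-- The complement of `γ` has exactly two components, `F₁` and `F₂`. -/
structure Separates {M : Type*} [TopologicalSpace M] (γ F₁ F₂ : Set M) : Prop where
  isOpen_left : IsOpen F₁
  isOpen_right : IsOpen F₂
  isConnected_left : IsConnected F₁
  isConnected_right : IsConnected F₂
  disjoint : Disjoint F₁ F₂
  union_eq : F₁ ∪ F₂ = γᶜ

end SurfaceSlice

open SurfaceSlice

/-! Let `e` be the embedding over `φ = D.proj`, and measure vertical position by `slope` (written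
`κ`): the last coordinate divided by the norm of the first four. Over a fixed point of `S³` it
orders points as `height` does. The graph of any smooth function `G` over the equator is an
equatorial sphere (`exists_isEquatorial_graph`). So it is enough to find, after an isotopy of `S⁴`,
a `G` with `κ < G ∘ φ` on `F₁` and `κ > G ∘ φ` on `F₂`, such that `κ - G ∘ φ` vanishes on `γ` with
nonzero derivative (`isSlice_of_graph`).

The first alternative of the hypothesis says that a point of `F₁` never lies above a point of `γ ∪
F₂` with the same projection. Reflecting `S⁴` in the equator reverses heights and turns the second
alternative into the first. The hypothesis leaves one obstruction: a sheet of `F₂` may pass below a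
point of `γ`. The double curve of these two sheets cannot enter `F₁` near that point, so on the
sheet of `γ` it stays in the closure of `F₂`. Pushing the lower sheet horizontally, in the direction
from `F₁` to `F₂`, therefore takes it off the closed side of `F₁` (`eventually_ne_of_push`).
Compactness makes one small push work everywhere (`eventually_lt_of_push`), and a horizontal field
realizes it by an isotopy which is constant near `γ`.

Once heights are strictly ordered, `G` is built locally. Away from `φ(γ)` a constant does. At an
immersive point of `γ` a local inverse of `φ` gives `G`. At a branch point on `γ` the kernel
direction of `dφ` is transverse to `γ`, and the over/under condition forces `κ` to increase along it
from `F₁` to `F₂` (`HasLocalSlope.of_isBranchPoint`). Pairs consisting of a separating value and a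
rate of separation form convex sets, so a partition of unity glues them (`exists_separating`). All
of this is expressed through a function `s` with `F₁ = {s < 0}`, `F₂ = {s > 0}` and regular zero set
`γ` (`exists_defining_function`). -/

namespace SurfaceSlice

open Filter Set

/-! ### Local calculus: inverse functions, straightening, growth in a direction. -/

section Calculus

variable {E F : Type*} [NormedAddCommGroup E] [NormedSpace ℝ E] [NormedAddCommGroup F]
  [NormedSpace ℝ F]

/-- The inverse function theorem for smooth maps, with smoothness of the inverse near the point. -/
theorem exists_smooth_localInverse [CompleteSpace E] {f : E → F} {f' : E ≃L[ℝ] F} {a : E}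
    (hf : ∀ᶠ x in 𝓝 a, ContDiffAt ℝ ∞ f x) (hf' : HasFDerivAt f (f' : E →L[ℝ] F) a) :
    ∃ e : OpenPartialHomeomorph E F, a ∈ e.source ∧ ⇑e = f ∧
      ∀ᶠ y in 𝓝 (f a), ContDiffAt ℝ ∞ e.symm y := by
  have h0 := hf.self_of_nhds
  have hn : (∞ : WithTop ℕ∞) ≠ 0 := by simp
  refine ⟨h0.toOpenPartialHomeomorph f hf' hn, h0.mem_toOpenPartialHomeomorph_source hf' hn,
    h0.toOpenPartialHomeomorph_coe hf' hn, ?_⟩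
  set e := h0.toOpenPartialHomeomorph f hf' hn with he
  have hes : a ∈ e.source := h0.mem_toOpenPartialHomeomorph_source hf' hn
  have hef : ⇑e = f := h0.toOpenPartialHomeomorph_coe hf' hn
  have hc : ContinuousAt (fderiv ℝ f) a :=
    (h0.fderiv_right (m := 0) (by simp)).continuousAt
  -- Invertible operators form an open set, so the derivative stays invertible near `a`; this gives
  -- smoothness of the inverse on a neighbourhood instead of at one point.
  have hinv : ∀ᶠ x in 𝓝 a, fderiv ℝ f x ∈ range ((↑) : (E ≃L[ℝ] F) → E →L[ℝ] F) := by
    apply hc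
    rw [hf'.fderiv]
    exact ContinuousLinearEquiv.nhds f'
  have hev := (hf.and hinv).and (e.open_source.mem_nhds hes)
  have hea : e a = f a := by rw [hef]
  have ht : Tendsto e.symm (𝓝 (f a)) (𝓝 a) := by
    have := e.continuousAt_symm (e.map_source hes)
    rw [ContinuousAt, e.left_inv hes, hea] at this
    exact this
  have hT : e.target ∈ 𝓝 (f a) := e.open_target.mem_nhds (hea ▸ e.map_source hes)
  filter_upwards [ht.eventually hev, hT] with y hy hyt
  obtain ⟨⟨hs, ⟨g', hg'⟩⟩, -⟩ := hy
  refine e.contDiffAt_symm hyt (f₀' := g') ?_ ?_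
  · rw [hef, hg']
    exact (hs.differentiableAt hn).hasFDerivAt
  · rw [hef]; exact hs

/-- A smooth map with injective derivative has a smooth local left inverse. -/
theorem exists_smooth_leftInverse [FiniteDimensional ℝ E] {ψ : E → F} {z : E}
    [FiniteDimensional ℝ F]
    (hψ : ∀ᶠ x in 𝓝 z, ContDiffAt ℝ ∞ ψ x) (hinj : Function.Injective (fderiv ℝ ψ z)) :
    ∃ r : F → E, (∀ᶠ x in 𝓝 z, r (ψ x) = x) ∧ ∀ᶠ y in 𝓝 (ψ z), ContDiffAt ℝ ∞ r y := by
  have := FiniteDimensional.complete ℝ E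
  obtain ⟨A, hA⟩ := LinearMap.exists_leftInverse_of_injective (fderiv ℝ ψ z).toLinearMap
    (LinearMap.ker_eq_bot.2 hinj)
  let A' : F →L[ℝ] E := A.toContinuousLinearMap
  have hd : HasFDerivAt (fun x => A' (ψ x)) ((ContinuousLinearEquiv.refl ℝ E : E ≃L[ℝ] E) :
      E →L[ℝ] E) z := by
    refine (A'.hasFDerivAt.comp z
      (hψ.self_of_nhds.differentiableAt (by simp)).hasFDerivAt).congr_fderiv ?_
    ext v
    exact LinearMap.congr_fun hA v
  have hsm : ∀ᶠ x in 𝓝 z, ContDiffAt ℝ ∞ (fun x => A' (ψ x)) x := by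
    filter_upwards [hψ] with x hx
    exact A'.contDiff.contDiffAt.comp x hx
  obtain ⟨e, hes, hef, hsy⟩ := exists_smooth_localInverse hsm hd
  refine ⟨fun y => e.symm (A' y), ?_, ?_⟩
  · filter_upwards [e.open_source.mem_nhds hes] with x hx
    have := e.left_inv hx
    rwa [hef] at this
  · have := (A'.continuous.continuousAt (x := ψ z)).eventually hsy
    filter_upwards [this] with y hy
    exact hy.comp y A'.contDiff.contDiffAt

/-- The image of a codimension one immersion is locally the zero set of a smooth function with
nonzero derivative. -/
theorem exists_smooth_equation [FiniteDimensional ℝ E] [FiniteDimensional ℝ F] {ψ : E → F} {z : E}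
    (hdim : Module.finrank ℝ F = Module.finrank ℝ E + 1)
    (hψ : ∀ᶠ x in 𝓝 z, ContDiffAt ℝ ∞ ψ x) (hinj : Function.Injective (fderiv ℝ ψ z)) :
    ∃ (r : F → E) (l : F → ℝ), (∀ᶠ y in 𝓝 (ψ z), ContDiffAt ℝ ∞ r y) ∧
      (∀ᶠ y in 𝓝 (ψ z), ContDiffAt ℝ ∞ l y) ∧ (∀ᶠ x in 𝓝 z, r (ψ x) = x) ∧
      (∀ᶠ x in 𝓝 z, l (ψ x) = 0) ∧ (∀ᶠ y in 𝓝 (ψ z), l y = 0 → ψ (r y) = y) ∧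
      fderiv ℝ l (ψ z) ≠ 0 := by
  have := FiniteDimensional.complete ℝ E
  set L := fderiv ℝ ψ z with hL
  -- Adding a coordinate in a direction `ν` transverse to the image makes `ψ` a local diffeomorphism
  -- `Φ` on `E × ℝ`. The components of its inverse are `r` and `l`.
  obtain ⟨ν, hν⟩ : ∃ ν, ν ∉ LinearMap.range L.toLinearMap := by
    by_contra! h
    have h1 : LinearMap.range L.toLinearMap = ⊤ := by
      ext v; simpa using h v
    have h2 := LinearMap.finrank_range_of_inj (f := L.toLinearMap) hinj
    rw [h1, finrank_top] at h2
    omega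
  let T : (E × ℝ) →L[ℝ] F := L.coprod ((ContinuousLinearMap.id ℝ ℝ).smulRight ν)
  have hT : ∀ p : E × ℝ, T p = L p.1 + p.2 • ν := fun p => by simp [T]
  have hTinj : Function.Injective T.toLinearMap := by
    rw [← LinearMap.ker_eq_bot, LinearMap.ker_eq_bot']
    rintro ⟨u, α⟩ h
    have h' : L u + α • ν = 0 := by simpa [hT] using h
    have hα : α = 0 := by
      by_contra hne
      apply hν
      refine ⟨-(α⁻¹ • u), ?_⟩
      have : L u = -(α • ν) := eq_neg_of_add_eq_zero_left h'
      simp [this, hne]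
    subst hα
    have : L u = L 0 := by simpa using h'
    rw [hinj this]; rfl
  let T' : (E × ℝ) ≃L[ℝ] F :=
    (LinearEquiv.ofInjectiveOfFinrankEq T.toLinearMap hTinj (by simp [hdim])).toContinuousLinearEquiv
  have hT' : (T' : (E × ℝ) →L[ℝ] F) = T := by
    ext <;> rfl
  let Φ : E × ℝ → F := fun p => ψ p.1 + p.2 • ν
  have hΦ0 : Φ (z, 0) = ψ z := by simp [Φ]
  have hd : HasFDerivAt Φ (T' : (E × ℝ) →L[ℝ] F) (z, 0) := by
    rw [hT']
    have h1 : HasFDerivAt ψ L z := (hψ.self_of_nhds.differentiableAt (by simp)).hasFDerivAt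
    have h2 : HasFDerivAt (fun p : E × ℝ => ψ p.1) (L.comp (ContinuousLinearMap.fst ℝ E ℝ)) (z, 0) :=
      HasFDerivAt.comp (z, (0 : ℝ)) h1 hasFDerivAt_fst
    have h3 : HasFDerivAt (fun p : E × ℝ => p.2 • ν)
      ((ContinuousLinearMap.snd ℝ E ℝ).smulRight ν) (z, 0) :=
      ((ContinuousLinearMap.snd ℝ E ℝ).smulRight ν).hasFDerivAt
    exact h2.add h3
  have hsm : ∀ᶠ p in 𝓝 (z, (0 : ℝ)), ContDiffAt ℝ ∞ Φ p := by
    have : ∀ᶠ p : E × ℝ in 𝓝 (z, (0 : ℝ)), ContDiffAt ℝ ∞ ψ p.1 :=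
      (continuous_fst.continuousAt (x := (z, (0 : ℝ)))).eventually hψ
    filter_upwards [this] with p hp
    exact (hp.comp p contDiffAt_fst).add (contDiffAt_snd.smul contDiffAt_const)
  obtain ⟨e, hes, hef, hsy⟩ := exists_smooth_localInverse hsm hd
  rw [hΦ0] at hsy
  have hzs : ∀ᶠ x in 𝓝 z, (x, (0 : ℝ)) ∈ e.source :=
    ((Continuous.prodMk_left (0 : ℝ)).continuousAt (x := z)).eventually
      (e.open_source.mem_nhds hes)
  have hei : ∀ p ∈ e.source, e.symm (Φ p) = p := fun p hp => by
    have := e.left_inv hp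
    rwa [hef] at this
  have hψs : ∀ᶠ x in 𝓝 z, e.symm (ψ x) = (x, 0) := by
    filter_upwards [hzs] with x hx
    have := hei _ hx
    simpa [Φ] using this
  have hl : ∀ᶠ y in 𝓝 (ψ z), ContDiffAt ℝ ∞ (fun y => (e.symm y).2) y := by
    filter_upwards [hsy] with y hy using contDiffAt_snd.comp y hy
  refine ⟨fun y => (e.symm y).1, fun y => (e.symm y).2, ?_, hl, ?_, ?_, ?_, ?_⟩
  · filter_upwards [hsy] with y hy using contDiffAt_fst.comp y hy
  · filter_upwards [hψs] with x hx; rw [hx]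
  · filter_upwards [hψs] with x hx; rw [hx]
  · have : e.target ∈ 𝓝 (ψ z) := e.open_target.mem_nhds (by
      rw [← hΦ0, ← hef]; exact e.map_source hes)
    filter_upwards [this] with y hy h0
    have := e.right_inv hy
    rw [hef] at this
    simpa [Φ, h0] using this
  -- Since `l ∘ Φ` is the second coordinate, a zero derivative of `l` would give `1 = 0`.
  · intro h0
    have h1 : HasFDerivAt (fun y => (e.symm y).2) (0 : F →L[ℝ] ℝ) (Φ (z, 0)) := by
      rw [hΦ0, ← h0]
      exact (hl.self_of_nhds.differentiableAt (by simp)).hasFDerivAt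
    have h2 := h1.comp (z, (0 : ℝ)) hd
    have h3 : HasFDerivAt (fun p : E × ℝ => p.2) (ContinuousLinearMap.snd ℝ E ℝ) (z, (0 : ℝ)) :=
      hasFDerivAt_snd
    have h4 : (fun p : E × ℝ => p.2) =ᶠ[𝓝 (z, (0 : ℝ))] (fun y => (e.symm y).2) ∘ Φ := by
      filter_upwards [e.open_source.mem_nhds hes] with p hp
      simp [hei p hp]
    have h5 := h3.unique (h2.congr_of_eventuallyEq h4)
    have := DFunLike.congr_fun h5 (0, (1 : ℝ))
    simp at this

/-- A function with nonzero strict derivative at a zero `z` has arbitrarily small neighbourhoods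
of `z` which it divides into two connected halves. -/
theorem exists_nhds_isPreconnected_halves [CompleteSpace E] {s : E → ℝ} {s' : E →L[ℝ] ℝ} {z : E}
    (hs : HasStrictFDerivAt s s' z) (h0 : s z = 0) (hne : s' ≠ 0) {N : Set E} (hN : N ∈ 𝓝 z) :
    ∃ N' ∈ 𝓝 z, N' ⊆ N ∧ IsPreconnected (N' ∩ {x | s x < 0}) ∧
      IsPreconnected (N' ∩ {x | 0 < s x}) := by
  obtain ⟨n, hn⟩ : ∃ n, s' n = 1 := by
    obtain ⟨v, hv⟩ := DFunLike.ne_iff.1 hne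
    exact ⟨(s' v)⁻¹ • v, by simpa using inv_mul_cancel₀ hv⟩
  -- The identity is corrected along `n` so that `T` carries `s` to an affine function. The halves
  -- then become intersections of a ball with half spaces, which are convex.
  let T : E → E := fun x => x + (s x - s' (x - z)) • n
  have hTz : T z = z := by simp [T, h0]
  have hT : HasStrictFDerivAt T ((ContinuousLinearEquiv.refl ℝ E : E ≃L[ℝ] E) : E →L[ℝ] E) z := by
    have h1 : HasStrictFDerivAt (fun x => s' (x - z)) s' z :=
      s'.hasStrictFDerivAt.comp z (((hasStrictFDerivAt_id z).sub_const z))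
    have h2 := (hasStrictFDerivAt_id z).add ((hs.sub h1).smul_const n)
    refine h2.congr_fderiv ?_
    ext v; simp
  have hTs : ∀ x, s' (T x - z) = s x := by
    intro x
    simp only [T, map_sub, map_add, map_smul, hn, smul_eq_mul]
    ring
  let e := hT.toOpenPartialHomeomorph T
  have hes : z ∈ e.source := hT.mem_toOpenPartialHomeomorph_source
  have hef : ⇑e = T := hT.toOpenPartialHomeomorph_coe
  have het : e.target ∈ 𝓝 z := e.open_target.mem_nhds (by
    have := e.map_source hes
    rwa [hef, hTz] at this)
  have hsz : e.symm z = z := by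
    have := e.left_inv hes
    rwa [hef, hTz] at this
  have hsc : Tendsto e.symm (𝓝 z) (𝓝 z) := by
    have := e.continuousAt_symm (mem_of_mem_nhds het)
    rwa [ContinuousAt, hsz] at this
  obtain ⟨δ, hδ, hball⟩ := Metric.mem_nhds_iff.1 (inter_mem het (hsc hN))
  have key : ∀ C : Set ℝ, Convex ℝ C →
      IsPreconnected ((e.symm '' Metric.ball z δ) ∩ {x | s x ∈ C}) := by
    intro C hC
    have h1 : (e.symm '' Metric.ball z δ) ∩ {x | s x ∈ C} =
        e.symm '' (Metric.ball z δ ∩ {y | s' (y - z) ∈ C}) := by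
      ext x
      constructor
      · rintro ⟨⟨y, hy, rfl⟩, hx⟩
        refine ⟨y, ⟨hy, ?_⟩, rfl⟩
        have hr := e.right_inv (hball hy).1
        rw [hef] at hr
        have := hTs (e.symm y)
        rw [hr] at this
        simpa only [mem_ofPred_eq, this] using hx
      · rintro ⟨y, ⟨hy, hyC⟩, rfl⟩
        refine ⟨⟨y, hy, rfl⟩, ?_⟩
        have hr := e.right_inv (hball hy).1
        rw [hef] at hr
        have := hTs (e.symm y)
        rw [hr] at this
        simpa only [mem_ofPred_eq, ← this] using hyC
    rw [h1]
    refine IsPreconnected.image ?_ _ (e.continuousOn_symm.mono fun y hy => (hball hy.1).1)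
    refine ((convex_ball z δ).inter ?_).isPreconnected
    intro x hx y hy a b ha hb hab
    have : s' (a • x + b • y - z) = a • s' (x - z) + b • s' (y - z) := by
      have hz : s' z = (a + b) * s' z := by rw [hab, one_mul]
      simp only [map_sub, map_add, map_smul, smul_eq_mul]
      linear_combination -hz
    simp only [mem_ofPred_eq, this]
    exact hC hx hy ha hb hab
  refine ⟨e.symm '' Metric.ball z δ, ?_, ?_, ?_, ?_⟩
  · have := e.symm.image_mem_nhds (x := z) (mem_of_mem_nhds het) (Metric.ball_mem_nhds z hδ)
    rwa [hsz] at this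
  · rintro _ ⟨y, hy, rfl⟩
    exact (hball hy).2
  · exact key (Iio 0) (convex_Iio 0)
  · exact key (Ioi 0) (convex_Ioi 0)

/-- A function increases in the directions in which its strict derivative is positive. -/
theorem eventually_lt_of_hasStrictFDerivAt {w : E → ℝ} {w' : E →L[ℝ] ℝ} {z n : E}
    (hw : HasStrictFDerivAt w w' z) (hn : 0 < w' n) :
    ∀ᶠ p : ℝ × E × E in 𝓝[>] (0 : ℝ) ×ˢ 𝓝 z ×ˢ 𝓝 n, w p.2.1 < w (p.2.1 + p.1 • p.2.2) := by
  -- With this `c` the error allowed by strict differentiability is less than half of `w' n` in the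
  -- direction `n`.
  set c : ℝ := w' n / (2 * (‖n‖ + 1)) with hc
  have hc0 : 0 < c := by positivity
  have h1 : Tendsto (fun p : ℝ × E × E => (p.2.1 + p.1 • p.2.2, p.2.1))
      (𝓝[>] (0 : ℝ) ×ˢ 𝓝 z ×ˢ 𝓝 n) (𝓝 (z, z)) := by
    have : Continuous (fun p : ℝ × E × E => (p.2.1 + p.1 • p.2.2, p.2.1)) := by fun_prop
    have h := this.tendsto (0, z, n)
    simp only [zero_smul, add_zero] at h
    refine h.mono_left ?_
    rw [nhds_prod_eq, nhds_prod_eq]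
    exact Filter.prod_mono nhdsWithin_le_nhds le_rfl
  have h2 := h1.eventually (hw.isLittleO.def hc0)
  have h3 : ∀ᶠ p : ℝ × E × E in 𝓝[>] (0 : ℝ) ×ˢ 𝓝 z ×ˢ 𝓝 n, 0 < p.1 :=
    tendsto_fst.eventually self_mem_nhdsWithin
  have h4 : ∀ᶠ p : ℝ × E × E in 𝓝[>] (0 : ℝ) ×ˢ 𝓝 z ×ˢ 𝓝 n,
      c * ‖p.2.2‖ < w' p.2.2 := by
    have : ∀ᶠ v in 𝓝 n, c * ‖v‖ < w' v := by
      have hcont : Continuous fun v => w' v - c * ‖v‖ := by fun_prop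
      have hpos : 0 < w' n - c * ‖n‖ := by
        have : c * (‖n‖ + 1) = w' n / 2 := by
          rw [hc]; field_simp
        nlinarith [norm_nonneg n]
      filter_upwards [hcont.continuousAt.eventually (lt_mem_nhds hpos)] with v hv
      linarith
    exact (tendsto_snd.comp tendsto_snd).eventually this
  filter_upwards [h2, h3, h4] with p hp2 hp3 hp4
  simp only [add_sub_cancel_left, map_smul, norm_smul, Real.norm_eq_abs, abs_of_pos hp3,
    smul_eq_mul] at hp2
  have := (abs_le.1 hp2).1
  nlinarith [mul_lt_mul_of_pos_left hp4 hp3]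

/-- If `k` vanishes on the zero set of `s` and both increase in a common direction, then `k` is
locally bounded from below by a positive multiple of `s` where `s ≥ 0`, and from above where
`s ≤ 0`. -/
theorem exists_pos_mul_le_of_hasStrictFDerivAt {k s : E → ℝ} {k' s' : E →L[ℝ] ℝ} {z n : E}
    (hk : HasStrictFDerivAt k k' z) (hs : HasStrictFDerivAt s s' z) (h0 : s z = 0)
    (hk0 : ∀ᶠ x in 𝓝 z, s x = 0 → k x = 0) (hsc : ∀ᶠ x in 𝓝 z, ContinuousAt s x)
    (hkn : 0 < k' n) (hsn : 0 < s' n) :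
    ∃ ε > 0, ∀ᶠ x in 𝓝 z, (0 ≤ s x → ε * s x ≤ k x) ∧ (s x ≤ 0 → k x ≤ ε * s x) := by
  -- Half the ratio of the growth rates along `n`, so `k - ε * s` still increases along `n`.
  set ε := k' n / (2 * s' n) with hε
  have hε0 : 0 < ε := by positivity
  refine ⟨ε, hε0, ?_⟩
  have hw : HasStrictFDerivAt (fun x => k x - ε * s x) (k' - ε • s') z := hk.sub (hs.const_mul ε)
  have hwn : 0 < (k' - ε • s') n := by
    have : ε * s' n = k' n / 2 := by rw [hε]; field_simp
    simp [this]; linarith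
  have e1 := eventually_lt_of_hasStrictFDerivAt hw hwn
  have e2 := eventually_lt_of_hasStrictFDerivAt hs hsn
  rw [Filter.eventually_prod_iff] at e1 e2
  obtain ⟨p1, hp1, q1, hq1, H1⟩ := e1
  obtain ⟨p2, hp2, q2, hq2, H2⟩ := e2
  have hq1' : ∀ᶠ x in 𝓝 z, q1 (x, n) := hq1.curry.mono fun x hx => hx.self_of_nhds
  have hq2' : ∀ᶠ x in 𝓝 z, q2 (x, n) := hq2.curry.mono fun x hx => hx.self_of_nhds
  obtain ⟨δ, hδ, hball⟩ := Metric.eventually_nhds_iff.1 (hq1'.and (hq2'.and (hk0.and hsc)))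
  -- Segments of parameter length `τ₀` along `n` stay in the good ball, and `s` changes sign on each
  -- of them near `z`.
  obtain ⟨τ₀, hτ0, hτ⟩ : ∃ τ₀ > 0, (∀ τ, 0 < τ → τ ≤ τ₀ → p1 τ ∧ p2 τ) ∧ τ₀ * ‖n‖ < δ / 2 := by
    obtain ⟨u, hu, hu'⟩ := mem_nhdsGT_iff_exists_Ioc_subset.1 (hp1.and hp2)
    refine ⟨min u (δ / (2 * (‖n‖ + 1)) / 2), lt_min hu (by positivity), fun τ h1 h2 =>
      hu' ⟨h1, h2.trans (min_le_left _ _)⟩, ?_⟩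
    calc min u (δ / (2 * (‖n‖ + 1)) / 2) * ‖n‖ ≤ δ / (2 * (‖n‖ + 1)) / 2 * ‖n‖ := by
          gcongr; exact min_le_right _ _
      _ < δ / (2 * (‖n‖ + 1)) * (‖n‖ + 1) := by
          have : 0 < δ / (2 * (‖n‖ + 1)) := by positivity
          nlinarith [norm_nonneg n]
      _ = δ / 2 := by field_simp
  have hdist : ∀ x, dist x z < δ / 2 → ∀ τ, |τ| ≤ τ₀ → dist (x + τ • n) z < δ := by
    intro x hx τ hτ'
    calc dist (x + τ • n) z ≤ dist (x + τ • n) x + dist x z := dist_triangle _ _ _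
      _ = |τ| * ‖n‖ + dist x z := by simp [norm_smul]
      _ ≤ τ₀ * ‖n‖ + dist x z := by gcongr
      _ < δ := by linarith [hτ.2]
  have hz : dist z z < δ / 2 := by simpa using hδ
  have hlo : s (z + (-τ₀) • n) < 0 := by
    have hd := hdist z hz (-τ₀) (by simp [abs_of_pos hτ0])
    have := H2 (hτ.1 τ₀ hτ0 le_rfl).2 (hball hd).2.1
    simpa [h0] using this
  have hhi : 0 < s (z + τ₀ • n) := by
    have := H2 (hτ.1 τ₀ hτ0 le_rfl).2 (hball (show dist z z < δ by linarith)).2.1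
    simpa [h0] using this
  have hcat : ∀ τ, |τ| ≤ τ₀ → ContinuousAt (fun x => s (x + τ • n)) z := by
    intro τ hτ'
    have : ContinuousAt s (z + τ • n) := (hball (hdist z hz τ hτ')).2.2.2
    exact ContinuousAt.comp (f := fun x => x + τ • n) this (by fun_prop)
  have hlo' := (hcat (-τ₀) (by simp [abs_of_pos hτ0])).eventually (gt_mem_nhds hlo)
  have hhi' := (hcat τ₀ (by simp [abs_of_pos hτ0])).eventually (lt_mem_nhds hhi)
  filter_upwards [hlo', hhi', Metric.ball_mem_nhds z (half_pos hδ)] with x hxl hxh hx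
  have hcon : ∀ a b, -τ₀ ≤ a → b ≤ τ₀ → ContinuousOn (fun τ => s (x + τ • n)) (Icc a b) := by
    intro a b ha hb τ ht
    have hct : ContinuousAt s (x + τ • n) :=
      (hball (hdist x hx τ (abs_le.2 ⟨ha.trans ht.1, ht.2.trans hb⟩))).2.2.2
    exact (ContinuousAt.comp (f := fun τ : ℝ => x + τ • n) hct (by fun_prop)).continuousWithinAt
  constructor
  · intro hsx
    -- Slide `x` back along `n` to a zero of `s`. There `k` vanishes too, and `k - ε * s` increases
    -- from that point to `x`.
    obtain ⟨τ, ⟨hτ1, hτ2⟩, hst⟩ := intermediate_value_Icc (by linarith : -τ₀ ≤ 0)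
      (hcon (-τ₀) 0 le_rfl hτ0.le) (show (0 : ℝ) ∈ Icc _ _ from ⟨hxl.le, by simpa using hsx⟩)
    have hd := hball (hdist x hx τ (abs_le.2 ⟨hτ1, by linarith⟩))
    have hkt : k (x + τ • n) = 0 := hd.2.2.1 hst
    rcases hτ2.lt_or_eq with h | h
    · have := H1 (hτ.1 (-τ) (by linarith) (by linarith)).1 hd.1
      simp only at this hst
      rw [hkt, hst] at this
      simp at this
      linarith
    · subst h
      simp at hkt hst
      simp [hkt, hst]
  · intro hsx
    obtain ⟨τ, ⟨hτ1, hτ2⟩, hst⟩ := intermediate_value_Icc hτ0.le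
      (hcon 0 τ₀ (by linarith) le_rfl) (show (0 : ℝ) ∈ Icc _ _ from ⟨by simpa using hsx, hxh.le⟩)
    have hd := hball (hdist x hx τ (abs_le.2 ⟨by linarith, hτ2⟩))
    have hkt : k (x + τ • n) = 0 := hd.2.2.1 hst
    rcases hτ1.lt_or_eq with h | h
    · have hd0 := hball (show dist x z < δ by have := Metric.mem_ball.1 hx; linarith)
      have := H1 (hτ.1 τ h hτ2).1 hd0.1
      simp only at this hst
      rw [hkt, hst] at this
      linarith
    · subst h
      simp at hkt hst
      simp [hkt, hst]

end Calculus

/-! ### The same calculus on manifolds, in preferred charts. -/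

section ManifoldCalculus

variable {E F : Type*} [NormedAddCommGroup E] [NormedSpace ℝ E] [NormedAddCommGroup F]
  [NormedSpace ℝ F] {M : Type*} [TopologicalSpace M] [ChartedSpace E M]

variable (E) in
/-- The derivative at `x` of a map from a manifold to a vector space, in the preferred chart
at `x`. -/
noncomputable def chartDeriv (k : M → F) (x : M) : E →L[ℝ] F :=
  fderiv ℝ (k ∘ (chartAt E x).symm) (chartAt E x x)

theorem chartDeriv_eq_mfderiv {k : M → F} {x : M} (hk : MDifferentiableAt 𝓘(ℝ, E) 𝓘(ℝ, F) k x) :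
    chartDeriv E k x = (mfderiv 𝓘(ℝ, E) 𝓘(ℝ, F) k x : E →L[ℝ] F) := by
  rw [hk.mfderiv]
  simp only [mfld_simps, fderivWithin_univ]
  rfl

omit [NormedSpace ℝ E] in
theorem comp_chartAt_symm_apply {X : Type*} (k : M → X) (x : M) :
    (k ∘ (chartAt E x).symm) (chartAt E x x) = k x := by
  simp

omit [NormedSpace ℝ E] in
theorem eventually_nhds_chartAt {p : M → Prop} {x : M} (h : ∀ᶠ y in 𝓝 x, p y) :
    ∀ᶠ z in 𝓝 (chartAt E x x), p ((chartAt E x).symm z) := by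
  have := (chartAt E x).continuousAt_symm (mem_chart_target E x)
  rw [ContinuousAt, (chartAt E x).left_inv (mem_chart_source E x)] at this
  exact this.eventually h

omit [NormedSpace ℝ E] in
theorem eventually_nhds_of_chartAt {p : M → Prop} {x : M}
    (h : ∀ᶠ z in 𝓝 (chartAt E x x), p ((chartAt E x).symm z)) : ∀ᶠ y in 𝓝 x, p y := by
  have := ((chartAt E x).continuousAt (mem_chart_source E x)).eventually h
  filter_upwards [this, (chartAt E x).open_source.mem_nhds (mem_chart_source E x)] with y hy hys
  rwa [(chartAt E x).left_inv hys] at hy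

variable [IsManifold 𝓘(ℝ, E) ∞ M]

theorem eventually_contDiffAt_comp_chartAt_symm {k : M → F} {x : M}
    (hk : ∀ᶠ y in 𝓝 x, ContMDiffAt 𝓘(ℝ, E) 𝓘(ℝ, F) ∞ k y) :
    ∀ᶠ z in 𝓝 (chartAt E x x), ContDiffAt ℝ ∞ (k ∘ (chartAt E x).symm) z := by
  filter_upwards [eventually_nhds_chartAt hk,
    (chartAt E x).open_target.mem_nhds (mem_chart_target E x)] with z hz hzt
  rw [← contMDiffAt_iff_contDiffAt]
  exact hz.comp z ((contMDiffOn_chart_symm (I := 𝓘(ℝ, E))).contMDiffAt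
    ((chartAt E x).open_target.mem_nhds hzt))

theorem hasStrictFDerivAt_comp_chartAt_symm {k : M → F} {x : M}
    (hk : ContMDiffAt 𝓘(ℝ, E) 𝓘(ℝ, F) ∞ k x) :
    HasStrictFDerivAt (k ∘ (chartAt E x).symm) (chartDeriv E k x) (chartAt E x x) := by
  have h1 : ContDiffAt ℝ ∞ (k ∘ (chartAt E x).symm) (chartAt E x x) := by
    rw [← contMDiffAt_iff_contDiffAt]
    refine ContMDiffAt.comp _ ?_ ((contMDiffOn_chart_symm (I := 𝓘(ℝ, E))).contMDiffAt
      ((chartAt E x).open_target.mem_nhds (mem_chart_target E x)))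
    rwa [(chartAt E x).left_inv (mem_chart_source E x)]
  exact h1.hasStrictFDerivAt (by simp)

/-- A smooth map to a vector space with injective derivative has a smooth local left inverse. -/
theorem exists_contMDiff_leftInverse [FiniteDimensional ℝ E] [FiniteDimensional ℝ F] {k : M → F}
    {x : M} (hk : ∀ᶠ y in 𝓝 x, ContMDiffAt 𝓘(ℝ, E) 𝓘(ℝ, F) ∞ k y)
    (hinj : Function.Injective (chartDeriv E k x)) :
    ∃ r : F → M, (∀ᶠ y in 𝓝 x, r (k y) = y) ∧
      ∀ᶠ q in 𝓝 (k x), ContMDiffAt 𝓘(ℝ, F) 𝓘(ℝ, E) ∞ r q := by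
  have hi : Function.Injective (fderiv ℝ (k ∘ (chartAt E x).symm) (chartAt E x x)) := by
    exact hinj
  obtain ⟨r, hr1, hr2⟩ := exists_smooth_leftInverse (eventually_contDiffAt_comp_chartAt_symm hk) hi
  rw [comp_chartAt_symm_apply (E := E)] at hr2
  have hrx : r (k x) = chartAt E x x := by
    have := hr1.self_of_nhds
    rwa [comp_chartAt_symm_apply (E := E)] at this
  refine ⟨fun q => (chartAt E x).symm (r q), ?_, ?_⟩
  · apply eventually_nhds_of_chartAt (E := E)
    filter_upwards [hr1] with z hz
    exact congrArg _ hz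
  · have hc : ContinuousAt r (k x) := hr2.self_of_nhds.continuousAt
    have : ∀ᶠ q in 𝓝 (k x), r q ∈ (chartAt E x).target := hc.eventually (by
      rw [hrx]; exact (chartAt E x).open_target.mem_nhds (mem_chart_target E x))
    filter_upwards [hr2, this] with q hq hqt
    exact ((contMDiffOn_chart_symm (I := 𝓘(ℝ, E))).contMDiffAt
      ((chartAt E x).open_target.mem_nhds hqt)).comp q hq.contMDiffAt

/-- Comparison of derivatives in a direction in which `s` increases. -/
theorem mfderiv_le_of_eventually_le {s k m : M → ℝ} {x : M} {n : E}
    (hs : ContMDiffAt 𝓘(ℝ, E) 𝓘(ℝ, ℝ) ∞ s x) (hk : ContMDiffAt 𝓘(ℝ, E) 𝓘(ℝ, ℝ) ∞ k x)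
    (hm : ContMDiffAt 𝓘(ℝ, E) 𝓘(ℝ, ℝ) ∞ m x) (hx : k x = m x)
    (hle : ∀ᶠ y in 𝓝 x, s x < s y → m y ≤ k y)
    (hn : 0 < chartDeriv E s x n) :
    chartDeriv E m x n ≤
      chartDeriv E k x n := by
  -- Otherwise `m - k` would increase strictly along `n`, starting from `0`, at points where `s` has
  -- increased as well.
  by_contra! hlt
  have hs' := hasStrictFDerivAt_comp_chartAt_symm hs
  have hd := (hasStrictFDerivAt_comp_chartAt_symm hm).sub (hasStrictFDerivAt_comp_chartAt_symm hk)
  have h1 := eventually_lt_of_hasStrictFDerivAt hs' hn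
  have h2 := eventually_lt_of_hasStrictFDerivAt hd
    (show 0 < (chartDeriv E m x -
      chartDeriv E k x) n from sub_pos.2 hlt)
  set z := chartAt E x x with hz
  have hcont : Tendsto (fun τ : ℝ => (τ, z, n)) (𝓝[>] 0) (𝓝[>] (0 : ℝ) ×ˢ 𝓝 z ×ˢ 𝓝 n) :=
    tendsto_id.prodMk (tendsto_const_nhds.prodMk tendsto_const_nhds)
  have hcont2 : Tendsto (fun τ : ℝ => z + τ • n) (𝓝[>] 0) (𝓝 z) := by
    have : Continuous fun τ : ℝ => z + τ • n := by fun_prop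
    have h := this.tendsto 0
    simp only [zero_smul, add_zero] at h
    exact h.mono_left nhdsWithin_le_nhds
  obtain ⟨τ, h3, h4, h5⟩ := ((hcont.eventually h1).and ((hcont.eventually h2).and
    (hcont2.eventually (eventually_nhds_chartAt hle)))).exists
  simp only [Pi.sub_apply, comp_chartAt_symm_apply, z, hx, sub_self] at h3 h4 h5
  have := h5 h3
  simp only [Function.comp_apply] at h4
  linarith

/-- A smooth function with nonzero derivative at a zero has arbitrarily small neighbourhoods
which it divides into two connected halves. -/
theorem exists_nhds_isPreconnected_halves_manifold [FiniteDimensional ℝ E] {s : M → ℝ} {x : M}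
    (hs : ContMDiffAt 𝓘(ℝ, E) 𝓘(ℝ, ℝ) ∞ s x) (h0 : s x = 0)
    (hne : chartDeriv E s x ≠ 0) {N : Set M} (hN : N ∈ 𝓝 x) :
    ∃ N' ∈ 𝓝 x, N' ⊆ N ∧ IsPreconnected (N' ∩ {y | s y < 0}) ∧
      IsPreconnected (N' ∩ {y | 0 < s y}) := by
  have := FiniteDimensional.complete ℝ E
  set a := chartAt E x
  have hN2 : {z | a.symm z ∈ N} ∩ a.target ∈ 𝓝 (a x) :=
    inter_mem (eventually_nhds_chartAt hN) (a.open_target.mem_nhds (mem_chart_target E x))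
  obtain ⟨N', hN', hsub, h1, h2⟩ := exists_nhds_isPreconnected_halves
    (hasStrictFDerivAt_comp_chartAt_symm hs) (by simpa using h0) hne hN2
  have hc : ContinuousOn a.symm N' := a.continuousOn_symm.mono fun z hz => (hsub hz).2
  have himg : ∀ C : Set ℝ, a.symm '' N' ∩ {y | s y ∈ C} =
      a.symm '' (N' ∩ {z | (s ∘ a.symm) z ∈ C}) := by
    intro C
    ext y
    constructor
    · rintro ⟨⟨z, hz, rfl⟩, hy⟩
      exact ⟨z, ⟨hz, hy⟩, rfl⟩
    · rintro ⟨z, ⟨hz, hy⟩, rfl⟩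
      exact ⟨⟨z, hz, rfl⟩, hy⟩
  refine ⟨a.symm '' N', ?_, ?_, ?_, ?_⟩
  · have := a.symm.image_mem_nhds (x := a x) (mem_chart_target E x) hN'
    rwa [a.left_inv (mem_chart_source E x)] at this
  · rintro _ ⟨z, hz, rfl⟩
    exact (hsub hz).1
  · have := h1.image a.symm (hc.mono inter_subset_left)
    exact (himg (Iio 0)) ▸ this
  · have := h2.image a.symm (hc.mono inter_subset_left)
    exact (himg (Ioi 0)) ▸ this

theorem exists_pos_mul_le_manifold {k s : M → ℝ} {x : M} {n : E}
    (hk : ContMDiffAt 𝓘(ℝ, E) 𝓘(ℝ, ℝ) ∞ k x)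
    (hs : ∀ᶠ y in 𝓝 x, ContMDiffAt 𝓘(ℝ, E) 𝓘(ℝ, ℝ) ∞ s y) (h0 : s x = 0)
    (hk0 : ∀ᶠ y in 𝓝 x, s y = 0 → k y = 0)
    (hkn : 0 < chartDeriv E k x n)
    (hsn : 0 < chartDeriv E s x n) :
    ∃ ε > 0, ∀ᶠ y in 𝓝 x, (0 ≤ s y → ε * s y ≤ k y) ∧ (s y ≤ 0 → k y ≤ ε * s y) := by
  obtain ⟨ε, hε, h⟩ := exists_pos_mul_le_of_hasStrictFDerivAt
    (hasStrictFDerivAt_comp_chartAt_symm hk) (hasStrictFDerivAt_comp_chartAt_symm hs.self_of_nhds)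
    (by simpa using h0) (eventually_nhds_chartAt hk0)
    ((eventually_contDiffAt_comp_chartAt_symm hs).mono fun z hz => hz.continuousAt) hkn hsn
  exact ⟨ε, hε, eventually_nhds_of_chartAt h⟩

end ManifoldCalculus

section TwoManifolds

variable {E F : Type*} [NormedAddCommGroup E] [NormedSpace ℝ E] [NormedAddCommGroup F]
  [NormedSpace ℝ F] {N : Type*} [TopologicalSpace N] [ChartedSpace E N]
  [IsManifold 𝓘(ℝ, E) ∞ N] {M : Type*} [TopologicalSpace M] [ChartedSpace F M]
  [IsManifold 𝓘(ℝ, F) ∞ M]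

omit [IsManifold 𝓘(ℝ, E) ∞ N] [IsManifold 𝓘(ℝ, F) ∞ M] in
/-- The derivative of a smooth immersion is injective. -/
theorem mfderiv_injective_of_isImmersionAt {f : N → M} {x : N}
    (h : Manifold.IsImmersionAt 𝓘(ℝ, E) 𝓘(ℝ, F) ∞ f x) :
    Function.Injective (mfderiv 𝓘(ℝ, E) 𝓘(ℝ, F) f x) := by
  set a := h.domChart
  set b := h.codChart
  have ha := h.mem_domChart_source
  have hb := h.mem_codChart_source
  have ham := h.domChart_mem_maximalAtlas
  have hbm := h.codChart_mem_maximalAtlas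
  have hf : MDifferentiableAt 𝓘(ℝ, E) 𝓘(ℝ, F) f x := h.contMDiffAt.mdifferentiableAt (by simp)
  have hb' : MDifferentiableAt 𝓘(ℝ, F) 𝓘(ℝ, F) b (f x) :=
    (contMDiffAt_of_mem_maximalAtlas hbm hb).mdifferentiableAt (by simp)
  have ha' : MDifferentiableAt 𝓘(ℝ, E) 𝓘(ℝ, E) a x :=
    (contMDiffAt_of_mem_maximalAtlas ham ha).mdifferentiableAt (by simp)
  have heq : b ∘ f =ᶠ[𝓝 x] (fun u => h.equiv (u, 0)) ∘ a := by
    filter_upwards [a.open_source.mem_nhds ha] with y hy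
    have hy' : a y ∈ (h.domChart.extend 𝓘(ℝ, E)).target := by
      simpa [mfld_simps] using a.map_source hy
    have := h.writtenInCharts hy'
    simpa [mfld_simps, a, b, h.domChart.left_inv hy] using this
  have hL : MDifferentiableAt 𝓘(ℝ, E) 𝓘(ℝ, F) (fun u => h.equiv (u, 0)) (a x) := by
    rw [mdifferentiableAt_iff_differentiableAt]
    fun_prop
  have had : a.MDifferentiable 𝓘(ℝ, E) 𝓘(ℝ, E) :=
    ⟨(contMDiffOn_of_mem_maximalAtlas ham).mdifferentiableOn (by simp),
      (contMDiffOn_symm_of_mem_maximalAtlas ham).mdifferentiableOn (by simp)⟩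
  have hchain : (mfderiv 𝓘(ℝ, F) 𝓘(ℝ, F) b (f x)).comp (mfderiv 𝓘(ℝ, E) 𝓘(ℝ, F) f x) =
      (mfderiv 𝓘(ℝ, E) 𝓘(ℝ, F) (fun u => h.equiv (u, 0)) (a x)).comp
        (mfderiv 𝓘(ℝ, E) 𝓘(ℝ, E) a x) := by
    rw [← mfderiv_comp x hb' hf, ← mfderiv_comp x hL ha', heq.mfderiv_eq]
  have hLi : Function.Injective (mfderiv 𝓘(ℝ, E) 𝓘(ℝ, F) (fun u => h.equiv (u, 0)) (a x)) := by
    have hd : HasFDerivAt (fun u => h.equiv (u, 0))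
        ((h.equiv : (E × h.complement) →L[ℝ] F).comp (ContinuousLinearMap.inl ℝ E h.complement))
        (a x) :=
      ((h.equiv : (E × h.complement) →L[ℝ] F).comp
        (ContinuousLinearMap.inl ℝ E h.complement)).hasFDerivAt
    rw [mfderiv_eq_fderiv, hd.fderiv]
    intro u u' huu
    have := h.equiv.injective huu
    exact (Prod.mk.inj this).1
  intro v w hvw
  apply had.mfderiv_injective ha
  apply hLi
  have h1 := DFunLike.congr_fun hchain v
  have h2 := DFunLike.congr_fun hchain w
  simp only [ContinuousLinearMap.comp_apply, hvw] at h1 h2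
  exact h1.symm.trans h2

/-- A codimension one immersion of manifolds is locally the zero set of a smooth function with
nonzero derivative. -/
theorem exists_contMDiff_equation [FiniteDimensional ℝ E] [FiniteDimensional ℝ F] {c : N → M}
    {x : N} (hdim : Module.finrank ℝ F = Module.finrank ℝ E + 1)
    (hc : ContMDiff 𝓘(ℝ, E) 𝓘(ℝ, F) ∞ c) (hinj : Function.Injective (mfderiv 𝓘(ℝ, E) 𝓘(ℝ, F) c x)) :
    ∃ (r : M → N) (v : M → ℝ), ContinuousAt r (c x) ∧ r (c x) = x ∧
      (∀ᶠ y in 𝓝 (c x), ContMDiffAt 𝓘(ℝ, F) 𝓘(ℝ, ℝ) ∞ v y) ∧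
      (∀ᶠ z in 𝓝 x, v (c z) = 0) ∧ (∀ᶠ y in 𝓝 (c x), v y = 0 → c (r y) = y) ∧
      chartDeriv F v (c x) ≠ 0 := by
  set b := chartAt F (c x) with hb
  set a := chartAt E x with ha
  have hbs : b.source ∈ 𝓝 (c x) := b.open_source.mem_nhds (mem_chart_source F (c x))
  have hk : ∀ᶠ z in 𝓝 x, ContMDiffAt 𝓘(ℝ, E) 𝓘(ℝ, F) ∞ (b ∘ c) z := by
    filter_upwards [hc.continuous.continuousAt.eventually hbs] with z hz
    exact ((contMDiffOn_chart (I := 𝓘(ℝ, F))).contMDiffAt (b.open_source.mem_nhds hz)).comp z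
      hc.contMDiffAt
  have hk' := eventually_contDiffAt_comp_chartAt_symm hk
  have hi : Function.Injective (fderiv ℝ ((b ∘ c) ∘ a.symm) (a x)) := by
    change Function.Injective (chartDeriv E (b ∘ c) x)
    rw [chartDeriv_eq_mfderiv (hk.self_of_nhds.mdifferentiableAt (by simp)),
      mfderiv_comp x ((contMDiffAt_of_mem_maximalAtlas (n := ∞) (IsManifold.chart_mem_maximalAtlas _)
        (mem_chart_source F (c x))).mdifferentiableAt (by simp))
        (hc.contMDiffAt.mdifferentiableAt (by simp))]
    exact ((mdifferentiable_chart (I := 𝓘(ℝ, F)) (c x)).mfderiv_injective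
      (mem_chart_source F (c x))).comp hinj
  obtain ⟨r, l, hr, hl, hrψ, hlψ, hlr, hne⟩ := exists_smooth_equation hdim hk' hi
  have hψx : ((b ∘ c) ∘ a.symm) (a x) = b (c x) := comp_chartAt_symm_apply (b ∘ c) x
  rw [hψx] at hr hl hlr hne
  have hrx : r (b (c x)) = a x := by
    have := hrψ.self_of_nhds
    rwa [hψx] at this
  have hbc : ContinuousAt b (c x) := b.continuousAt (mem_chart_source F (c x))
  have hrc : ContinuousAt (fun y => r (b y)) (c x) :=
    ContinuousAt.comp (f := b) hr.self_of_nhds.continuousAt hbc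
  refine ⟨fun y => a.symm (r (b y)), fun y => l (b y), ?_, ?_, ?_, ?_, ?_, ?_⟩
  · refine ContinuousAt.comp (f := fun y => r (b y)) (g := a.symm) ?_ hrc
    simp only [hrx]
    exact a.continuousAt_symm (mem_chart_target E x)
  · simp only [hrx]
    exact a.left_inv (mem_chart_source E x)
  · filter_upwards [hbc.eventually hl, hbs] with y hy hys
    exact hy.contMDiffAt.comp y
      ((contMDiffOn_chart (I := 𝓘(ℝ, F))).contMDiffAt (b.open_source.mem_nhds hys))
  · exact eventually_nhds_of_chartAt hlψ
  · have h1 : ∀ᶠ y in 𝓝 (c x), c (a.symm (r (b y))) ∈ b.source := by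
      have : ContinuousAt (fun y => c (a.symm (r (b y)))) (c x) := by
        refine ContinuousAt.comp (f := fun y => r (b y)) (g := fun z => c (a.symm z)) ?_ hrc
        simp only [hrx]
        exact ContinuousAt.comp (f := a.symm) hc.continuous.continuousAt
          (a.continuousAt_symm (mem_chart_target E x))
      refine this.eventually ?_
      simp only [hrx]
      rw [a.left_inv (mem_chart_source E x)]
      exact hbs
    filter_upwards [hbc.eventually hlr, h1, hbs] with y hy hy1 hys h0
    exact b.injOn hy1 hys (hy h0)
  · unfold chartDeriv
    have : (fun y => l (b y)) ∘ b.symm =ᶠ[𝓝 (b (c x))] l := by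
      filter_upwards [b.open_target.mem_nhds (mem_chart_target F (c x))] with z hz
      simp [b.right_inv hz]
    rw [this.fderiv_eq]
    exact hne

end TwoManifolds

/-! ### Isotopies of `S⁴` from small homogeneous perturbations of the identity of `ℝ⁵`. -/

section Homogeneous

variable {E : Type*} [NormedAddCommGroup E] [NormedSpace ℝ E]

/-- A map which is smooth away from the origin and positively homogeneous is Lipschitz. -/
theorem exists_norm_sub_le_of_homogeneous {E : Type*} [NormedAddCommGroup E]
    [InnerProductSpace ℝ E] [FiniteDimensional ℝ E] {W : E → E}
    (hW : ContDiffOn ℝ ∞ W {0}ᶜ) (hom : ∀ r : ℝ, 0 < r → ∀ x, W (r • x) = r • W x) :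
    ∃ L : ℝ, 0 < L ∧ ∀ x y, ‖W x - W y‖ ≤ L * ‖x - y‖ := by
  have hW0 : W 0 = 0 := by
    have := hom 2 two_pos 0
    rw [smul_zero, two_smul] at this
    simpa using this.symm
  -- The factor vanishes for `‖x‖² ≤ 1/2` and is `1` on the unit sphere, so `V` is smooth everywhere
  -- and agrees with `W` on the sphere. Its Lipschitz constant there is then spread out by
  -- homogeneity.
  let V : E → E := fun x => Real.smoothTransition (2 * ‖x‖ ^ 2 - 1) • W x
  have hV : ContDiff ℝ ∞ V := by
    rw [contDiff_iff_contDiffAt]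
    intro x
    by_cases hx : x = 0
    · have : V =ᶠ[𝓝 x] fun _ => 0 := by
        have hc : ContinuousAt (fun y : E => 2 * ‖y‖ ^ 2 - 1) x := by fun_prop
        filter_upwards [hc.eventually (gt_mem_nhds (by simp [hx] : 2 * ‖x‖ ^ 2 - 1 < 0))] with y hy
        simp [V, Real.smoothTransition.zero_of_nonpos hy.le]
      exact contDiffAt_const.congr_of_eventuallyEq this
    · have h1 : ContDiffAt ℝ ∞ W x := hW.contDiffAt (isOpen_compl_singleton.mem_nhds hx)
      have h2 : ContDiffAt ℝ ∞ (fun x : E => 2 * ‖x‖ ^ 2 - 1) x :=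
        ((contDiff_const.mul (contDiff_norm_sq ℝ)).sub contDiff_const).contDiffAt
      exact (Real.smoothTransition.contDiff.contDiffAt.comp x h2).smul h1
  obtain ⟨K, hK⟩ := (hV.contDiffOn (s := Metric.closedBall 0 1)).exists_lipschitzOnWith (by simp)
    (convex_closedBall 0 1) (isCompact_closedBall 0 1)
  have hVW : ∀ x : E, ‖x‖ = 1 → V x = W x := by
    intro x hx
    simp [V, hx, Real.smoothTransition.one_of_one_le (x := 2 - 1) (by norm_num)]
  have hLip : ∀ x y : E, ‖x‖ = 1 → ‖y‖ = 1 → ‖W x - W y‖ ≤ K * ‖x - y‖ := by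
    intro x y hx hy
    rw [← hVW x hx, ← hVW y hy]
    have := hK.dist_le_mul x (by simp [hx]) y (by simp [hy])
    simpa [dist_eq_norm] using this
  obtain ⟨C, hC⟩ : ∃ C, ∀ x : E, ‖x‖ = 1 → ‖W x‖ ≤ C := by
    obtain ⟨C, hC⟩ := (isCompact_sphere (0 : E) 1).exists_bound_of_continuousOn
      hV.continuous.continuousOn
    refine ⟨C, fun x hx => ?_⟩
    rw [← hVW x hx]
    exact hC x (by simpa using hx)
  set C' := max C 0
  have hC0 : 0 ≤ C' := le_max_right _ _
  have hnorm : ∀ x : E, x ≠ 0 → ‖(‖x‖⁻¹ • x)‖ = 1 := fun x hx => by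
    rw [norm_smul, norm_inv, norm_norm, inv_mul_cancel₀ (norm_ne_zero_iff.2 hx)]
  have hpol : ∀ x : E, x ≠ 0 → W x = ‖x‖ • W (‖x‖⁻¹ • x) := fun x hx => by
    rw [← hom _ (norm_pos_iff.2 hx), smul_smul, mul_inv_cancel₀ (norm_ne_zero_iff.2 hx), one_smul]
  have hbd : ∀ x : E, ‖W x‖ ≤ C' * ‖x‖ := by
    intro x
    by_cases hx : x = 0
    · simp [hx, hW0]
    · rw [hpol x hx, norm_smul, norm_norm, mul_comm]
      gcongr
      exact (hC _ (hnorm x hx)).trans (le_max_left _ _)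
  refine ⟨C' + 2 * K + 1, by positivity, fun x y => ?_⟩
  by_cases hx : x = 0
  · subst hx
    rw [hW0, zero_sub, norm_neg, zero_sub, norm_neg]
    refine (hbd y).trans ?_
    gcongr
    have := K.coe_nonneg
    linarith
  by_cases hy : y = 0
  · subst hy
    rw [hW0, sub_zero, sub_zero]
    refine (hbd x).trans ?_
    gcongr
    have := K.coe_nonneg
    linarith
  set x' := ‖x‖⁻¹ • x with hx'
  set y' := ‖y‖⁻¹ • y with hy'
  -- The radial change and the angular change are estimated separately.
  have hsub : W x - W y = (‖x‖ - ‖y‖) • W x' + ‖y‖ • (W x' - W y') := by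
    rw [hpol x hx, hpol y hy, sub_smul, smul_sub]; abel
  have hy1 : ‖y‖ * ‖x' - y'‖ ≤ 2 * ‖x - y‖ := by
    have h1 : ‖y‖ • (x' - y') = (x - y) + (‖y‖ - ‖x‖) • x' := by
      have e1 : ‖x‖ • x' = x := by
        rw [hx', smul_smul, mul_inv_cancel₀ (norm_ne_zero_iff.2 hx), one_smul]
      have e2 : ‖y‖ • y' = y := by
        rw [hy', smul_smul, mul_inv_cancel₀ (norm_ne_zero_iff.2 hy), one_smul]
      rw [smul_sub, sub_smul, e1, e2]; abel
    calc ‖y‖ * ‖x' - y'‖ = ‖‖y‖ • (x' - y')‖ := by rw [norm_smul, norm_norm]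
      _ ≤ ‖x - y‖ + |‖y‖ - ‖x‖| * ‖x'‖ := by
        rw [h1]; refine (norm_add_le _ _).trans ?_
        rw [norm_smul, Real.norm_eq_abs]
      _ ≤ 2 * ‖x - y‖ := by
        rw [hnorm x hx, mul_one]
        have := abs_norm_sub_norm_le y x
        rw [norm_sub_rev y x] at this
        linarith
  calc ‖W x - W y‖ ≤ |‖x‖ - ‖y‖| * ‖W x'‖ + ‖y‖ * ‖W x' - W y'‖ := by
        rw [hsub]; refine (norm_add_le _ _).trans ?_
        rw [norm_smul, norm_smul, Real.norm_eq_abs, norm_norm]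
    _ ≤ ‖x - y‖ * C' + ‖y‖ * (K * ‖x' - y'‖) := by
        gcongr
        · exact abs_norm_sub_norm_le x y
        · exact (hC _ (hnorm x hx)).trans (le_max_left _ _)
        · exact hLip _ _ (hnorm x hx) (hnorm y hy)
    _ ≤ (C' + 2 * K + 1) * ‖x - y‖ := by
        have := mul_le_mul_of_nonneg_left hy1 K.coe_nonneg
        nlinarith [norm_nonneg (x - y)]

omit [NormedSpace ℝ E] in
/-- A perturbation of the identity by a map with Lipschitz constant less than one is bijective. -/
theorem bijective_add_of_norm_sub_le [CompleteSpace E] {U : E → E} {K : ℝ} (hK0 : 0 ≤ K)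
    (hK : K < 1) (hU : ∀ x y, ‖U x - U y‖ ≤ K * ‖x - y‖) :
    Function.Bijective fun x => x + U x := by
  constructor
  · intro x y hxy
    have h1 : x - y = -(U x - U y) := by
      have : x + U x = y + U y := hxy
      rw [neg_sub, sub_eq_sub_iff_add_eq_add, this, add_comm]
    have h2 := hU x y
    rw [← norm_neg (U x - U y), ← h1] at h2
    have : ‖x - y‖ = 0 := by nlinarith [norm_nonneg (x - y)]
    exact sub_eq_zero.1 (norm_eq_zero.1 this)
  · intro y
    -- A fixed point of this contraction solves `x + U x = y`.
    have hc : ContractingWith ⟨K, hK0⟩ fun x => y - U x := by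
      refine ⟨by exact_mod_cast hK, LipschitzWith.of_dist_le_mul fun a b => ?_⟩
      rw [dist_eq_norm, dist_eq_norm, sub_sub_sub_cancel_left, norm_sub_rev]
      exact hU a b
    have := hc.fixedPoint_isFixedPt
    refine ⟨hc.fixedPoint, ?_⟩
    have h : y - U hc.fixedPoint = hc.fixedPoint := this
    change hc.fixedPoint + U hc.fixedPoint = y
    nth_rewrite 1 [← h]
    abel

end Homogeneous

section Track

variable {E : Type*} [NormedAddCommGroup E] [NormedSpace ℝ E] [FiniteDimensional ℝ E]

/-- The inverse of a smooth family of small perturbations of the identity is smooth. -/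
theorem contDiffAt_inverse_of_perturbation {W : E → E} {b : ℝ → ℝ} {L : ℝ}
    (hW : ContDiffOn ℝ ∞ W {0}ᶜ) (hW0 : W 0 = 0) (hL : ∀ x y, ‖W x - W y‖ ≤ L * ‖x - y‖)
    (hb : ContDiff ℝ ∞ b) (hbL : ∀ t, |b t| * L < 1) {g : ℝ × E → ℝ × E}
    (hg1 : ∀ t x, g (t, x + b t • W x) = (t, x))
    (hg2 : ∀ p, ((g p).1, (g p).2 + b (g p).1 • W (g p).2) = p) {q : ℝ × E} (hq : q.2 ≠ 0) :
    ContDiffAt ℝ ∞ g q := by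
  have hcomp := FiniteDimensional.complete ℝ E
  set F : ℝ × E → ℝ × E := fun p => (p.1, p.2 + b p.1 • W p.2) with hF
  set p := g q with hp
  have hFp : F p = q := hg2 q
  have hp2 : p.2 ≠ 0 := by
    intro h0
    apply hq
    rw [← hFp]
    simp [F, h0, hW0]
  have hWc : ∀ y : E, y ≠ 0 → ContDiffAt ℝ ∞ W y := fun y hy =>
    hW.contDiffAt (isOpen_compl_singleton.mem_nhds hy)
  have hsm : ∀ᶠ y in 𝓝 p, ContDiffAt ℝ ∞ F y := by
    have : ∀ᶠ y : ℝ × E in 𝓝 p, y.2 ≠ 0 :=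
      continuousAt_snd.eventually (isOpen_compl_singleton.mem_nhds hp2)
    filter_upwards [this] with y hy
    exact contDiffAt_fst.prodMk (contDiffAt_snd.add
      ((hb.contDiffAt.comp y contDiffAt_fst).smul ((hWc _ hy).comp y contDiffAt_snd)))
  set A := fderiv ℝ W p.2 with hA
  have hWd : HasFDerivAt W A p.2 := ((hWc _ hp2).differentiableAt (by simp)).hasFDerivAt
  have hAb : ∀ v, ‖A v‖ ≤ L * ‖v‖ := by
    have hL0 : 0 ≤ L ∨ ∀ v : E, v = 0 := by
      by_contra! h
      obtain ⟨hneg, v, hv⟩ := h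
      have := hL v 0
      have h2 : 0 < ‖v - 0‖ := by simpa using hv
      nlinarith [norm_nonneg (W v - W 0)]
    rcases hL0 with h | h
    · have : ‖A‖ ≤ L := hWd.le_of_lip' h (Eventually.of_forall fun x => hL x p.2)
      exact fun v => (A.le_opNorm v).trans (by gcongr)
    · intro v; simp [h v]
  have hbd : HasDerivAt b (deriv b p.1) p.1 :=
    ((hb.differentiable (by simp)) p.1).hasDerivAt
  set b' := deriv b p.1
  let T : (ℝ × E) →L[ℝ] (ℝ × E) := (ContinuousLinearMap.fst ℝ ℝ E).prod
    (ContinuousLinearMap.snd ℝ ℝ E + (b p.1 • A.comp (ContinuousLinearMap.snd ℝ ℝ E) +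
      (b' • ContinuousLinearMap.fst ℝ ℝ E).smulRight (W p.2)))
  have hT : HasFDerivAt F T p := by
    have h1 : HasFDerivAt (fun y : ℝ × E => b y.1) (b' • ContinuousLinearMap.fst ℝ ℝ E) p :=
      hbd.comp_hasFDerivAt p hasFDerivAt_fst
    have h2 : HasFDerivAt (fun y : ℝ × E => W y.2) (A.comp (ContinuousLinearMap.snd ℝ ℝ E)) p :=
      HasFDerivAt.comp p hWd hasFDerivAt_snd
    exact hasFDerivAt_fst.prodMk (hasFDerivAt_snd.add (h1.smul h2))
  -- A kernel vector has time component `0`, and its other component satisfies `v = -(b p.1 • A v)`.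
  -- As `|b p.1| * L < 1`, it is `0`.
  have hTinj : Function.Injective T.toLinearMap := by
    rw [← LinearMap.ker_eq_bot, LinearMap.ker_eq_bot']
    rintro ⟨s, v⟩ h
    have h' : T (s, v) = 0 := h
    simp only [T, ContinuousLinearMap.prod_apply, add_apply,
      smul_apply, ContinuousLinearMap.comp_apply,
      ContinuousLinearMap.smulRight_apply, ContinuousLinearMap.coe_fst',
      ContinuousLinearMap.coe_snd', Prod.mk_eq_zero] at h'
    obtain ⟨hs, hv⟩ := h'
    subst hs
    simp only [smul_zero, zero_smul, add_zero] at hv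
    have h1 : v = -(b p.1 • A v) := eq_neg_of_add_eq_zero_left hv
    have h2 : ‖v‖ ≤ |b p.1| * (L * ‖v‖) := by
      calc ‖v‖ = ‖-(b p.1 • A v)‖ := by rw [← h1]
        _ = |b p.1| * ‖A v‖ := by rw [norm_neg, norm_smul, Real.norm_eq_abs]
        _ ≤ _ := by gcongr; exact hAb v
    have h3 := hbL p.1
    have : ‖v‖ = 0 := by nlinarith [norm_nonneg v]
    rw [norm_eq_zero.1 this]; rfl
  let T' : (ℝ × E) ≃L[ℝ] (ℝ × E) :=
    (LinearEquiv.ofInjectiveEndo T.toLinearMap hTinj).toContinuousLinearEquiv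
  have hT' : HasFDerivAt F (T' : (ℝ × E) →L[ℝ] (ℝ × E)) p := hT
  obtain ⟨e, hes, hef, hsy⟩ := exists_smooth_localInverse hsm hT'
  rw [hFp] at hsy
  refine hsy.self_of_nhds.congr_of_eventuallyEq ?_
  have het : e.target ∈ 𝓝 q := e.open_target.mem_nhds (by
    rw [← hFp, ← hef]; exact e.map_source hes)
  filter_upwards [het] with y hy
  have h1 : F (e.symm y) = y := by
    have := e.right_inv hy
    rwa [hef] at this
  have h2 := hg1 (e.symm y).1 (e.symm y).2
  have h3 : g (F (e.symm y)) = e.symm y := h2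
  rw [h1] at h3
  exact h3

end Track

/-- `ℝ⁵`, the ambient space of `S⁴`. -/
abbrev E5 : Type := EuclideanSpace ℝ (Fin 5)

/-- `ℝ⁴`, the ambient space of `S³`. -/
abbrev E4 : Type := EuclideanSpace ℝ (Fin 4)

instance : Fact (Module.finrank ℝ E5 = 4 + 1) := ⟨finrank_euclideanSpace_fin⟩

instance : Fact (Module.finrank ℝ E4 = 3 + 1) := ⟨finrank_euclideanSpace_fin⟩

section Isotopy

theorem IsIsotopicToId.comp {Ψ Φ : S4 → S4} (hΨ : IsIsotopicToId Ψ) (hΦ : IsIsotopicToId Φ) :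
    IsIsotopicToId (Ψ ∘ Φ) := by
  obtain ⟨H, h1, h2, h3⟩ := hΨ
  obtain ⟨K, k1, k2, k3⟩ := hΦ
  refine ⟨K.trans H, fun t x => ?_, fun x => ?_, fun x => ?_⟩
  · rw [Diffeomorph.coe_trans, Function.comp_apply]
    have : K (t, x) = (t, (K (t, x)).2) := Prod.ext (k1 t x) rfl
    rw [this, h1]
  · rw [Diffeomorph.coe_trans, Function.comp_apply, k2, h2]
  · rw [Diffeomorph.coe_trans, Function.comp_apply, k3, h3]; rfl

theorem IsIsotopicToId.id : IsIsotopicToId id :=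
  ⟨Diffeomorph.refl _ _ _, fun _ _ => rfl, fun _ => rfl, fun _ => rfl⟩

theorem IsIsotopicToId.iterate {Ψ : S4 → S4} (hΨ : IsIsotopicToId Ψ) (n : ℕ) :
    IsIsotopicToId Ψ^[n] := by
  induction n with
  | zero => exact .id
  | succ n ih => exact ih.comp hΨ

/-- The inverse of the track is again level preserving, and the time one level of both tracks gives
a diffeomorphism with its inverse. -/
theorem IsIsotopicToId.exists_inverse {Ψ : S4 → S4} (hΨ : IsIsotopicToId Ψ) :
    ∃ Φ : S4 ≃ₘ^∞⟮𝓡 4, 𝓡 4⟯ S4, (∀ x, Φ x = Ψ x) ∧ IsIsotopicToId Φ.symm := by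
  obtain ⟨H, h1, h2, h3⟩ := hΨ
  have s1 : ∀ t x, (H.symm (t, x)).1 = t := by
    intro t x
    have := h1 (H.symm (t, x)).1 (H.symm (t, x)).2
    rw [Prod.mk.eta, H.apply_symm_apply] at this
    exact this.symm
  have s2 : ∀ x, H.symm (0, x) = (0, x) := fun x => by
    nth_rewrite 1 [← h2 x]; exact H.symm_apply_apply _
  have s3 : ∀ x, H.symm (1, Ψ x) = (1, x) := fun x => by
    rw [← h3 x]; exact H.symm_apply_apply _
  have hι : ContMDiff (𝓡 4) (𝓘(ℝ, ℝ).prod (𝓡 4)) ∞ (fun x : S4 => ((1 : ℝ), x)) :=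
    contMDiff_const.prodMk contMDiff_id
  refine ⟨⟨⟨Ψ, fun x => (H.symm (1, x)).2, fun x => congrArg Prod.snd (s3 x), fun x => ?_⟩, ?_, ?_⟩,
    fun x => rfl, ⟨H.symm, s1, s2, fun x => ?_⟩⟩
  · have h4 : H.symm (1, x) = (1, (H.symm (1, x)).2) := Prod.ext (s1 1 x) rfl
    have h5 := h3 (H.symm (1, x)).2
    rw [← h4, H.apply_symm_apply] at h5
    exact (Prod.mk.inj h5).2.symm
  · have : Ψ = fun x => (H (1, x)).2 := by funext x; rw [h3]
    change ContMDiff (𝓡 4) (𝓡 4) ∞ Ψ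
    rw [this]
    exact contMDiff_snd.comp (H.contMDiff.comp hι)
  · exact contMDiff_snd.comp (H.symm.contMDiff.comp hι)
  · exact Prod.ext (s1 1 x) rfl

/-- The diffeomorphism `R` need not be isotopic to the identity; this serves for the reflection in
the equator, which reverses orientation. -/
theorem IsIsotopicToId.conj {Ψ : S4 → S4} (hΨ : IsIsotopicToId Ψ) (R : S4 ≃ₘ^∞⟮𝓡 4, 𝓡 4⟯ S4) :
    IsIsotopicToId (R.symm ∘ Ψ ∘ R) := by
  obtain ⟨H, h1, h2, h3⟩ := hΨ
  refine ⟨(((Diffeomorph.refl 𝓘(ℝ, ℝ) ℝ ∞).prodCongr R).trans H).trans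
    ((Diffeomorph.refl 𝓘(ℝ, ℝ) ℝ ∞).prodCongr R).symm, fun t x => ?_, fun x => ?_, fun x => ?_⟩
  · change (H (t, R x)).1 = t
    exact h1 _ _
  · change ((H (0, R x)).1, R.symm (H (0, R x)).2) = _
    rw [h2, R.symm_apply_apply]
  · change ((H (1, R x)).1, R.symm (H (1, R x)).2) = _
    rw [h3]; rfl

end Isotopy

section NearIdentity

theorem ContMDiff.normalize {N : Type*} {E : Type*} [NormedAddCommGroup E] [NormedSpace ℝ E]
    {H : Type*} [TopologicalSpace H] {I : ModelWithCorners ℝ E H} [TopologicalSpace N]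
    [ChartedSpace H N] {f : N → E5} (hf : ContMDiff I 𝓘(ℝ, E5) ∞ f)
    (h0 : ∀ x, f x ≠ 0) : ContMDiff I 𝓘(ℝ, E5) ∞ fun x => ‖f x‖⁻¹ • f x := by
  have h : ∀ y : E5, y ≠ 0 → ContDiffAt ℝ ∞ (fun y : E5 => ‖y‖⁻¹ • y) y := fun y hy =>
    ((contDiffAt_norm ℝ hy).inv (norm_ne_zero_iff.2 hy)).smul contDiffAt_id
  exact fun x => (h _ (h0 x)).contMDiffAt.comp x (hf x)

theorem norm_normalize {E : Type*} [NormedAddCommGroup E] [NormedSpace ℝ E] {x : E} (hx : x ≠ 0) :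
    ‖(‖x‖⁻¹ • x)‖ = 1 := by
  rw [norm_smul, norm_inv, norm_norm, inv_mul_cancel₀ (norm_ne_zero_iff.2 hx)]

theorem S4.norm_eq (q : S4) : ‖(q : E5)‖ = 1 := norm_eq_of_mem_sphere q

theorem S4.ne_zero (q : S4) : (q : E5) ≠ 0 := ne_zero_of_mem_unit_sphere q

/-- A small positively homogeneous perturbation of the identity of `ℝ⁵` induces a diffeomorphism of
`S⁴` which is isotopic to the identity. -/
theorem exists_isotopic_perturbation {W : E5 → E5} (hW : ContDiffOn ℝ ∞ W {0}ᶜ)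
    (hom : ∀ r : ℝ, 0 < r → ∀ x, W (r • x) = r • W x) :
    ∃ ε₀ > 0, ∀ ε : ℝ, 0 < ε → ε < ε₀ → ∃ Ψ : S4 → S4, IsIsotopicToId Ψ ∧
      ∀ q : S4, ∃ r : ℝ, 0 < r ∧ (q : E5) + ε • W q = r • (Ψ q : E5) := by
  obtain ⟨L, hL0, hL⟩ := exists_norm_sub_le_of_homogeneous hW hom
  have hW0 : W 0 = 0 := by
    have := hom 2 two_pos 0
    rw [smul_zero, two_smul] at this
    simpa using this.symm
  refine ⟨L⁻¹, by positivity, fun ε hε hε0 => ?_⟩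
  have hεL : ε * L < 1 := by
    calc ε * L < L⁻¹ * L := by gcongr
      _ = 1 := inv_mul_cancel₀ hL0.ne'
  -- The smooth transition lets the track live over all of `ℝ`, with values in `[0, ε]`, `b 0 = 0`
  -- and `b 1 = ε`.
  set b : ℝ → ℝ := fun t => ε * Real.smoothTransition t with hb
  have hbs : ContDiff ℝ ∞ b := contDiff_const.mul Real.smoothTransition.contDiff
  have hb0 : ∀ t, 0 ≤ b t := fun t => mul_nonneg hε.le (Real.smoothTransition.nonneg t)
  have hbε : ∀ t, b t ≤ ε := fun t => by
    simpa using mul_le_mul_of_nonneg_left (Real.smoothTransition.le_one t) hε.le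
  have hbL : ∀ t, |b t| * L < 1 := fun t => by
    rw [abs_of_nonneg (hb0 t)]
    exact (mul_le_mul_of_nonneg_right (hbε t) hL0.le).trans_lt hεL
  have hbij : ∀ t, Function.Bijective fun x : E5 => x + b t • W x := fun t => by
    refine bijective_add_of_norm_sub_le (K := |b t| * L) (by positivity) (hbL t) fun x y => ?_
    rw [← smul_sub, norm_smul, Real.norm_eq_abs, mul_assoc]
    gcongr
    exact hL x y
  let g : ℝ × E5 → ℝ × E5 := fun p => (p.1, (Equiv.ofBijective _ (hbij p.1)).symm p.2)
  have hg1 : ∀ t x, g (t, x + b t • W x) = (t, x) := fun t x =>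
    Prod.ext rfl ((Equiv.ofBijective _ (hbij t)).symm_apply_apply x)
  have hg2 : ∀ p, ((g p).1, (g p).2 + b (g p).1 • W (g p).2) = p := fun p =>
    Prod.ext rfl ((Equiv.ofBijective _ (hbij p.1)).apply_symm_apply p.2)
  have hgs : ∀ q : ℝ × E5, q.2 ≠ 0 → ContDiffAt ℝ ∞ g q := fun q hq =>
    contDiffAt_inverse_of_perturbation hW hW0 hL hbs hbL hg1 hg2 hq
  have hF0 : ∀ t (x : E5), x ≠ 0 → x + b t • W x ≠ 0 := fun t x hx h =>
    hx ((hbij t).1 (by simp [h, hW0]))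
  have hG0 : ∀ t (y : E5), y ≠ 0 → (g (t, y)).2 ≠ 0 := fun t y hy h => by
    have := hg2 (t, y)
    rw [h, hW0, smul_zero, add_zero] at this
    exact hy (Prod.mk.inj this).2.symm
  -- The inverse is positively homogeneous as well, so the two maps remain inverse to each other
  -- after normalization to the sphere.
  have hghom : ∀ t (r : ℝ), 0 < r → ∀ y, (g (t, r • y)).2 = r • (g (t, y)).2 := fun t r hr y => by
    have h1 : y = (g (t, y)).2 + b t • W (g (t, y)).2 := (Prod.mk.inj (hg2 (t, y))).2.symm
    nth_rewrite 1 [h1]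
    rw [smul_add, smul_comm, ← hom r hr, hg1]
  have hco : ContMDiff (𝓘(ℝ, ℝ).prod (𝓡 4)) 𝓘(ℝ, ℝ × E5) ∞
      (fun p : ℝ × S4 => (p.1, (p.2 : E5))) :=
    contMDiff_fst.prodMk_space (contMDiff_coe_sphere.comp contMDiff_snd)
  have hf1 : ContMDiff (𝓘(ℝ, ℝ).prod (𝓡 4)) 𝓘(ℝ, E5) ∞
      (fun p : ℝ × S4 => (p.2 : E5) + b p.1 • W p.2) := by
    intro p
    have : ContDiffAt ℝ ∞ (fun p : ℝ × E5 => p.2 + b p.1 • W p.2) (p.1, (p.2 : E5)) :=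
      contDiffAt_snd.add ((hbs.contDiffAt.comp _ contDiffAt_fst).smul
        (ContDiffAt.comp (g := W) (f := Prod.snd) (p.1, (p.2 : E5))
          (hW.contDiffAt (isOpen_compl_singleton.mem_nhds (S4.ne_zero p.2))) contDiffAt_snd))
    exact ContMDiffAt.comp (g := fun p : ℝ × E5 => p.2 + b p.1 • W p.2)
      (f := fun p : ℝ × S4 => (p.1, (p.2 : E5))) p this.contMDiffAt (hco p)
  have hf2 : ContMDiff (𝓘(ℝ, ℝ).prod (𝓡 4)) 𝓘(ℝ, E5) ∞
      (fun p : ℝ × S4 => (g (p.1, (p.2 : E5))).2) := by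
    intro p
    exact ContMDiffAt.comp (g := fun p : ℝ × E5 => (g p).2)
      (f := fun p : ℝ × S4 => (p.1, (p.2 : E5))) p
      (ContDiffAt.snd (hgs (p.1, (p.2 : E5)) (S4.ne_zero p.2))).contMDiffAt (hco p)
  have n1 : ∀ p : ℝ × S4, (p.2 : E5) + b p.1 • W p.2 ≠ 0 := fun p => hF0 _ _ (S4.ne_zero p.2)
  have n2 : ∀ p : ℝ × S4, (g (p.1, (p.2 : E5))).2 ≠ 0 := fun p => hG0 _ _ (S4.ne_zero p.2)
  let f1 : ℝ × S4 → S4 := fun p => ⟨‖(p.2 : E5) + b p.1 • W p.2‖⁻¹ • ((p.2 : E5) + b p.1 • W p.2),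
    by rw [mem_sphere_zero_iff_norm]; exact norm_normalize (n1 p)⟩
  let f2 : ℝ × S4 → S4 := fun p => ⟨‖(g (p.1, (p.2 : E5))).2‖⁻¹ • (g (p.1, (p.2 : E5))).2,
    by rw [mem_sphere_zero_iff_norm]; exact norm_normalize (n2 p)⟩
  have hf1s : ContMDiff (𝓘(ℝ, ℝ).prod (𝓡 4)) (𝓡 4) ∞ f1 :=
    ContMDiff.codRestrict_sphere (ContMDiff.normalize hf1 n1) _
  have hf2s : ContMDiff (𝓘(ℝ, ℝ).prod (𝓡 4)) (𝓡 4) ∞ f2 :=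
    ContMDiff.codRestrict_sphere (ContMDiff.normalize hf2 n2) _
  have hcancel : ∀ (r : ℝ) (q : S4), 0 < r → ‖r • (q : E5)‖⁻¹ • r • (q : E5) = q := by
    intro r q hr
    rw [norm_smul, S4.norm_eq, mul_one, Real.norm_eq_abs, abs_of_pos hr, smul_smul,
      inv_mul_cancel₀ hr.ne', one_smul]
  let H : (ℝ × S4) ≃ₘ^∞⟮𝓘(ℝ, ℝ).prod (𝓡 4), 𝓘(ℝ, ℝ).prod (𝓡 4)⟯ (ℝ × S4) :=
    { toFun := fun p => (p.1, f1 p)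
      invFun := fun p => (p.1, f2 p)
      left_inv := by
        rintro ⟨t, q⟩
        refine Prod.ext rfl (Subtype.ext ?_)
        change ‖(g (t, ‖(q : E5) + b t • W q‖⁻¹ • ((q : E5) + b t • W q))).2‖⁻¹ •
          (g (t, ‖(q : E5) + b t • W q‖⁻¹ • ((q : E5) + b t • W q))).2 = (q : E5)
        have hpos : 0 < ‖(q : E5) + b t • W q‖⁻¹ := inv_pos.2 (norm_pos_iff.2 (n1 (t, q)))
        rw [hghom _ _ hpos, hg1]
        exact hcancel _ q hpos
      right_inv := by
        rintro ⟨t, q⟩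
        refine Prod.ext rfl (Subtype.ext ?_)
        have h1 : (g (t, (q : E5))).2 + b t • W (g (t, (q : E5))).2 = q :=
          (Prod.mk.inj (hg2 (t, (q : E5)))).2
        set y := (g (t, (q : E5))).2 with hy
        have hpos : 0 < ‖y‖⁻¹ := inv_pos.2 (norm_pos_iff.2 (n2 (t, q)))
        change ‖‖y‖⁻¹ • y + b t • W (‖y‖⁻¹ • y)‖⁻¹ • (‖y‖⁻¹ • y + b t • W (‖y‖⁻¹ • y)) = (q : E5)
        rw [hom _ hpos, smul_comm (b t), ← smul_add, h1]
        exact hcancel _ q hpos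
      contMDiff_toFun := contMDiff_fst.prodMk hf1s
      contMDiff_invFun := contMDiff_fst.prodMk hf2s }
  refine ⟨fun q => f1 (1, q), ⟨H, fun _ _ => rfl, fun x => ?_, fun _ => rfl⟩, fun q => ?_⟩
  · refine Prod.ext rfl (Subtype.ext ?_)
    change ‖(x : E5) + b 0 • W x‖⁻¹ • ((x : E5) + b 0 • W x) = x
    have hb00 : b 0 = 0 := by simp [hb]
    rw [hb00, zero_smul, add_zero, S4.norm_eq, inv_one, one_smul]
  · have hb1 : b 1 = ε := by simp [hb]
    have hne := n1 (1, q)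
    simp only [hb1] at hne
    refine ⟨‖(q : E5) + ε • W q‖, norm_pos_iff.2 hne, ?_⟩
    change _ = ‖(q : E5) + ε • W q‖ • (‖(q : E5) + b 1 • W q‖⁻¹ • ((q : E5) + b 1 • W q))
    rw [hb1, smul_smul, mul_inv_cancel₀ (norm_ne_zero_iff.2 hne), one_smul]

end NearIdentity

/-! ### Coordinates on `ℝ⁵`, and graphs over the equator as equatorial spheres. -/

section Coordinates

/-- The first four coordinates of a point of `ℝ⁵`. -/
noncomputable def hor : E5 →L[ℝ] E4 :=
  LinearMap.toContinuousLinearMap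
    { toFun := fun x => WithLp.toLp 2 fun i : Fin 4 => x i.castSucc
      map_add' := fun _ _ => rfl
      map_smul' := fun _ _ => rfl }

/-- The last coordinate of a point of `ℝ⁵`. -/
noncomputable def ver : E5 →L[ℝ] ℝ := EuclideanSpace.proj (Fin.last 4)

/-- The identification of `ℝ⁴ × ℝ` with `ℝ⁵`. -/
noncomputable def emb : E4 × ℝ →L[ℝ] E5 :=
  LinearMap.toContinuousLinearMap
    { toFun := fun p => WithLp.toLp 2 (Fin.snoc (fun i : Fin 4 => p.1 i) p.2)
      map_add' := fun p q => by
        ext i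
        refine Fin.lastCases ?_ (fun i => ?_) i
        · simp [-Fin.reduceLast]
        · simp
      map_smul' := fun r p => by
        ext i
        refine Fin.lastCases ?_ (fun i => ?_) i
        · simp [-Fin.reduceLast]
        · simp }

theorem hor_apply (x : E5) (i : Fin 4) : hor x i = x i.castSucc := rfl

theorem ver_apply (x : E5) : ver x = x (Fin.last 4) := rfl

theorem emb_castSucc (p : E4 × ℝ) (i : Fin 4) : emb p i.castSucc = p.1 i :=
  Fin.snoc_castSucc (α := fun _ => ℝ) (x := p.2) (p := fun i : Fin 4 => p.1 i) (i := i)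

theorem emb_last (p : E4 × ℝ) : emb p (Fin.last 4) = p.2 :=
  Fin.snoc_last (α := fun _ => ℝ) p.2 (fun i : Fin 4 => p.1 i)

@[simp]
theorem hor_emb (p : E4 × ℝ) : hor (emb p) = p.1 := by
  ext i; rw [hor_apply, emb_castSucc]

@[simp]
theorem ver_emb (p : E4 × ℝ) : ver (emb p) = p.2 := by
  rw [ver_apply, emb_last]

@[simp]
theorem emb_hor_ver (x : E5) : emb (hor x, ver x) = x := by
  ext i
  refine Fin.lastCases ?_ (fun i => ?_) i
  · rw [emb_last, ver_apply]
  · rw [emb_castSucc, hor_apply]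

theorem norm_sq_eq_hor_ver (x : E5) : ‖x‖ ^ 2 = ‖hor x‖ ^ 2 + ver x ^ 2 := by
  rw [EuclideanSpace.norm_sq_eq, EuclideanSpace.norm_sq_eq, Fin.sum_univ_castSucc]
  simp [hor_apply, ver_apply, -Fin.reduceLast]

theorem ext_hor_ver {x y : E5} (h1 : hor x = hor y) (h2 : ver x = ver y) : x = y := by
  rw [← emb_hor_ver x, h1, h2, emb_hor_ver]

theorem coe_equator (p : S3) : (equator p : E5) = emb ((p : E4), 0) := rfl

theorem height_eq (q : S4) : height q = ver q := rfl

theorem liesOver_iff (q : S4) (p : S3) :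
    LiesOver q p ↔ ∃ r : ℝ, 0 < r ∧ hor q = r • (p : E4) := by
  refine exists_congr fun r => and_congr_right fun _ => ?_
  constructor
  · intro h; ext i; exact h i
  · intro h i; rw [← hor_apply, h]; rfl

theorem S3.norm_eq (p : S3) : ‖(p : E4)‖ = 1 := norm_eq_of_mem_sphere p

theorem S3.ne_zero (p : S3) : (p : E4) ≠ 0 := ne_zero_of_mem_unit_sphere p

/-- The reflection of `S⁴` in the hyperplane of the equator. -/
noncomputable def reflect : S4 ≃ₘ^∞⟮𝓡 4, 𝓡 4⟯ S4 :=
  have hmem : ∀ q : S4, emb (hor q, -ver q) ∈ Metric.sphere (0 : E5) 1 := fun q => by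
    have h1 := norm_sq_eq_hor_ver (emb (hor q, -ver q))
    have h2 := norm_sq_eq_hor_ver (q : E5)
    rw [hor_emb, ver_emb, neg_sq, ← h2, S4.norm_eq] at h1
    rw [mem_sphere_zero_iff_norm]
    nlinarith [norm_nonneg (emb (hor q, -ver q))]
  have hs : ContMDiff (𝓡 4) 𝓘(ℝ, E5) ∞ fun q : S4 => emb (hor q, -ver q) := by
    have : ContDiff ℝ ∞ fun x : E5 => emb (hor x, -ver x) :=
      emb.contDiff.comp (hor.contDiff.prodMk ver.contDiff.neg)
    exact this.contMDiff.comp contMDiff_coe_sphere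
  have hinv : ∀ q : S4, emb (hor (emb (hor q, -ver q)), -ver (emb (hor q, -ver q))) = (q : E5) :=
    fun q => by simp
  { toFun := fun q => ⟨emb (hor q, -ver q), hmem q⟩
    invFun := fun q => ⟨emb (hor q, -ver q), hmem q⟩
    left_inv := fun q => Subtype.ext (hinv q)
    right_inv := fun q => Subtype.ext (hinv q)
    contMDiff_toFun := ContMDiff.codRestrict_sphere hs hmem
    contMDiff_invFun := ContMDiff.codRestrict_sphere hs hmem }

theorem coe_reflect (q : S4) : (reflect q : E5) = emb (hor q, -ver q) := rfl

theorem reflect_symm_equator (p : S3) : reflect.symm (equator p) = equator p :=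
  Subtype.ext (show emb (hor (equator p : E5), -ver (equator p : E5)) = (equator p : E5) by
    rw [coe_equator]; simp)

end Coordinates

section Graph

/-- The reflection fixes the equator pointwise, so composing with it on the left has the same effect
on the equator as conjugating the isotopy. -/
theorem isEquatorial_reflect {j : S3 → S4} (hj : IsEquatorial j) :
    IsEquatorial (reflect.symm ∘ j) := by
  obtain ⟨Ψ, hΨ, rfl⟩ := hj
  refine ⟨_, hΨ.conj reflect, ?_⟩
  funext p
  have : reflect (equator p) = equator p := by
    nth_rewrite 1 [← reflect_symm_equator p]; exact reflect.apply_symm_apply _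
  simp [this]

theorem IsEquatorial.comp {j : S3 → S4} (hj : IsEquatorial j) {Φ : S4 → S4}
    (hΦ : IsIsotopicToId Φ) : IsEquatorial (Φ ∘ j) := by
  obtain ⟨Ψ, hΨ, rfl⟩ := hj
  exact ⟨_, hΦ.comp hΨ, rfl⟩

/-- The graph of a smooth function over the equator is an equatorial sphere. -/
theorem exists_isEquatorial_graph {G : E4 → ℝ} (hG : ContDiff ℝ ∞ G) :
    ∃ j : S3 → S4, IsEquatorial j ∧ ∀ p : S3, ∃ r : ℝ, 0 < r ∧ r • (j p : E5) = emb ((p : E4), G p) := by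
  obtain ⟨R, hR⟩ := (isCompact_sphere (0 : E4) 1).exists_bound_of_continuousOn hG.continuous.continuousOn
  have hR' : ∀ p : S3, |G p| ≤ R := fun p => hR p p.2
  -- A cutoff equal to `1` for `|u| ≤ R` and to `0` for `u² ≥ R² + 1`.
  let χ : ℝ → ℝ := fun u => Real.smoothTransition (R ^ 2 + 1 - u ^ 2)
  have hχ : ContDiff ℝ ∞ χ :=
    Real.smoothTransition.contDiff.comp (contDiff_const.sub (contDiff_id.pow 2))
  have hχ1 : ∀ u, |u| ≤ R → χ u = 1 := fun u hu => Real.smoothTransition.one_of_one_le (by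
    have := sq_le_sq' (by linarith [neg_abs_le u]) ((le_abs_self u).trans hu)
    linarith)
  have hχ0 : ∀ u, R ^ 2 + 1 ≤ u ^ 2 → χ u = 0 := fun u hu =>
    Real.smoothTransition.zero_of_nonpos (by linarith)
  -- The homogeneous extension of `(p, u) ↦ G p * χ u` from the cylinder `‖hor x‖ = 1`. The cutoff
  -- makes it vanish near the axis through the poles, where the direction of `hor x` is undefined.
  let w : E5 → ℝ := fun x => ‖hor x‖ * (G (‖hor x‖⁻¹ • hor x) * χ (‖hor x‖⁻¹ * ver x))
  have hw : ContDiffOn ℝ ∞ w {0}ᶜ := by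
    intro x hx
    refine ContDiffAt.contDiffWithinAt ?_
    by_cases h0 : hor x = 0
    · have hv : ver x ≠ 0 := fun hv => hx (ext_hor_ver (by simp [h0]) (by simp [hv]))
      have hev : ∀ᶠ y in 𝓝 x, (R ^ 2 + 1) * ‖hor y‖ ^ 2 < ver y ^ 2 := by
        have hc : Continuous fun y : E5 => ver y ^ 2 - (R ^ 2 + 1) * ‖hor y‖ ^ 2 := by fun_prop
        have hp : 0 < ver x ^ 2 - (R ^ 2 + 1) * ‖hor x‖ ^ 2 := by
          simp [h0]; positivity
        filter_upwards [hc.continuousAt.eventually (lt_mem_nhds hp)] with y hy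
        linarith
      have : w =ᶠ[𝓝 x] fun _ => 0 := by
        filter_upwards [hev] with y hy
        by_cases hy0 : ‖hor y‖ = 0
        · simp [w, hy0]
        · have : χ (‖hor y‖⁻¹ * ver y) = 0 := by
            apply hχ0
            rw [mul_pow, inv_pow, ← div_eq_inv_mul, le_div_iff₀ (by positivity)]
            exact hy.le
          simp [w, this]
      exact contDiffAt_const.congr_of_eventuallyEq this
    · have h1 : ContDiffAt ℝ ∞ (fun x : E5 => ‖hor x‖) x :=
        (contDiffAt_norm ℝ h0).comp x hor.contDiff.contDiffAt
      have h2 : ContDiffAt ℝ ∞ (fun x : E5 => ‖hor x‖⁻¹) x := h1.inv (norm_ne_zero_iff.2 h0)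
      exact h1.mul ((hG.contDiffAt.comp x (h2.smul hor.contDiff.contDiffAt)).mul
        (hχ.contDiffAt.comp x (h2.mul ver.contDiff.contDiffAt)))
  have hwhom : ∀ r : ℝ, 0 < r → ∀ x, w (r • x) = r * w x := by
    intro r hr x
    have e1 : ‖hor (r • x)‖ = r * ‖hor x‖ := by
      rw [map_smul, norm_smul, Real.norm_eq_abs, abs_of_pos hr]
    have e2 : ‖hor (r • x)‖⁻¹ • hor (r • x) = ‖hor x‖⁻¹ • hor x := by
      rw [e1, map_smul, smul_smul, mul_inv]
      congr 1; field_simp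
    have e3 : ‖hor (r • x)‖⁻¹ * ver (r • x) = ‖hor x‖⁻¹ * ver x := by
      rw [e1, map_smul, smul_eq_mul, mul_inv]
      field_simp
    simp only [w, e2, e3]
    rw [e1, mul_assoc]
  let W : E5 → E5 := fun x => emb (0, w x)
  have hW : ContDiffOn ℝ ∞ W {0}ᶜ := emb.contDiff.comp_contDiffOn (contDiffOn_const.prodMk hw)
  have hom : ∀ r : ℝ, 0 < r → ∀ x, W (r • x) = r • W x := fun r hr x => by
    simp only [W, hwhom r hr, ← map_smul, Prod.smul_mk, smul_zero, smul_eq_mul]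
  obtain ⟨ε₀, hε₀, H⟩ := exists_isotopic_perturbation hW hom
  -- Only small perturbations are known to be isotopies, so the equator is raised to the graph in
  -- `N` steps of `G / N`. All stages stay in the region where `χ = 1`.
  obtain ⟨N, hN⟩ := exists_nat_gt (1 / ε₀)
  have hN0 : 0 < (N : ℝ) := lt_trans (by positivity) hN
  obtain ⟨Ψ, hΨ, hq⟩ := H (1 / N) (by positivity) (by
    rw [div_lt_iff₀ hN0]; rw [div_lt_iff₀ hε₀] at hN; linarith)
  have key : ∀ p : S3, ∀ k : ℕ, k ≤ N →
      ∃ r : ℝ, 0 < r ∧ r • (Ψ^[k] (equator p) : E5) = emb ((p : E4), k / N * G p) := by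
    intro p k
    induction k with
    | zero => exact fun _ => ⟨1, one_pos, by simp [coe_equator]⟩
    | succ k ih =>
      intro hk
      obtain ⟨r, hr, h⟩ := ih (by omega)
      obtain ⟨r', hr', h'⟩ := hq (Ψ^[k] (equator p))
      refine ⟨r * r', by positivity, ?_⟩
      rw [Function.iterate_succ_apply', mul_smul, ← h', smul_add, smul_comm, ← hom r hr, h]
      have hw1 : w (emb ((p : E4), k / N * G p)) = G p := by
        simp only [w, hor_emb, ver_emb, S3.norm_eq, inv_one, one_smul, one_mul]
        rw [hχ1, mul_one]
        rw [abs_mul, abs_of_nonneg (by positivity)]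
        have h3 : (k : ℝ) / N ≤ 1 := by
          rw [div_le_one hN0]; exact_mod_cast (by omega : k ≤ N)
        calc (k : ℝ) / N * |G p| ≤ 1 * |G p| := by gcongr
          _ ≤ R := by rw [one_mul]; exact hR' p
      simp only [W, hw1, ← map_smul, ← map_add, Prod.smul_mk, smul_zero, Prod.mk_add_mk, add_zero,
        smul_eq_mul]
      congr 2
      push_cast; ring
  refine ⟨Ψ^[N] ∘ equator, ⟨_, hΨ.iterate N, rfl⟩, fun p => ?_⟩
  obtain ⟨r, hr, h⟩ := key p N le_rfl
  refine ⟨r, hr, ?_⟩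
  rw [Function.comp_apply, h, div_self hN0.ne', one_mul]

end Graph

/-- `ℝ²`, the model space of surfaces. -/
abbrev E2 : Type := EuclideanSpace ℝ (Fin 2)

section Equatorial

theorem contMDiff_equator : ContMDiff (𝓡 3) (𝓡 4) ∞ equator := by
  have : ContMDiff (𝓡 3) 𝓘(ℝ, E5) ∞ fun p : S3 => emb ((p : E4), 0) :=
    (emb.contDiff.comp (contDiff_id.prodMk contDiff_const)).contMDiff.comp contMDiff_coe_sphere
  exact ContMDiff.codRestrict_sphere this fun p => (equator p).2

/-- Following the equator by `hor` gives the inclusion of `S³` in `ℝ⁴`, which is an immersion. -/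
theorem injective_mfderiv_equator (p : S3) : Function.Injective (mfderiv (𝓡 3) (𝓡 4) equator p) := by
  have h1 : MDifferentiableAt (𝓡 4) 𝓘(ℝ, E4) (fun q : S4 => hor q) (equator p) :=
    (hor.contDiff.contMDiff.comp (contMDiff_coe_sphere (m := 1))).mdifferentiableAt (by simp)
  have h2 : MDifferentiableAt (𝓡 3) (𝓡 4) equator p :=
    contMDiff_equator.mdifferentiableAt (by simp)
  have h3 := mfderiv_comp p h1 h2
  have h4 : (fun q : S4 => hor q) ∘ equator = ((↑) : S3 → E4) := by
    funext p; simp [coe_equator]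
  rw [h4] at h3
  have h5 := injective_mvfderiv_subtypeVal_sphere (E := E4) (n := 3) p
  have h6 : Function.Injective (mfderiv (𝓡 3) 𝓘(ℝ, E4) ((↑) : S3 → E4) p) := by
    convert! h5
  rw [h3] at h6
  exact Function.Injective.of_comp h6

theorem IsEquatorial.contMDiff {j : S3 → S4} (hj : IsEquatorial j) :
    ContMDiff (𝓡 3) (𝓡 4) ∞ j := by
  obtain ⟨Ψ, hΨ, rfl⟩ := hj
  obtain ⟨Φ, hΦ, -⟩ := hΨ.exists_inverse
  rw [← funext hΦ]
  exact Φ.contMDiff.comp contMDiff_equator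

theorem Diffeomorph.injective_mfderiv (Φ : S4 ≃ₘ^∞⟮𝓡 4, 𝓡 4⟯ S4) (q : S4) :
    Function.Injective (mfderiv (𝓡 4) (𝓡 4) Φ q) :=
  (Φ.mfderivToContinuousLinearEquiv (by simp) q).injective

theorem IsEquatorial.injective_mfderiv {j : S3 → S4} (hj : IsEquatorial j) (p : S3) :
    Function.Injective (mfderiv (𝓡 3) (𝓡 4) j p) := by
  obtain ⟨Ψ, hΨ, rfl⟩ := hj
  obtain ⟨Φ, hΦ, -⟩ := hΨ.exists_inverse
  rw [← funext hΦ, mfderiv_comp p (Φ.mdifferentiable (by simp) _)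
    (contMDiff_equator.mdifferentiableAt (by simp))]
  exact (Diffeomorph.injective_mfderiv Φ _).comp (injective_mfderiv_equator p)

end Equatorial

/-! ### Transport of slices by diffeomorphisms, and slices cut out by graphs. -/

section Transfer

variable {M : Type*} [TopologicalSpace M] [ChartedSpace E2 M]

/-- Only the images of `B ∘ e` and `A ∘ f` agree, and the parametrizations differ by `θ = e⁻¹ ∘ B⁻¹
∘ A ∘ f`. It is smooth as `e` is an embedding, and its differential is injective because `f` is an
immersion. So tangent planes correspond. Of `A` only the effect on equatorial spheres matters, which
leaves room for a reflection. -/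
theorem IsSlice.of_diffeomorph {f e : M → S4} {K : Set S3}
    (hf : Manifold.IsSmoothEmbedding (𝓡 2) (𝓡 4) ∞ f)
    (he : Manifold.IsSmoothEmbedding (𝓡 2) (𝓡 4) ∞ e) (A B : S4 ≃ₘ^∞⟮𝓡 4, 𝓡 4⟯ S4)
    (hA : ∀ j, IsEquatorial j → IsEquatorial (A.symm ∘ j))
    (hrange : range (B ∘ e) = A '' range f) (h : IsSlice (B ∘ e) K) : IsSlice f K := by
  obtain ⟨j, hj, hK, htr⟩ := h
  have hθ : ∀ x, ∃ y, B (e y) = A (f x) := fun x => by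
    have : A (f x) ∈ range (B ∘ e) := hrange ▸ ⟨f x, ⟨x, rfl⟩, rfl⟩
    exact this
  choose θ hθ using hθ
  have hθ' : e ∘ θ = B.symm ∘ A ∘ f := by
    funext x
    rw [Function.comp_apply, Function.comp_apply, Function.comp_apply, ← hθ, B.symm_apply_apply]
  have hs : ContMDiff (𝓡 2) (𝓡 4) ∞ (e ∘ θ) := by
    rw [hθ']; exact B.symm.contMDiff.comp (A.contMDiff.comp hf.contMDiff)
  have hθc : Continuous θ := he.isEmbedding.continuous_iff.2 hs.continuous
  have hθs : ContMDiff (𝓡 2) (𝓡 2) ∞ θ := fun x =>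
    (ContMDiffAt.iff_comp_isImmersionAt (he.isImmersion.isImmersionAt (θ x))).2
      ⟨hθc.continuousAt, hs x⟩
  refine ⟨A.symm ∘ j, hA j hj, ?_, fun x p hxp => ?_⟩
  · rw [image_comp, hK, hrange]
    have : range (A.symm ∘ j) = A.symm '' range j := range_comp _ _
    rw [this, image_inter (show Function.Injective A.symm from A.symm.injective), A.symm_image_image]
  · have hjp : (B ∘ e) (θ x) = j p := by
      rw [Function.comp_apply, hθ, hxp, Function.comp_apply, A.apply_symm_apply]
    have htop := htr (θ x) p hjp
    have hAf : A ∘ f = (B ∘ e) ∘ θ := by funext x; exact (hθ x).symm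
    have hAd : ∀ q, MDifferentiableAt (𝓡 4) (𝓡 4) A q := A.mdifferentiable (by simp)
    have hfd : MDifferentiableAt (𝓡 2) (𝓡 4) f x := hf.contMDiff.mdifferentiableAt (by simp)
    have hBe : MDifferentiableAt (𝓡 2) (𝓡 4) (B ∘ e) (θ x) :=
      (B.contMDiff.comp he.contMDiff).mdifferentiableAt (by simp)
    have hjd : MDifferentiableAt (𝓡 3) (𝓡 4) (A.symm ∘ j) p :=
      (A.symm.contMDiff.comp hj.contMDiff).mdifferentiableAt (by simp)
    have hchain : (mfderiv (𝓡 4) (𝓡 4) A (f x)).comp (mfderiv (𝓡 2) (𝓡 4) f x) =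
        (mfderiv (𝓡 2) (𝓡 4) (B ∘ e) (θ x)).comp (mfderiv (𝓡 2) (𝓡 2) θ x) := by
      rw [← mfderiv_comp x (hAd _) hfd, hAf,
        mfderiv_comp x hBe (hθs.mdifferentiableAt (by simp))]
    let dA : EuclideanSpace ℝ (Fin 4) →ₗ[ℝ] EuclideanSpace ℝ (Fin 4) :=
      (mfderiv (𝓡 4) (𝓡 4) A (f x)).toLinearMap
    have hdA : Function.Injective dA := Diffeomorph.injective_mfderiv A (f x)
    let df : EuclideanSpace ℝ (Fin 2) →ₗ[ℝ] EuclideanSpace ℝ (Fin 4) :=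
      (mfderiv (𝓡 2) (𝓡 4) f x).toLinearMap
    have hdf : Function.Injective df :=
      mfderiv_injective_of_isImmersionAt (hf.isImmersion.isImmersionAt x)
    let dB : EuclideanSpace ℝ (Fin 2) →ₗ[ℝ] EuclideanSpace ℝ (Fin 4) :=
      (mfderiv (𝓡 2) (𝓡 4) (B ∘ e) (θ x)).toLinearMap
    let dθ : EuclideanSpace ℝ (Fin 2) →ₗ[ℝ] EuclideanSpace ℝ (Fin 2) :=
      (mfderiv (𝓡 2) (𝓡 2) θ x).toLinearMap
    have hlin : dA ∘ₗ df = dB ∘ₗ dθ := by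
      ext1 v; exact DFunLike.congr_fun hchain v
    have hdθ : Function.Injective dθ := by
      have : Function.Injective (dB ∘ₗ dθ) := hlin ▸ hdA.comp hdf
      exact Function.Injective.of_comp this
    have hdθs : LinearMap.range dθ = ⊤ :=
      LinearMap.range_eq_top.2 (LinearMap.injective_iff_surjective.1 hdθ)
    have hsheet : Submodule.map dA (sheet4 f x) = sheet4 (B ∘ e) (θ x) := by
      change Submodule.map dA (LinearMap.range df) = LinearMap.range dB
      rw [← LinearMap.range_comp, hlin, LinearMap.range_comp, hdθs, Submodule.map_top]
    have htan : Submodule.map dA (tangent3 (A.symm ∘ j) p) = tangent3 j p := by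
      have hjA : j = A ∘ (A.symm ∘ j) := by funext q; simp
      have h1 := mfderiv_comp p (hAd ((A.symm ∘ j) p)) hjd
      rw [← hjA, ← hxp] at h1
      let dj : EuclideanSpace ℝ (Fin 3) →ₗ[ℝ] EuclideanSpace ℝ (Fin 4) :=
        (mfderiv (𝓡 3) (𝓡 4) j p).toLinearMap
      let dj' : EuclideanSpace ℝ (Fin 3) →ₗ[ℝ] EuclideanSpace ℝ (Fin 4) :=
        (mfderiv (𝓡 3) (𝓡 4) (A.symm ∘ j) p).toLinearMap
      have h2 : dj = dA ∘ₗ dj' := by ext1 v; exact DFunLike.congr_fun h1 v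
      change Submodule.map dA (LinearMap.range dj') = LinearMap.range dj
      rw [h2, LinearMap.range_comp]
    have h3 : Submodule.map dA (sheet4 f x ⊔ tangent3 (A.symm ∘ j) p) = Submodule.map dA ⊤ := by
      rw [Submodule.map_sup, hsheet, htan, htop, Submodule.map_top,
        LinearMap.range_eq_top.2 (LinearMap.injective_iff_surjective.1 hdA)]
    exact Submodule.map_injective_of_injective hdA h3

end Transfer

section GraphSlice

variable {M : Type*} [TopologicalSpace M] [ChartedSpace E2 M]

/-- The height of a point of `ℝ⁵` relative to the norm of its projection to `ℝ⁴`. -/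
noncomputable def slope (x : E5) : ℝ := ‖hor x‖⁻¹ * ver x

theorem slope_of_hor_eq {x : E5} {p : S3} {r : ℝ} (hr : 0 < r) (h : hor x = r • (p : E4)) :
    x = r • emb ((p : E4), slope x) := by
  have hn : ‖hor x‖ = r := by
    rw [h, norm_smul, S3.norm_eq, mul_one, Real.norm_eq_abs, abs_of_pos hr]
  apply ext_hor_ver
  · rw [map_smul, hor_emb, h]
  · rw [map_smul, ver_emb, slope, hn, smul_eq_mul, mul_inv_cancel_left₀ hr.ne']

theorem eq_of_smul_emb_eq {p p' : S3} {t t' r r' : ℝ} (hr : 0 < r) (hr' : 0 < r')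
    (h : r • emb ((p : E4), t) = r' • emb ((p' : E4), t')) : r = r' ∧ p = p' ∧ t = t' := by
  have h1 : r • (p : E4) = r' • (p' : E4) := by
    have := congrArg hor h
    simpa using this
  have h2 : r = r' := by
    have := congrArg norm h1
    simpa [norm_smul, S3.norm_eq, abs_of_pos hr, abs_of_pos hr'] using this
  subst h2
  have h3 : r * t = r * t' := by
    have := congrArg ver h
    simpa using this
  exact ⟨rfl, Subtype.ext (smul_right_injective E4 hr.ne' h1), mul_left_cancel₀ hr.ne' h3⟩

theorem contDiffAt_slope {x : E5} (hx : hor x ≠ 0) : ContDiffAt ℝ ∞ slope x :=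
  (((contDiffAt_norm ℝ hx).comp x hor.contDiff.contDiffAt).inv
    (norm_ne_zero_iff.2 hx)).mul ver.contDiff.contDiffAt

theorem LiesOver.hor_ne_zero {q : S4} {p : S3} (h : LiesOver q p) : hor q ≠ 0 := by
  obtain ⟨r, hr, h⟩ := (liesOver_iff q p).1 h
  rw [h]
  exact smul_ne_zero hr.ne' (S3.ne_zero p)

theorem LiesOver.normalize_hor {q : S4} {p : S3} (h : LiesOver q p) :
    ‖hor q‖⁻¹ • hor q = (p : E4) := by
  obtain ⟨r, hr, h⟩ := (liesOver_iff q p).1 h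
  rw [h, norm_smul, S3.norm_eq, mul_one, Real.norm_eq_abs, abs_of_pos hr, smul_smul,
    inv_mul_cancel₀ hr.ne', one_smul]

/-- A surface over which the graph of a function `G` on `S³` passes transversally has the
projection of the intersection as a slice. -/
theorem isSlice_of_graph {e : M → S4} (he : ContMDiff (𝓡 2) (𝓡 4) ∞ e) {φ : M → S3}
    (hφ : ∀ x, LiesOver (e x) (φ x)) {G : E4 → ℝ} (hG : ContDiff ℝ ∞ G)
    (hk : ∀ x, slope (e x) = G (φ x) →
      chartDeriv E2 (fun y => slope (e y) - G (φ y)) x ≠ 0) :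
    IsSlice e (φ '' {x | slope (e x) = G (φ x)}) := by
  obtain ⟨j, hj, hjG⟩ := exists_isEquatorial_graph hG
  have hmeet : ∀ x p, e x = j p ↔ φ x = p ∧ slope (e x) = G p := by
    intro x p
    obtain ⟨r, hr, h⟩ := hjG p
    obtain ⟨r', hr', h'⟩ := (liesOver_iff _ _).1 (hφ x)
    have h2 := slope_of_hor_eq hr' h'
    have h3 : (j p : E5) = r⁻¹ • emb ((p : E4), G p) := by
      rw [← h, smul_smul, inv_mul_cancel₀ hr.ne', one_smul]
    constructor
    · intro hxp
      have h4 : (e x : E5) = j p := congrArg _ hxp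
      rw [h3] at h4
      nth_rewrite 1 [h2] at h4
      exact (eq_of_smul_emb_eq hr' (inv_pos.2 hr) h4).2
    · rintro ⟨hp, hG'⟩
      rw [hp, hG'] at h2
      have hrr : r' = r⁻¹ := by
        have n1 := congrArg norm h2
        have n2 := congrArg norm h3
        rw [S4.norm_eq, norm_smul, Real.norm_eq_abs, abs_of_pos hr'] at n1
        rw [S4.norm_eq, norm_smul, Real.norm_eq_abs, abs_of_pos (inv_pos.2 hr)] at n2
        have h0 : ‖emb ((p : E4), G p)‖ ≠ 0 := fun h0 => by simp [h0] at n1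
        exact mul_right_cancel₀ h0 (n1.symm.trans n2)
      apply Subtype.ext
      rw [h2, h3, hrr]
  refine ⟨j, hj, ?_, fun x p hxp => ?_⟩
  · ext q
    constructor
    · rintro ⟨_, ⟨x, hx, rfl⟩, rfl⟩
      exact ⟨⟨x, (hmeet x _).2 ⟨rfl, hx⟩⟩, ⟨_, rfl⟩⟩
    · rintro ⟨⟨x, rfl⟩, ⟨p, hp⟩⟩
      obtain ⟨h1, h2⟩ := (hmeet x p).1 hp.symm
      exact ⟨p, ⟨x, by rw [mem_ofPred_eq, h2, h1], h1⟩, hp⟩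
  · obtain ⟨hp, hG'⟩ := (hmeet x p).1 hxp
    -- An equation of the graph. Its differential kills the tangent space of the sphere but, by
    -- `hk`, not the tangent plane of the surface.
    let Γ : E5 → ℝ := fun y => slope y - G (‖hor y‖⁻¹ • hor y)
    have hΓ : ∀ y : E5, hor y ≠ 0 → ContDiffAt ℝ ∞ Γ y := fun y hy =>
      (contDiffAt_slope hy).sub (hG.contDiffAt.comp y
        ((((contDiffAt_norm ℝ hy).comp y hor.contDiff.contDiffAt).inv
          (norm_ne_zero_iff.2 hy)).smul hor.contDiff.contDiffAt))
    have hΓe : (fun q : S4 => Γ q) ∘ e = fun y => slope (e y) - G (φ y) := by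
      funext y
      simp only [Γ, Function.comp_apply, (hφ y).normalize_hor]
    have hΓj : (fun q : S4 => Γ q) ∘ j = fun _ => 0 := by
      funext p'
      obtain ⟨r, hr, h⟩ := hjG p'
      have h3 : (j p' : E5) = r⁻¹ • emb ((p' : E4), G p') := by
        rw [← h, smul_smul, inv_mul_cancel₀ hr.ne', one_smul]
      have hh : hor (j p' : E5) = r⁻¹ • (p' : E4) := by rw [h3, map_smul, hor_emb]
      have hl : LiesOver (j p') p' := (liesOver_iff _ _).2 ⟨r⁻¹, inv_pos.2 hr, hh⟩
      have h4 := slope_of_hor_eq (inv_pos.2 hr) hh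
      have h5 := (eq_of_smul_emb_eq (inv_pos.2 hr) (inv_pos.2 hr) (h4.symm.trans h3)).2.2
      simp only [Γ, Function.comp_apply, hl.normalize_hor, h5, sub_self]
    have hΓs : ContMDiffAt (𝓡 4) 𝓘(ℝ, ℝ) ∞ (fun q : S4 => Γ q) (e x) :=
      ContMDiffAt.comp (g := Γ) (f := fun q : S4 => (q : E5)) (e x)
        (hΓ _ (hφ x).hor_ne_zero).contMDiffAt (contMDiff_coe_sphere _)
    have hΓd := hΓs.mdifferentiableAt (by simp)
    let lam : EuclideanSpace ℝ (Fin 4) →ₗ[ℝ] ℝ :=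
      (mfderiv (𝓡 4) 𝓘(ℝ, ℝ) (fun q : S4 => Γ q) (e x)).toLinearMap
    let de : EuclideanSpace ℝ (Fin 2) →ₗ[ℝ] EuclideanSpace ℝ (Fin 4) :=
      (mfderiv (𝓡 2) (𝓡 4) e x).toLinearMap
    let dj : EuclideanSpace ℝ (Fin 3) →ₗ[ℝ] EuclideanSpace ℝ (Fin 4) :=
      (mfderiv (𝓡 3) (𝓡 4) j p).toLinearMap
    have h1 : ∃ v, lam (de v) ≠ 0 := by
      by_contra! h0
      apply hk x (by rw [hG', hp])
      rw [← hΓe, chartDeriv_eq_mfderiv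
        ((hΓs.comp x he.contMDiffAt).mdifferentiableAt (by simp)),
        mfderiv_comp x hΓd (he.mdifferentiableAt (by simp))]
      ext v
      exact h0 v
    have h2 : ∀ w, lam (dj w) = 0 := by
      intro w
      have hd' : MDifferentiableAt (𝓡 4) 𝓘(ℝ, ℝ) (fun q : S4 => Γ q) (j p) := hxp ▸ hΓd
      have hc := mfderiv_comp p hd' (hj.contMDiff.mdifferentiableAt (by simp))
      rw [hΓj, mfderiv_const, ← hxp] at hc
      exact (DFunLike.congr_fun hc w).symm
    obtain ⟨v, hv⟩ := h1
    -- One inclusion is `h2`; both spaces have dimension `3`.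
    have hker : LinearMap.range dj = LinearMap.ker lam := by
      refine Submodule.eq_of_le_of_finrank_eq ?_ ?_
      · rintro _ ⟨w, rfl⟩; exact h2 w
      · rw [LinearMap.finrank_range_of_inj (f := dj) (hj.injective_mfderiv p)]
        have hr : LinearMap.range lam = ⊤ :=
          LinearMap.range_eq_top.2 (LinearMap.surjective (fun h0 => hv (by rw [h0]; rfl)))
        have := LinearMap.finrank_range_add_finrank_ker lam
        rw [hr, finrank_top] at this
        simp at this ⊢
        omega
    change LinearMap.range de ⊔ LinearMap.range dj = ⊤
    rw [hker, eq_top_iff]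
    intro w _
    rw [Submodule.mem_sup]
    refine ⟨de ((lam w / lam (de v)) • v), ⟨_, rfl⟩, w - de ((lam w / lam (de v)) • v), ?_, by abel⟩
    rw [LinearMap.mem_ker, map_sub, map_smul, map_smul, smul_eq_mul, div_mul_cancel₀ _ hv, sub_self]

end GraphSlice

/-! ### A smooth defining function of the separating curve. -/

section Auxiliary

/-- A property which holds near all points of a fibre of a continuous map on a compact set holds
on all nearby fibres. -/
theorem eventually_forall_fiber {X Y : Type*} [TopologicalSpace X] [TopologicalSpace Y] [T2Space Y]
    {K : Set X} (hK : IsCompact K) {φ : X → Y} (hφ : Continuous φ) {p : Y} {Q : X → Prop}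
    (h : ∀ x ∈ K, φ x = p → ∀ᶠ y in 𝓝 x, Q y) :
    ∀ᶠ q in 𝓝 p, ∀ x ∈ K, φ x = q → Q x := by
  refine hK.eventually_forall_of_forall_eventually fun x hx => ?_
  by_cases hxp : φ x = p
  · have : ∀ᶠ z : Y × X in 𝓝 (p, x), Q z.2 := continuousAt_snd.eventually (h x hx hxp)
    exact this.mono fun z hz _ => hz
  · have : ∀ᶠ z : Y × X in 𝓝 (p, x), φ z.2 ≠ z.1 :=
      (isOpen_ne_fun (hφ.comp continuous_snd) continuous_fst).mem_nhds hxp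
    exact this.mono fun z hz h => absurd h hz

theorem exists_apply_pos {E : Type*} [NormedAddCommGroup E] [NormedSpace ℝ E] {L : E →L[ℝ] ℝ}
    (hL : L ≠ 0) : ∃ n, 0 < L n := by
  obtain ⟨n, hn⟩ := DFunLike.ne_iff.1 hL
  rcases lt_or_gt_of_ne hn with h | h
  · exact ⟨-n, by simpa using h⟩
  · exact ⟨n, h⟩

variable {E : Type*} [NormedAddCommGroup E] [NormedSpace ℝ E] {F : Type*} [NormedAddCommGroup F]
  [NormedSpace ℝ F] {M : Type*} [TopologicalSpace M] [ChartedSpace E M] [IsManifold 𝓘(ℝ, E) ∞ M]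

/-- The derivative at `y` of the change of charts from the preferred chart at `x`. -/
noncomputable def chartTransition (x y : M) : E →L[ℝ] E :=
  mfderiv 𝓘(ℝ, E) 𝓘(ℝ, E) (chartAt E x).symm (chartAt E x y)

/-- The derivative of a map in the preferred chart at a nearby point. -/
theorem fderiv_comp_chartAt_symm_eq {x y : M} (hy : y ∈ (chartAt E x).source) {k : M → F}
    (hk : ContMDiffAt 𝓘(ℝ, E) 𝓘(ℝ, F) ∞ k y) :
    fderiv ℝ (k ∘ (chartAt E x).symm) (chartAt E x y) =
      (chartDeriv E k y).comp (chartTransition x y) := by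
  set a := chartAt E x with ha
  have h1 : MDifferentiableAt 𝓘(ℝ, E) 𝓘(ℝ, F) k (a.symm (a y)) := by
    rw [a.left_inv hy]; exact hk.mdifferentiableAt (by simp)
  have h2 : MDifferentiableAt 𝓘(ℝ, E) 𝓘(ℝ, E) a.symm (a y) :=
    ((contMDiffOn_chart_symm (I := 𝓘(ℝ, E)) (n := ∞)).contMDiffAt
      (a.open_target.mem_nhds (a.map_source hy))).mdifferentiableAt (by simp)
  have h3 := mfderiv_comp (a y) h1 h2
  rw [mfderiv_eq_fderiv] at h3
  rw [h3, chartDeriv_eq_mfderiv (hk.mdifferentiableAt (by simp))]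
  rw [a.left_inv hy]
  rfl

/-- The preferred chart may jump with the point, so continuity is used in the fixed chart at `x` and
the result is translated by the change of charts. -/
theorem eventually_chartDeriv_ne_zero {v : M → ℝ} {x : M}
    (hv : ∀ᶠ y in 𝓝 x, ContMDiffAt 𝓘(ℝ, E) 𝓘(ℝ, ℝ) ∞ v y) (hne : chartDeriv E v x ≠ 0) :
    ∀ᶠ y in 𝓝 x, chartDeriv E v y ≠ 0 := by
  set a := chartAt E x
  have h1 := (eventually_contDiffAt_comp_chartAt_symm hv).self_of_nhds
  have h2 : ContinuousAt (fderiv ℝ (v ∘ a.symm)) (a x) :=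
    (h1.fderiv_right (m := 0) (by simp)).continuousAt
  have h3 := (a.continuousAt (mem_chart_source E x)).eventually (h2.eventually_ne hne)
  filter_upwards [h3, hv, a.open_source.mem_nhds (mem_chart_source E x)] with y hy hvy hys h0
  apply hy
  rw [fderiv_comp_chartAt_symm_eq hys hvy, h0, ContinuousLinearMap.zero_comp]

/-- From each zero of `v` near `x`, short moves along one fixed direction `n` with positive
derivative enter `{0 < v}`. -/
theorem eventually_mem_closure_pos {v : M → ℝ} {x : M}
    (hv : ContMDiffAt 𝓘(ℝ, E) 𝓘(ℝ, ℝ) ∞ v x) (hne : chartDeriv E v x ≠ 0) :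
    ∀ᶠ y in 𝓝 x, v y = 0 → y ∈ closure {z | 0 < v z} := by
  set a := chartAt E x
  obtain ⟨n, hn⟩ := exists_apply_pos hne
  have h1 := eventually_lt_of_hasStrictFDerivAt (hasStrictFDerivAt_comp_chartAt_symm hv) hn
  have h2 : ∀ᶠ z in 𝓝 (a x), ∀ᶠ τ in 𝓝[>] (0 : ℝ), (v ∘ a.symm) z < (v ∘ a.symm) (z + τ • n) := by
    rw [Filter.eventually_prod_iff] at h1
    obtain ⟨p, hp, q, hq, H⟩ := h1
    filter_upwards [hq.curry] with z hz
    filter_upwards [hp] with τ hτ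
    exact H hτ hz.self_of_nhds
  have h3 := (a.continuousAt (mem_chart_source E x)).eventually h2
  filter_upwards [h3, a.open_source.mem_nhds (mem_chart_source E x)] with y hy hys hvy
  have hc : ContinuousAt (fun τ : ℝ => a.symm (a y + τ • n)) 0 := by
    refine ContinuousAt.comp (g := a.symm) (f := fun τ : ℝ => a y + τ • n) ?_ (by fun_prop)
    simpa using a.continuousAt_symm (a.map_source hys)
  have ht : Tendsto (fun τ : ℝ => a.symm (a y + τ • n)) (𝓝[>] 0) (𝓝 y) := by
    have := hc.tendsto.mono_left (nhdsWithin_le_nhds (s := Ioi 0))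
    simpa [a.left_inv hys] using this
  refine mem_closure_of_tendsto ht ?_
  filter_upwards [hy] with τ hτ
  simpa [a.left_inv hys, hvy] using hτ

omit [IsManifold 𝓘(ℝ, E) ∞ M] in
theorem contMDiffAt_neg {v : M → ℝ} {x : M} (hv : ContMDiffAt 𝓘(ℝ, E) 𝓘(ℝ, ℝ) ∞ v x) :
    ContMDiffAt 𝓘(ℝ, E) 𝓘(ℝ, ℝ) ∞ (fun y => -v y) x :=
  ContMDiffAt.comp x (g := fun t : ℝ => -t) (contDiff_neg.contDiffAt.contMDiffAt) hv

omit [IsManifold 𝓘(ℝ, E) ∞ M] in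
theorem chartDeriv_neg (v : M → ℝ) (x : M) :
    chartDeriv E (fun y => -v y) x = -chartDeriv E v x := by
  unfold chartDeriv
  exact fderiv_neg

end Auxiliary

section DefiningFunction

variable {M : Type*} [TopologicalSpace M] [ChartedSpace E2 M] [IsManifold (𝓡 2) ∞ M]

omit [ChartedSpace E2 M] [IsManifold (𝓡 2) ∞ M] in
theorem Separates.symm {γ F₁ F₂ : Set M} (h : Separates γ F₁ F₂) : Separates γ F₂ F₁ :=
  ⟨h.isOpen_right, h.isOpen_left, h.isConnected_right, h.isConnected_left, h.disjoint.symm,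
    by rw [union_comm, h.union_eq]⟩

omit [ChartedSpace E2 M] [IsManifold (𝓡 2) ∞ M] in
theorem Separates.trichotomy {γ F₁ F₂ : Set M} (h : Separates γ F₁ F₂) (x : M) :
    x ∈ γ ∨ x ∈ F₁ ∨ x ∈ F₂ := by
  by_cases hx : x ∈ γ
  · exact Or.inl hx
  · right
    have : x ∈ F₁ ∪ F₂ := by rw [h.union_eq]; exact hx
    exact this

omit [ChartedSpace E2 M] [IsManifold (𝓡 2) ∞ M] in
theorem Separates.notMem_left {γ F₁ F₂ : Set M} (h : Separates γ F₁ F₂) {x : M} (hx : x ∈ γ) :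
    x ∉ F₁ := fun h1 => by
  have : x ∈ γᶜ := h.union_eq ▸ Or.inl h1
  exact this hx

variable {c : Circle → M} {F₁ F₂ : Set M}

theorem exists_local_equation [T2Space M] (hc : Manifold.IsSmoothEmbedding (𝓡 1) (𝓡 2) ∞ c)
    (θ : Circle) :
    ∃ v : M → ℝ, (∀ᶠ y in 𝓝 (c θ), ContMDiffAt (𝓡 2) 𝓘(ℝ, ℝ) ∞ v y) ∧
      chartDeriv E2 v (c θ) ≠ 0 ∧ ∀ᶠ y in 𝓝 (c θ), v y = 0 ↔ y ∈ range c := by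
  obtain ⟨r, v, hr, hrc, hv, hvc, hvr, hne⟩ := exists_contMDiff_equation (by simp) hc.contMDiff
    (mfderiv_injective_of_isImmersionAt (hc.isImmersion.isImmersionAt θ))
  refine ⟨v, hv, hne, ?_⟩
  -- Compactness and injectivity prevent distant parts of the curve from returning close to `c θ`.
  have h1 : ∀ᶠ y in 𝓝 (c θ), ∀ z ∈ univ, c z = y → v (c z) = 0 := by
    refine eventually_forall_fiber isCompact_univ hc.contMDiff.continuous fun z _ hz => ?_
    rw [hc.isEmbedding.injective hz]
    exact hvc
  filter_upwards [h1, hvr] with y hy1 hy2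
  constructor
  · intro h0; exact ⟨r y, hy2 h0⟩
  · rintro ⟨z, rfl⟩; exact hy1 z trivial rfl

/-- Each half of a small neighbourhood is connected and misses the curve, so it lies in one
component. Nothing here excludes that both halves lie in the same one. -/
theorem exists_local_sides [T2Space M] (hc : Manifold.IsSmoothEmbedding (𝓡 1) (𝓡 2) ∞ c)
    (hsep : Separates (range c) F₁ F₂) (θ : Circle) :
    ∃ v : M → ℝ, (∀ᶠ y in 𝓝 (c θ), ContMDiffAt (𝓡 2) 𝓘(ℝ, ℝ) ∞ v y) ∧
      chartDeriv E2 v (c θ) ≠ 0 ∧ (∀ᶠ y in 𝓝 (c θ), v y = 0 ↔ y ∈ range c) ∧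
      ((∀ᶠ y in 𝓝 (c θ), v y < 0 → y ∈ F₁) ∨ (∀ᶠ y in 𝓝 (c θ), v y < 0 → y ∈ F₂)) ∧
      ((∀ᶠ y in 𝓝 (c θ), 0 < v y → y ∈ F₁) ∨ (∀ᶠ y in 𝓝 (c θ), 0 < v y → y ∈ F₂)) := by
  obtain ⟨v, hv, hne, h0⟩ := exists_local_equation hc θ
  refine ⟨v, hv, hne, h0, ?_⟩
  obtain ⟨N, hN, hsub, hneg, hpos⟩ := exists_nhds_isPreconnected_halves_manifold hv.self_of_nhds
    (h0.self_of_nhds.2 ⟨θ, rfl⟩) hne h0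
  have key : ∀ A : Set ℝ, (0 : ℝ) ∉ A → IsPreconnected (N ∩ {y | v y ∈ A}) →
      ((∀ᶠ y in 𝓝 (c θ), v y ∈ A → y ∈ F₁) ∨ (∀ᶠ y in 𝓝 (c θ), v y ∈ A → y ∈ F₂)) := by
    intro A hA hpre
    have hcov : N ∩ {y | v y ∈ A} ⊆ F₁ ∪ F₂ := by
      rintro y ⟨hyN, hyA⟩
      rw [hsep.union_eq]
      intro hy
      have := (hsub hyN).2 hy
      exact hA (this ▸ hyA)
    rcases IsPreconnected.subset_or_subset hsep.isOpen_left hsep.isOpen_right hsep.disjoint hcov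
      hpre with h | h
    · left; filter_upwards [hN] with y hy hyA using h ⟨hy, hyA⟩
    · right; filter_upwards [hN] with y hy hyA using h ⟨hy, hyA⟩
  exact ⟨key (Iio 0) (by simp) hneg, key (Ioi 0) (by simp) hpos⟩

/-- The parameters whose points adhere to `F₂` form a clopen subset of the circle: near such a point
some half lies in `F₂`, and the nearby curve adheres to that half. If there were none, `F₂` would be
clopen in `M`, against connectedness. -/
theorem range_subset_closure_right [T2Space M] [PreconnectedSpace M]
    (hc : Manifold.IsSmoothEmbedding (𝓡 1) (𝓡 2) ∞ c) (hsep : Separates (range c) F₁ F₂)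
    (θ : Circle) : c θ ∈ closure F₂ := by
  have hclopen : IsClopen {θ | c θ ∈ closure F₂} := by
    refine ⟨isClosed_closure.preimage hc.contMDiff.continuous, ?_⟩
    rw [isOpen_iff_mem_nhds]
    intro θ hθ
    obtain ⟨v, hv, hne, h0, h1, h2⟩ := exists_local_sides hc hsep θ
    have hnot : ¬ ((∀ᶠ y in 𝓝 (c θ), v y < 0 → y ∈ F₁) ∧ (∀ᶠ y in 𝓝 (c θ), 0 < v y → y ∈ F₁)) := by
      rintro ⟨h3, h4⟩
      have h5 : ∀ᶠ y in 𝓝 (c θ), y ∉ F₂ := by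
        filter_upwards [h3, h4, h0] with y y1 y2 y3
        rcases lt_trichotomy (v y) 0 with h | h | h
        · exact disjoint_left.1 hsep.disjoint (y1 h)
        · exact hsep.symm.notMem_left (y3.1 h)
        · exact disjoint_left.1 hsep.disjoint (y2 h)
      rw [mem_ofPred_eq, mem_closure_iff_frequently] at hθ
      exact hθ h5
    have hcl : ∀ᶠ y in 𝓝 (c θ), y ∈ range c → y ∈ closure F₂ := by
      have hside : (∀ᶠ y in 𝓝 (c θ), v y < 0 → y ∈ F₂) ∨ (∀ᶠ y in 𝓝 (c θ), 0 < v y → y ∈ F₂) := by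
        tauto
      rcases hside with h | h
      · have h6 := eventually_mem_closure_pos (contMDiffAt_neg hv.self_of_nhds)
          (by rw [chartDeriv_neg]; exact neg_ne_zero.2 hne)
        filter_upwards [h6, h0, eventually_eventually_nhds.2 h] with y y1 y2 y3 hy
        have := y1 (by rw [y2.2 hy, neg_zero])
        rw [mem_closure_iff_frequently] at this ⊢
        exact (this.and_eventually y3).mono fun z hz => hz.2 (neg_pos.1 hz.1)
      · have h6 := eventually_mem_closure_pos hv.self_of_nhds hne
        filter_upwards [h6, h0, eventually_eventually_nhds.2 h] with y y1 y2 y3 hy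
        have := y1 (y2.2 hy)
        rw [mem_closure_iff_frequently] at this ⊢
        exact (this.and_eventually y3).mono fun z hz => hz.2 hz.1
    have := hc.contMDiff.continuous.continuousAt.eventually hcl
    filter_upwards [this] with z hz using hz ⟨z, rfl⟩
  rcases isClopen_iff.1 hclopen with h | h
  · exfalso
    have hclosed : IsClosed F₂ := by
      rw [← closure_subset_iff_isClosed]
      intro y hy
      rcases hsep.trichotomy y with ⟨z, rfl⟩ | h1 | h2
      · exact absurd (show z ∈ {θ | c θ ∈ closure F₂} from hy) (by rw [h]; simp)
      · rw [mem_closure_iff_nhds] at hy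
        obtain ⟨w, hw1, hw2⟩ := hy F₁ (hsep.isOpen_left.mem_nhds h1)
        exact absurd hw2 (disjoint_left.1 hsep.disjoint hw1)
      · exact h2
    rcases isClopen_iff.1 ⟨hclosed, hsep.isOpen_right⟩ with h1 | h1
    · exact hsep.isConnected_right.nonempty.ne_empty h1
    · obtain ⟨y, hy⟩ := hsep.isConnected_left.nonempty
      exact disjoint_left.1 hsep.disjoint hy (h1 ▸ mem_univ y)
  · exact (h ▸ mem_univ θ : θ ∈ {θ | c θ ∈ closure F₂})

/-- Both components adhere to `c θ`, so the two halves belong to different components; the sign of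
`v` is changed if necessary. -/
theorem exists_local_defining_function [T2Space M] [PreconnectedSpace M]
    (hc : Manifold.IsSmoothEmbedding (𝓡 1) (𝓡 2) ∞ c) (hsep : Separates (range c) F₁ F₂)
    (θ : Circle) :
    ∃ v : M → ℝ, (∀ᶠ y in 𝓝 (c θ), ContMDiffAt (𝓡 2) 𝓘(ℝ, ℝ) ∞ v y) ∧
      chartDeriv E2 v (c θ) ≠ 0 ∧ ∀ᶠ y in 𝓝 (c θ), (y ∈ F₁ → v y < 0) ∧ (y ∈ F₂ → 0 < v y) ∧
        (y ∈ range c → v y = 0) := by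
  obtain ⟨v, hv, hne, h0, h1, h2⟩ := exists_local_sides hc hsep θ
  have hcl1 := range_subset_closure_right hc hsep.symm θ
  have hcl2 := range_subset_closure_right hc hsep θ
  rw [mem_closure_iff_frequently] at hcl1 hcl2
  have excl : ∀ {A B : Set M}, Separates (range c) A B → (∃ᶠ y in 𝓝 (c θ), y ∈ B) →
      (∀ᶠ y in 𝓝 (c θ), v y < 0 → y ∈ A) → ¬ (∀ᶠ y in 𝓝 (c θ), 0 < v y → y ∈ A) := by
    intro A B hAB hfr h3 h4
    apply hfr
    filter_upwards [h3, h4, h0] with y y1 y2 y3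
    rcases lt_trichotomy (v y) 0 with h | h | h
    · exact disjoint_left.1 hAB.disjoint (y1 h)
    · exact hAB.symm.notMem_left (y3.1 h)
    · exact disjoint_left.1 hAB.disjoint (y2 h)
  have hdis := disjoint_left.1 hsep.disjoint
  rcases h1 with h1 | h1
  · have h2' := h2.resolve_left (excl hsep hcl2 h1)
    refine ⟨v, hv, hne, ?_⟩
    filter_upwards [h0, h1, h2'] with y y0 y1 y2
    refine ⟨fun hy => ?_, fun hy => ?_, y0.2⟩
    · rcases lt_trichotomy (v y) 0 with h | h | h
      · exact h
      · exact absurd hy (hsep.notMem_left (y0.1 h))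
      · exact absurd (y2 h) (hdis hy)
    · rcases lt_trichotomy (v y) 0 with h | h | h
      · exact absurd hy (hdis (y1 h))
      · exact absurd hy (hsep.symm.notMem_left (y0.1 h))
      · exact h
  · have h2' := h2.resolve_right (excl hsep.symm hcl1 h1)
    refine ⟨fun y => -v y, hv.mono fun y hy => contMDiffAt_neg hy,
      by rw [chartDeriv_neg]; exact neg_ne_zero.2 hne, ?_⟩
    filter_upwards [h0, h1, h2'] with y y0 y1 y2
    refine ⟨fun hy => ?_, fun hy => ?_, fun hy => by rw [y0.2 hy, neg_zero]⟩
    · rcases lt_trichotomy (v y) 0 with h | h | h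
      · exact absurd (y1 h) (hdis hy)
      · exact absurd hy (hsep.notMem_left (y0.1 h))
      · exact neg_neg_iff_pos.2 h
    · rcases lt_trichotomy (v y) 0 with h | h | h
      · exact neg_pos.2 h
      · exact absurd hy (hsep.symm.notMem_left (y0.1 h))
      · exact absurd hy (hdis (y2 h))

/-- A smooth function on the surface, which is negative on one side of a separating curve,
positive on the other side, and vanishes on the curve to first order. -/
theorem exists_defining_function [T2Space M] [CompactSpace M] [PreconnectedSpace M]
    (hc : Manifold.IsSmoothEmbedding (𝓡 1) (𝓡 2) ∞ c) (hsep : Separates (range c) F₁ F₂) :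
    ∃ s : M → ℝ, ContMDiff (𝓡 2) 𝓘(ℝ, ℝ) ∞ s ∧ (∀ x, s x < 0 ↔ x ∈ F₁) ∧ (∀ x, 0 < s x ↔ x ∈ F₂) ∧
      (∀ x, s x = 0 ↔ x ∈ range c) ∧ ∀ x, s x = 0 → chartDeriv E2 s x ≠ 0 := by
  choose v hv hne hsgn using exists_local_defining_function hc hsep
  have hdis := disjoint_left.1 hsep.disjoint
  -- The sign conditions are convex, so a partition of unity yields `s₁` with the right signs.
  -- Regularity along the curve is not part of these conditions and is supplied by the functions `V`
  -- below.
  obtain ⟨s₁, hs₁⟩ : ∃ g : C^∞⟮𝓡 2, M; 𝓘(ℝ, ℝ), ℝ⟯, ∀ x, g x ∈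
      {t : ℝ | (x ∈ F₁ → t < 0) ∧ (x ∈ F₂ → 0 < t) ∧ (x ∈ range c → t = 0)} := by
    refine exists_contMDiffMap_forall_mem_convex_of_local (𝓡 2) (n := (⊤ : ℕ∞)) (fun x => ?_)
      fun x => ?_
    · rcases hsep.trichotomy x with h | h | h
      · have h1 := hsep.notMem_left h
        have h2 := hsep.symm.notMem_left h
        simp [h, h1, h2]
      · have h1 := hdis h
        have h2 : x ∉ range c := fun h' => hsep.notMem_left h' h
        have : {t : ℝ | (x ∈ F₁ → t < 0) ∧ (x ∈ F₂ → 0 < t) ∧ (x ∈ range c → t = 0)} = Iio 0 := by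
          ext t; simp [h, h1, -mem_range, h2]
        rw [this]; exact convex_Iio 0
      · have h1 : x ∉ F₁ := fun h' => hdis h' h
        have h2 : x ∉ range c := fun h' => hsep.symm.notMem_left h' h
        have : {t : ℝ | (x ∈ F₁ → t < 0) ∧ (x ∈ F₂ → 0 < t) ∧ (x ∈ range c → t = 0)} = Ioi 0 := by
          ext t; simp [h, h1, -mem_range, h2]
        rw [this]; exact convex_Ioi 0
    · rcases hsep.trichotomy x with ⟨θ, rfl⟩ | h | h
      · exact ⟨_, (hv θ).and (hsgn θ), v θ, fun y hy => hy.1.contMDiffWithinAt, fun y hy => hy.2⟩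
      · refine ⟨F₁, hsep.isOpen_left.mem_nhds h, fun _ => -1, contMDiffOn_const, fun y hy => ?_⟩
        exact ⟨fun _ => by norm_num, fun h' => absurd h' (hdis hy),
          fun h' => absurd hy (hsep.notMem_left h')⟩
      · refine ⟨F₂, hsep.isOpen_right.mem_nhds h, fun _ => 1, contMDiffOn_const, fun y hy => ?_⟩
        exact ⟨fun h' => absurd hy (hdis h'), fun _ => by norm_num,
          fun h' => absurd hy (hsep.symm.notMem_left h')⟩
  have hbump : ∀ θ, ∃ V : M → ℝ, ContMDiff (𝓡 2) 𝓘(ℝ, ℝ) ∞ V ∧ (∀ y ∈ F₁, V y ≤ 0) ∧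
      (∀ y ∈ F₂, 0 ≤ V y) ∧ (∀ y ∈ range c, V y = 0) ∧ ∀ᶠ y in 𝓝 (c θ), chartDeriv E2 V y ≠ 0 := by
    intro θ
    obtain ⟨f, -, hf⟩ := (SmoothBumpFunction.nhds_basis_tsupport (I := 𝓡 2) (c θ)).mem_iff.1
      ((hv θ).and (hsgn θ))
    have hzero : ∀ y, y ∉ tsupport f → f y = 0 := fun y hy => image_eq_zero_of_notMem_tsupport hy
    refine ⟨fun y => f y * v θ y, ?_, fun y hy => ?_, fun y hy => ?_, fun y hy => ?_, ?_⟩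
    · refine contMDiff_of_tsupport fun y hy => ?_
      have hy' : y ∈ tsupport f := tsupport_mul_subset_left hy
      exact f.contMDiffAt.mul (hf hy').1
    · by_cases h : y ∈ tsupport f
      · exact mul_nonpos_of_nonneg_of_nonpos f.nonneg ((hf h).2.1 hy).le
      · simp [hzero y h]
    · by_cases h : y ∈ tsupport f
      · exact mul_nonneg f.nonneg ((hf h).2.2.1 hy).le
      · simp [hzero y h]
    · by_cases h : y ∈ tsupport f
      · simp [(hf h).2.2.2 hy]
      · simp [hzero y h]
    · have h1 := eventually_chartDeriv_ne_zero (hv θ) (hne θ)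
      filter_upwards [h1, eventually_eventually_nhds.2 f.eventuallyEq_one] with y hy hfy
      have heq : (fun y => f y * v θ y) =ᶠ[𝓝 y] v θ := by
        filter_upwards [hfy] with z hz
        simp [hz]
      have : chartDeriv E2 (fun y => f y * v θ y) y = chartDeriv E2 (v θ) y := by
        unfold chartDeriv
        refine Filter.EventuallyEq.fderiv_eq ?_
        exact eventually_nhds_chartAt heq
      rwa [this]
  choose V hVs hV1 hV2 hV0 hVd using hbump
  obtain ⟨T, hT⟩ := isCompact_univ.elim_nhds_subcover (fun θ : Circle => c ⁻¹' {y |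
    chartDeriv E2 (V θ) y ≠ 0}) fun θ _ => hc.contMDiff.continuous.continuousAt (hVd θ)
  have hneg : ∀ x ∈ F₁, s₁ x + ∑ θ ∈ T, V θ x < 0 := fun x hx =>
    add_neg_of_neg_of_nonpos ((hs₁ x).1 hx) (Finset.sum_nonpos fun θ _ => hV1 θ x hx)
  have hpos : ∀ x ∈ F₂, 0 < s₁ x + ∑ θ ∈ T, V θ x := fun x hx =>
    add_pos_of_pos_of_nonneg ((hs₁ x).2.1 hx) (Finset.sum_nonneg fun θ _ => hV2 θ x hx)
  have hzero : ∀ x ∈ range c, s₁ x + ∑ θ ∈ T, V θ x = 0 := fun x hx => by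
    rw [(hs₁ x).2.2 hx, Finset.sum_eq_zero fun θ _ => hV0 θ x hx, add_zero]
  have hs : ContMDiff (𝓡 2) 𝓘(ℝ, ℝ) ∞ fun x => s₁ x + ∑ θ ∈ T, V θ x :=
    s₁.contMDiff.add (contMDiff_finsetSum fun θ _ => hVs θ)
  have hiff0 : ∀ x, s₁ x + ∑ θ ∈ T, V θ x = 0 ↔ x ∈ range c := fun x => by
    refine ⟨fun h => ?_, hzero x⟩
    rcases hsep.trichotomy x with h' | h' | h'
    · exact h'
    · exact absurd h (hneg x h').ne
    · exact absurd h (hpos x h').ne'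
  refine ⟨fun x => s₁ x + ∑ θ ∈ T, V θ x, hs, fun x => ⟨fun h => ?_, hneg x⟩,
    fun x => ⟨fun h => ?_, hpos x⟩, hiff0, fun x hx => ?_⟩
  · rcases hsep.trichotomy x with h' | h' | h'
    · exact absurd (hzero x h') h.ne
    · exact h'
    · exact absurd (hpos x h') h.not_gt
  · rcases hsep.trichotomy x with h' | h' | h'
    · exact absurd (hzero x h') h.ne'
    · exact absurd (hneg x h') h.not_gt
    · exact h'
  · have hxc := (hiff0 x).1 hx
    obtain ⟨θ, rfl⟩ := hxc
    have hcov := hT.2 (mem_univ θ)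
    simp only [mem_iUnion] at hcov
    obtain ⟨i, hi, hd⟩ := hcov
    have hd' : chartDeriv E2 (V i) (c θ) ≠ 0 := hd
    obtain ⟨n, hn⟩ := exists_apply_pos hd'
    -- Where `V i` is positive the whole sum is at least `V i`, so its derivative along `n` is at
    -- least that of `V i`, which is positive.
    have hle := mfderiv_le_of_eventually_le (s := V i) (k := fun x => s₁ x + ∑ θ ∈ T, V θ x)
      (m := V i) (hVs i _) (hs _) (hVs i _) (by rw [hV0 i _ ⟨θ, rfl⟩]; exact hx)
      (Eventually.of_forall fun y hy => ?_) hn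
    · intro h0
      have h0' : chartDeriv E2 (fun x => s₁ x + ∑ θ ∈ T, V θ x) (c θ) n = 0 := by
        rw [h0]; rfl
      linarith
    · rw [hV0 i _ ⟨θ, rfl⟩] at hy
      have hy2 : y ∈ F₂ := by
        rcases hsep.trichotomy y with h' | h' | h'
        · exact absurd (hV0 i y h') hy.ne'
        · exact absurd (hV1 i y h') hy.not_ge
        · exact h'
      have h1 : V i y ≤ ∑ θ ∈ T, V θ y :=
        Finset.single_le_sum (f := fun θ => V θ y) (fun θ _ => hV2 θ y hy2) hi
      linarith [(hs₁ y).2.1 hy2]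

end DefiningFunction

/-! ### Local separating functions at points of the curve, branch points included. -/

section ChainRule

variable {E : Type*} [NormedAddCommGroup E] [NormedSpace ℝ E] {F : Type*} [NormedAddCommGroup F]
  [NormedSpace ℝ F] {V : Type*} [NormedAddCommGroup V] [NormedSpace ℝ V]
  {N : Type*} [TopologicalSpace N] [ChartedSpace E N] [IsManifold 𝓘(ℝ, E) ∞ N]
  {M : Type*} [TopologicalSpace M] [ChartedSpace F M] [IsManifold 𝓘(ℝ, F) ∞ M]

theorem hasFDerivAt_chart_comp {c : N → M} {x : N} (hc : ContMDiffAt 𝓘(ℝ, E) 𝓘(ℝ, F) ∞ c x) :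
    HasFDerivAt ((chartAt F (c x) ∘ c) ∘ (chartAt E x).symm)
      (chartDeriv E (chartAt F (c x) ∘ c) x) (chartAt E x x) :=
  (hasStrictFDerivAt_comp_chartAt_symm (ContMDiffAt.comp x
    ((contMDiffOn_chart (I := 𝓘(ℝ, F))).contMDiffAt
      ((chartAt F (c x)).open_source.mem_nhds (mem_chart_source F (c x)))) hc)).hasFDerivAt

theorem chartDeriv_comp {c : N → M} {x : N} (hc : ContMDiffAt 𝓘(ℝ, E) 𝓘(ℝ, F) ∞ c x) {k : M → V}
    (hk : ContMDiffAt 𝓘(ℝ, F) 𝓘(ℝ, V) ∞ k (c x)) :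
    chartDeriv E (k ∘ c) x =
      (chartDeriv F k (c x)).comp (chartDeriv E (chartAt F (c x) ∘ c) x) := by
  have h1 := hasFDerivAt_chart_comp hc
  have h2 : HasFDerivAt (k ∘ (chartAt F (c x)).symm) (chartDeriv F k (c x))
      (((chartAt F (c x) ∘ c) ∘ (chartAt E x).symm) (chartAt E x x)) := by
    rw [comp_chartAt_symm_apply]
    exact (hasStrictFDerivAt_comp_chartAt_symm hk).hasFDerivAt
  refine HasFDerivAt.fderiv ((h2.comp _ h1).congr_of_eventuallyEq ?_)
  have h3 := eventually_nhds_chartAt (E := E) (hc.continuousAt.preimage_mem_nhds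
    ((chartAt F (c x)).open_source.mem_nhds (mem_chart_source F (c x))))
  filter_upwards [h3] with y hy
  simp only [Function.comp_apply]
  rw [(chartAt F (c x)).left_inv hy]

end ChainRule

section SphereValued

variable {E : Type*} [NormedAddCommGroup E] [NormedSpace ℝ E]
  {N : Type*} [TopologicalSpace N] [ChartedSpace E N] [IsManifold 𝓘(ℝ, E) ∞ N]

variable {V : Type*} [NormedAddCommGroup V] [InnerProductSpace ℝ V] {d : ℕ}
  [Fact (Module.finrank ℝ V = d + 1)]

omit [IsManifold 𝓘(ℝ, E) ∞ N] in
theorem contMDiff_coe_comp {g : N → Metric.sphere (0 : V) 1}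
    (hg : ContMDiff 𝓘(ℝ, E) (𝓡 d) ∞ g) : ContMDiff 𝓘(ℝ, E) 𝓘(ℝ, V) ∞ fun y => (g y : V) :=
  contMDiff_coe_sphere.comp hg

omit [IsManifold 𝓘(ℝ, E) ∞ N] in
theorem injective_chartDeriv_coe {g : N → Metric.sphere (0 : V) 1}
    (hg : ContMDiff 𝓘(ℝ, E) (𝓡 d) ∞ g) {x : N}
    (hinj : Function.Injective (mfderiv 𝓘(ℝ, E) (𝓡 d) g x)) :
    Function.Injective (chartDeriv E (fun y => (g y : V)) x) := by
  have h1 : MDifferentiableAt (𝓡 d) 𝓘(ℝ, V) ((↑) : Metric.sphere (0 : V) 1 → V) (g x) :=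
    (contMDiff_coe_sphere (m := 1)).mdifferentiableAt (by simp)
  have h2 : MDifferentiableAt 𝓘(ℝ, E) (𝓡 d) g x := hg.mdifferentiableAt (by simp)
  have h3 := mfderiv_comp x h1 h2
  have h4 : Function.Injective (mfderiv (𝓡 d) 𝓘(ℝ, V) ((↑) : Metric.sphere (0 : V) 1 → V) (g x)) :=
    injective_mvfderiv_subtypeVal_sphere (E := V) (n := d) (g x)
  rw [chartDeriv_eq_mfderiv ((contMDiff_coe_comp hg).mdifferentiableAt (by simp))]
  have h5 : Function.Injective (mfderiv 𝓘(ℝ, E) 𝓘(ℝ, V) (fun y => (g y : V)) x) := by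
    have h6 : (fun y => (g y : V)) = ((↑) : Metric.sphere (0 : V) 1 → V) ∘ g := rfl
    rw [h6, h3]
    exact h4.comp hinj
  exact h5

/-- This extends local functions on `S³` smoothly to open subsets of `ℝ⁴`, where derivatives and
partitions of unity are taken. -/
theorem exists_contMDiff_retraction (p : S3) : ∃ r : E4 → S3, (∀ᶠ y : S3 in 𝓝 p, r (y : E4) = y) ∧
    ∀ᶠ q in 𝓝 (p : E4), ContMDiffAt 𝓘(ℝ, E4) (𝓡 3) ∞ r q := by
  refine exists_contMDiff_leftInverse (k := ((↑) : S3 → E4))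
    (Eventually.of_forall fun y => contMDiff_coe_sphere.contMDiffAt) ?_
  refine injective_chartDeriv_coe (g := id) contMDiff_id ?_
  rw [mfderiv_id]
  exact Function.injective_id

end SphereValued

section BranchPoint

variable {M : Type*} [TopologicalSpace M] [ChartedSpace E2 M] [IsManifold (𝓡 2) ∞ M]

/-- Coordinates near a branch point: `u` is a function which factors through the map, `σ` is the
curve `u = 0`, along which the map is even, and `n` is its tangent vector. -/
theorem IsBranchPoint.exists_coordinates {φ : M → S3} {x : M} (hφ : ContinuousAt φ x)
    (h : IsBranchPoint φ x) :
    ∃ (u : M → ℝ) (X : E4 → ℝ) (σ : ℝ → M) (n : E2),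
      (∀ᶠ y in 𝓝 x, ContMDiffAt (𝓡 2) 𝓘(ℝ, ℝ) ∞ u y) ∧
      (∀ᶠ q in 𝓝 (φ x : E4), ContDiffAt ℝ ∞ X q) ∧ (∀ᶠ y in 𝓝 x, X (φ y) = u y) ∧
      n ≠ 0 ∧ chartDeriv E2 u x n = 0 ∧ (∀ m, chartDeriv E2 u x m = 0 → ∃ β : ℝ, m = β • n) ∧
      σ 0 = x ∧ ContinuousAt σ 0 ∧ (∀ᶠ t in 𝓝 0, φ (σ (-t)) = φ (σ t)) ∧
      (∀ k : M → ℝ, ContMDiffAt (𝓡 2) 𝓘(ℝ, ℝ) ∞ k x →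
        HasDerivAt (k ∘ σ) (chartDeriv E2 k x n) 0) ∧
      ∀ k : M → E4, ContMDiffAt (𝓡 2) 𝓘(ℝ, E4) ∞ k x →
        HasDerivAt (k ∘ σ) (chartDeriv E2 k x n) 0 := by
  obtain ⟨a, ha, b, hb, hxa, hxb, ha0, hab⟩ := h
  have has : a.source ∈ 𝓝 x := a.open_source.mem_nhds hxa
  have hbs : b.source ∈ 𝓝 (φ x) := b.open_source.mem_nhds hxb
  have h0t : (0 : E2) ∈ a.target := ha0 ▸ a.map_source hxa
  have hsx : a.symm 0 = x := by rw [← ha0, a.left_inv hxa]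
  set A := chartAt E2 x with hA
  have hAs : A.source ∈ 𝓝 x := A.open_source.mem_nhds (mem_chart_source E2 x)
  have haM : ∀ᶠ y in 𝓝 x, ContMDiffAt (𝓡 2) 𝓘(ℝ, E2) ∞ a y := by
    filter_upwards [has] with y hy using contMDiffAt_of_mem_maximalAtlas ha hy
  have hasM : ContMDiffAt 𝓘(ℝ, E2) (𝓡 2) ∞ a.symm 0 :=
    contMDiffAt_symm_of_mem_maximalAtlas ha h0t
  let T : E2 →L[ℝ] E2 := chartDeriv E2 a x
  have hT : HasFDerivAt (a ∘ A.symm) T (A x) :=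
    (hasStrictFDerivAt_comp_chartAt_symm haM.self_of_nhds).hasFDerivAt
  have hS' : ContDiffAt ℝ ∞ (A ∘ a.symm) 0 := by
    rw [← contMDiffAt_iff_contDiffAt]
    refine ContMDiffAt.comp _ ?_ hasM
    rw [hsx]
    exact (contMDiffOn_chart (I := 𝓡 2)).contMDiffAt hAs
  let S : E2 →L[ℝ] E2 := fderiv ℝ (A ∘ a.symm) 0
  have hS : HasFDerivAt (A ∘ a.symm) S 0 := (hS'.differentiableAt (by simp)).hasFDerivAt
  have hST : S.comp T = ContinuousLinearMap.id ℝ E2 := by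
    have h1 : HasFDerivAt (A ∘ a.symm) S ((a ∘ A.symm) (A x)) := by
      rwa [comp_chartAt_symm_apply, ha0]
    refine (h1.comp _ hT).unique ((hasFDerivAt_id _).congr_of_eventuallyEq ?_)
    filter_upwards [eventually_nhds_chartAt (E := E2) has,
      A.open_target.mem_nhds (mem_chart_target E2 x)] with z hz hzt
    change A (a.symm (a (A.symm z))) = z
    rw [a.left_inv hz, A.right_inv hzt]
  have hTS : T.comp S = ContinuousLinearMap.id ℝ E2 := by
    have h1 : HasFDerivAt (a ∘ A.symm) T ((A ∘ a.symm) 0) := by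
      rwa [Function.comp_apply, hsx]
    refine (h1.comp _ hS).unique ((hasFDerivAt_id _).congr_of_eventuallyEq ?_)
    filter_upwards [hasM.continuousAt.preimage_mem_nhds (by rw [hsx]; exact hAs),
      a.open_target.mem_nhds h0t] with z hz hzt
    simp [A.left_inv hz, a.right_inv hzt]
  -- In the umbrella coordinates `(u, v) ↦ (u, v², u v)` the `v`-axis is mapped evenly, and its
  -- direction spans the kernel of the differential at the branch point.
  let e₁ : E2 := !₂[0, 1]
  have hu : ∀ᶠ y in 𝓝 x, ContMDiffAt (𝓡 2) 𝓘(ℝ, ℝ) ∞ (fun y => a y 0) y := by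
    filter_upwards [haM] with y hy
    exact ContMDiffAt.comp y (g := fun z : E2 => z 0)
      (EuclideanSpace.proj (𝕜 := ℝ) (0 : Fin 2)).contDiff.contMDiff.contMDiffAt hy
  have hdu : ∀ m, chartDeriv E2 (fun y => a y 0) x m = T m 0 := by
    intro m
    have := ((EuclideanSpace.proj (𝕜 := ℝ) (0 : Fin 2)).hasFDerivAt.comp _ hT).fderiv
    exact congrArg (fun L : E2 →L[ℝ] ℝ => L m) this
  obtain ⟨ρ, hρ, hρs⟩ := exists_contMDiff_retraction (φ x)
  have hρx : ρ (φ x) = φ x := hρ.self_of_nhds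
  have hline : HasDerivAt (fun t : ℝ => t • e₁) e₁ 0 := by
    simpa using (hasDerivAt_id (0 : ℝ)).smul_const e₁
  have hσc : ContinuousAt (fun t : ℝ => a.symm (t • e₁)) 0 := by
    refine ContinuousAt.comp (g := a.symm) (f := fun t : ℝ => t • e₁) ?_ (by fun_prop)
    rw [zero_smul]
    exact a.continuousAt_symm h0t
  have hσx : a.symm ((0 : ℝ) • e₁) = x := by rw [zero_smul, hsx]
  have hσd : HasDerivAt (fun t : ℝ => A (a.symm (t • e₁))) (S e₁) 0 := by
    have h1 : HasFDerivAt (A ∘ a.symm) S ((0 : ℝ) • e₁) := by rwa [zero_smul]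
    exact h1.comp_hasDerivAt (0 : ℝ) hline
  have hσnear : ∀ᶠ t : ℝ in 𝓝 0, a.symm (t • e₁) ∈ A.source :=
    hσc.preimage_mem_nhds (by rw [hσx]; exact hAs)
  have hTn : T (S e₁) = e₁ := by
    have := congrArg (fun L : E2 →L[ℝ] E2 => L e₁) hTS
    simpa using this
  refine ⟨fun y => a y 0, fun q => b (ρ q) 0, fun t => a.symm (t • e₁), S e₁, hu, ?_, ?_, ?_, ?_,
    ?_, hσx, hσc, ?_, ?_, ?_⟩
  · have h1 : ∀ᶠ q in 𝓝 (φ x : E4), ρ q ∈ b.source :=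
      hρs.self_of_nhds.continuousAt.preimage_mem_nhds (by rw [hρx]; exact hbs)
    filter_upwards [h1, hρs] with q hq1 hq2
    rw [← contMDiffAt_iff_contDiffAt]
    exact ContMDiffAt.comp q (g := fun z : EuclideanSpace ℝ (Fin 3) => z 0) (f := fun q => b (ρ q))
      (EuclideanSpace.proj (𝕜 := ℝ) (0 : Fin 3)).contDiff.contMDiff.contMDiffAt
      (ContMDiffAt.comp q (contMDiffAt_of_mem_maximalAtlas hb hq1) hq2)
  · filter_upwards [hab, hφ.eventually hρ] with y hy1 hy2
    rw [hy2, hy1]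
    rfl
  · intro h0
    rw [h0, map_zero] at hTn
    have := congrArg (fun z : E2 => z 1) hTn
    simp [e₁] at this
  · rw [hdu, hTn]; simp [e₁]
  · intro m hm
    refine ⟨T m 1, ?_⟩
    have h1 : T m = (T m 1) • e₁ := by
      rw [hdu] at hm
      ext i
      fin_cases i
      · simpa [e₁] using hm
      · simp [e₁]
    have h2 : S (T m) = m := congrArg (fun L : E2 →L[ℝ] E2 => L m) hST
    rw [← map_smul, ← h1, h2]
  · have h1 : ∀ᶠ t : ℝ in 𝓝 0, (φ (a.symm (t • e₁)) ∈ b.source) ∧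
        b (φ (a.symm (t • e₁))) = !₂[0, t ^ 2, 0] := by
      have h2 : ∀ᶠ t : ℝ in 𝓝 0, t • e₁ ∈ a.target := by
        refine ContinuousAt.preimage_mem_nhds (by fun_prop) (a.open_target.mem_nhds ?_)
        simpa using h0t
      have h3 := hσc.eventually (hσx ▸ hab)
      have h4 := hσc.eventually (hσx ▸ (hφ.preimage_mem_nhds hbs : ∀ᶠ y in 𝓝 x, φ y ∈ b.source))
      filter_upwards [h2, h3, h4] with t t2 t3 t4
      refine ⟨t4, ?_⟩
      rw [t3, a.right_inv t2]
      simp [e₁]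
    have h2 : ∀ᶠ t : ℝ in 𝓝 0, (φ (a.symm (-t • e₁)) ∈ b.source) ∧
        b (φ (a.symm (-t • e₁))) = !₂[0, (-t) ^ 2, 0] := by
      have : Tendsto (fun t : ℝ => -t) (𝓝 0) (𝓝 0) := by
        simpa using (continuous_neg (G := ℝ)).tendsto 0
      exact this.eventually h1
    filter_upwards [h1, h2] with t t1 t2
    apply b.injOn t2.1 t1.1
    rw [t1.2, t2.2, neg_sq]
  all_goals
    intro k hk
    have h1 := (hasStrictFDerivAt_comp_chartAt_symm hk).hasFDerivAt
    have h2 : HasFDerivAt (k ∘ A.symm) (chartDeriv E2 k x) (A (a.symm ((0 : ℝ) • e₁))) := by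
      rwa [hσx]
    refine (h2.comp_hasDerivAt (0 : ℝ) hσd).congr_of_eventuallyEq ?_
    filter_upwards [hσnear] with t ht
    simp [A.left_inv ht]

end BranchPoint

section Derivative

theorem eventually_pos_of_hasDerivAt {p : ℝ → ℝ} {d : ℝ} (h : HasDerivAt p d 0) (h0 : p 0 = 0)
    (hd : 0 < d) : ∀ᶠ t in 𝓝[>] 0, 0 < p t := by
  filter_upwards [h.tendsto_slope_zero_right.eventually_const_lt hd, self_mem_nhdsWithin] with t ht ht0
  rw [zero_add, h0, sub_zero, smul_eq_mul] at ht
  exact (mul_pos_iff_of_pos_left (inv_pos.2 ht0)).1 ht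

theorem hasDerivAt_comp_neg {V : Type*} [NormedAddCommGroup V] [NormedSpace ℝ V] {p : ℝ → V} {d : V}
    (h : HasDerivAt p d 0) : HasDerivAt (fun t => p (-t)) (-d) 0 := by
  have h1 : HasDerivAt p d (-0) := by rwa [neg_zero]
  simpa [Function.comp_def] using h1.scomp (0 : ℝ) (hasDerivAt_neg (0 : ℝ))

theorem eq_zero_of_hasDerivAt_even {V : Type*} [NormedAddCommGroup V] [NormedSpace ℝ V] {p : ℝ → V}
    {d : V} (h : HasDerivAt p d 0) (he : ∀ᶠ t in 𝓝 0, p (-t) = p t) : d = 0 := by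
  have h1 : -d = d := (hasDerivAt_comp_neg h).unique (h.congr_of_eventuallyEq he)
  have h2 : (2 : ℝ) • d = 0 := by rw [two_smul]; nth_rewrite 1 [← h1]; simp
  exact (smul_eq_zero.1 h2).resolve_left two_ne_zero

variable {E : Type*} [NormedAddCommGroup E] [NormedSpace ℝ E] {F : Type*} [NormedAddCommGroup F]
  [NormedSpace ℝ F] {M : Type*} [TopologicalSpace M] [ChartedSpace E M] [IsManifold 𝓘(ℝ, E) ∞ M]

theorem chartDeriv_sub {k m : M → F} {x : M} (hk : ContMDiffAt 𝓘(ℝ, E) 𝓘(ℝ, F) ∞ k x)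
    (hm : ContMDiffAt 𝓘(ℝ, E) 𝓘(ℝ, F) ∞ m x) :
    chartDeriv E (fun y => k y - m y) x = chartDeriv E k x - chartDeriv E m x :=
  ((hasStrictFDerivAt_comp_chartAt_symm hk).sub
    (hasStrictFDerivAt_comp_chartAt_symm hm)).hasFDerivAt.fderiv

end Derivative

section LocalSlope

variable {M : Type*} [TopologicalSpace M] [ChartedSpace E2 M]

/-- Near `x`, some smooth function `G` on `ℝ⁴` separates the values of `κ` on the two sides of
`s = 0`. -/
def HasLocalSlope (φ : M → S3) (κ s : M → ℝ) (x : M) : Prop :=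
  ∃ G : E4 → ℝ, (∀ᶠ q in 𝓝 (φ x : E4), ContDiffAt ℝ ∞ G q) ∧ ∃ ε > 0, ∀ᶠ y in 𝓝 x,
    (0 ≤ s y → ε * s y ≤ κ y - G (φ y)) ∧ (s y ≤ 0 → κ y - G (φ y) ≤ ε * s y)

variable [IsManifold (𝓡 2) ∞ M] {φ : M → S3} {κ s : M → ℝ} {x : M}

/-- Near an immersive point `φ` has a smooth left inverse, so `κ - s` factors through `φ`; with this
choice `κ - G ∘ φ` is `s` itself. -/
theorem HasLocalSlope.of_immersiveAt (hφ : ContMDiff (𝓡 2) (𝓡 3) ∞ φ)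
    (hκ : ContMDiff (𝓡 2) 𝓘(ℝ, ℝ) ∞ κ) (hs : ContMDiff (𝓡 2) 𝓘(ℝ, ℝ) ∞ s) (hx : ImmersiveAt φ x) :
    HasLocalSlope φ κ s x := by
  obtain ⟨r, hr, hrs⟩ := exists_contMDiff_leftInverse (k := fun y => (φ y : E4))
    (Eventually.of_forall fun y => contMDiff_coe_comp hφ y) (injective_chartDeriv_coe hφ hx)
  refine ⟨fun q => κ (r q) - s (r q), ?_, 1, one_pos, ?_⟩
  · filter_upwards [hrs] with q hq
    rw [← contMDiffAt_iff_contDiffAt]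
    exact ContMDiffAt.comp q (g := fun y => κ y - s y) ((hκ.sub hs) _) hq
  · filter_upwards [hr] with y hy
    simp [hy]

variable {c : Circle → M}

/-- The coordinate `u` factors through `φ` and parametrizes the curve, so the values of `κ` on the
curve extend to a function `G` of `u`. Then `κ - G ∘ φ` vanishes on the curve. In the kernel
direction `n` of `dφ` it has the derivative of `κ`, whose sign agrees with that of the derivative of
`s` by the over/under condition. -/
theorem HasLocalSlope.of_isBranchPoint (hφ : ContMDiff (𝓡 2) (𝓡 3) ∞ φ)
    (hκ : ContMDiff (𝓡 2) 𝓘(ℝ, ℝ) ∞ κ) (hs : ContMDiff (𝓡 2) 𝓘(ℝ, ℝ) ∞ s)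
    (himm : ∀ x n, chartDeriv E2 (fun y => (φ y : E4)) x n = 0 → chartDeriv E2 κ x n = 0 → n = 0)
    (horder : ∀ x y, x ≠ y → φ x = φ y → κ y < κ x → s x < 0 → s y < 0)
    (hc : Manifold.IsSmoothEmbedding (𝓡 1) (𝓡 2) ∞ c)
    (hK : Manifold.IsSmoothEmbedding (𝓡 1) (𝓡 3) ∞ (φ ∘ c))
    (hsc : ∀ x, s x = 0 ↔ x ∈ range c) (hs0 : s x = 0) (hds : chartDeriv E2 s x ≠ 0)
    (hx : IsBranchPoint φ x) [T2Space M] : HasLocalSlope φ κ s x := by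
  obtain ⟨θ, rfl⟩ := (hsc x).1 hs0
  obtain ⟨u, X, σ, n, hu, hX, hXu, hn0, hun, huker, hσ0, hσc, hσφ, hσd, hσd4⟩ :=
    hx.exists_coordinates hφ.continuous.continuousAt
  have hcs := hc.contMDiff θ
  set D := chartDeriv (EuclideanSpace ℝ (Fin 1)) (chartAt E2 (c θ) ∘ c) θ with hD
  have hφ4 : chartDeriv E2 (fun y => (φ y : E4)) (c θ) n = 0 :=
    eq_zero_of_hasDerivAt_even (hσd4 _ (contMDiff_coe_comp hφ _)) (hσφ.mono fun t ht => by
      simp only [Function.comp_apply, ht])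
  -- A tangent vector of the curve killed by `du` is a multiple of `n`, hence killed by `dφ`, while
  -- `φ ∘ c` is an immersion.
  have hdu : Function.Injective (chartDeriv (EuclideanSpace ℝ (Fin 1)) (u ∘ c) θ) := by
    rw [injective_iff_map_eq_zero]
    intro τ hτ
    rw [chartDeriv_comp hcs hu.self_of_nhds] at hτ
    obtain ⟨β, hβ⟩ := huker (D τ) hτ
    have h1 := injective_chartDeriv_coe hK.contMDiff
      (mfderiv_injective_of_isImmersionAt (hK.isImmersion.isImmersionAt θ))
    rw [injective_iff_map_eq_zero] at h1
    apply h1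
    have h2 : chartDeriv (EuclideanSpace ℝ (Fin 1)) (fun y => ((φ ∘ c) y : E4)) θ =
        (chartDeriv E2 (fun y => (φ y : E4)) (c θ)).comp D :=
      chartDeriv_comp hcs (contMDiff_coe_comp hφ (c θ))
    rw [h2, ContinuousLinearMap.comp_apply, hβ, map_smul, hφ4, smul_zero]
  have huc : ∀ᶠ η in 𝓝 θ, ContMDiffAt (𝓡 1) 𝓘(ℝ, ℝ) ∞ (u ∘ c) η := by
    filter_upwards [hc.contMDiff.continuous.continuousAt.eventually hu] with η hη
    exact hη.comp η (hc.contMDiff η)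
  obtain ⟨r, hr, hrs⟩ := exists_contMDiff_leftInverse huc hdu
  let G : E4 → ℝ := fun q => κ (c (r (X q)))
  have hXx : X (φ (c θ)) = u (c θ) := hXu.self_of_nhds
  have hG : ∀ᶠ q in 𝓝 (φ (c θ) : E4), ContDiffAt ℝ ∞ G q := by
    have h1 : ∀ᶠ q in 𝓝 (φ (c θ) : E4), ContMDiffAt 𝓘(ℝ, ℝ) (𝓡 1) ∞ r (X q) :=
      hX.self_of_nhds.continuousAt.eventually (by rw [hXx]; exact hrs)
    filter_upwards [h1, hX] with q hq1 hq2
    rw [← contMDiffAt_iff_contDiffAt]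
    refine ContMDiffAt.comp q (g := fun η => κ (c η)) (f := fun q => r (X q))
      ((hκ.comp hc.contMDiff) _) ?_
    exact ContMDiffAt.comp q (g := r) (f := X) hq1 hq2.contMDiffAt
  have hGφ : ContMDiffAt (𝓡 2) 𝓘(ℝ, ℝ) ∞ (fun y => G (φ y)) (c θ) :=
    ContMDiffAt.comp (c θ) (g := G) (f := fun y => (φ y : E4)) hG.self_of_nhds.contMDiffAt
      (contMDiff_coe_comp hφ _)
  have hk : ContMDiffAt (𝓡 2) 𝓘(ℝ, ℝ) ∞ (fun y => κ y - G (φ y)) (c θ) := (hκ _).sub hGφ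
  have hk0 : ∀ᶠ y in 𝓝 (c θ), s y = 0 → κ y - G (φ y) = 0 := by
    have h1 : ∀ᶠ y in 𝓝 (c θ), ∀ η ∈ univ, c η = y → r (u (c η)) = η := by
      refine eventually_forall_fiber isCompact_univ hc.contMDiff.continuous fun η _ hη => ?_
      rw [hc.isEmbedding.injective hη]
      exact hr
    filter_upwards [h1, hXu] with y y1 y2 y3
    obtain ⟨η, rfl⟩ := (hsc y).1 y3
    simp [G, y2, y1 η trivial rfl]
  have hsd := hσd s (hs _)
  have hκd := hσd κ (hκ _)
  -- The differential of `s` kills the tangent of the curve. If it also killed `n`, which together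
  -- with that tangent spans the plane, it would vanish.
  have hA : chartDeriv E2 s (c θ) n ≠ 0 := by
    intro h0
    obtain ⟨τ, hτ⟩ : ∃ τ : EuclideanSpace ℝ (Fin 1), τ ≠ 0 := exists_ne 0
    have h1 : chartDeriv E2 s (c θ) (D τ) = 0 := by
      have h2 := chartDeriv_comp hcs (hs (c θ))
      have h3 : s ∘ c = fun _ => 0 := by
        funext η; exact (hsc _).2 ⟨η, rfl⟩
      have h4 : chartDeriv (EuclideanSpace ℝ (Fin 1)) (s ∘ c) θ = 0 := by
        rw [h3]; exact fderiv_const_apply _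
      rw [h4] at h2
      exact (congrArg (fun L : EuclideanSpace ℝ (Fin 1) →L[ℝ] ℝ => L τ) h2).symm
    have h2 : chartDeriv E2 u (c θ) (D τ) ≠ 0 := by
      intro h3
      apply hτ
      apply (injective_iff_map_eq_zero _).1 hdu
      rw [chartDeriv_comp hcs hu.self_of_nhds]
      exact h3
    apply hds
    ext1 m
    obtain ⟨β, hβ⟩ := huker (m - (chartDeriv E2 u (c θ) m / chartDeriv E2 u (c θ) (D τ)) • D τ) (by
      rw [map_sub, map_smul, smul_eq_mul, div_mul_cancel₀ _ h2, sub_self])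
    rw [sub_eq_iff_eq_add.1 hβ, map_add, map_smul, map_smul, h0, h1]
    simp
  have hC : chartDeriv E2 κ (c θ) n ≠ 0 := fun h0 => hn0 (himm _ _ hφ4 h0)
  -- The points `σ t` and `σ (-t)` have the same projection and lie on opposite sides of the curve.
  -- A negative product would put the one with `s < 0` above the one with `s > 0`.
  have hAC : 0 < chartDeriv E2 s (c θ) n * chartDeriv E2 κ (c θ) n := by
    set A := chartDeriv E2 s (c θ) n
    set C := chartDeriv E2 κ (c θ) n
    by_contra! hle
    have hlt : A * C < 0 := lt_of_le_of_ne hle (mul_ne_zero hA hC)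
    have e1 := eventually_pos_of_hasDerivAt (hsd.const_mul A) (by simp [hσ0, hs0])
      (mul_self_pos.2 hA)
    have e2 := eventually_pos_of_hasDerivAt ((hasDerivAt_comp_neg hsd).const_mul (-A))
      (by simp [hσ0, hs0]) (by rw [neg_mul_neg]; exact mul_self_pos.2 hA)
    have e3 := eventually_pos_of_hasDerivAt ((hκd.sub (hasDerivAt_comp_neg hκd)).const_mul (-A))
      (by simp) (by linarith)
    obtain ⟨t, t1, t2, t3, t4⟩ := (e1.and (e2.and (e3.and
      (hσφ.filter_mono nhdsWithin_le_nhds)))).exists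
    simp only [Function.comp_apply, Pi.sub_apply] at t1 t2 t3
    rcases lt_or_gt_of_ne hA with h | h
    · have s1 : s (σ t) < 0 := by nlinarith
      have s2 : 0 < s (σ (-t)) := by nlinarith
      have s3 : κ (σ (-t)) < κ (σ t) := by nlinarith
      exact (horder (σ t) (σ (-t)) (fun h => by rw [← h] at s2; linarith) t4.symm s3 s1).not_gt s2
    · have s1 : 0 < s (σ t) := by nlinarith
      have s2 : s (σ (-t)) < 0 := by nlinarith
      have s3 : κ (σ t) < κ (σ (-t)) := by nlinarith
      exact (horder (σ (-t)) (σ t) (fun h => by rw [← h] at s1; linarith) t4 s3 s2).not_gt s1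
  have hkn : chartDeriv E2 (fun y => κ y - G (φ y)) (c θ) n = chartDeriv E2 κ (c θ) n := by
    have h1 : chartDeriv E2 (fun y => G (φ y)) (c θ) n = 0 :=
      eq_zero_of_hasDerivAt_even (hσd _ hGφ) (hσφ.mono fun t ht => by
        simp only [Function.comp_apply, ht])
    rw [chartDeriv_sub (hκ _) hGφ, sub_apply, h1, sub_zero]
  exact ⟨G, hG, exists_pos_mul_le_manifold (n := chartDeriv E2 s (c θ) n • n) hk
    (Eventually.of_forall fun y => hs y) hs0 hk0
    (by rw [map_smul, hkn]; exact hAC) (by rw [map_smul, smul_eq_mul]; exact mul_self_pos.2 hA)⟩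

end LocalSlope

theorem exists_between_of_isCompact {A B : Set ℝ} (hA : IsCompact A) (hB : IsCompact B)
    (h : ∀ a ∈ A, ∀ b ∈ B, a < b) : ∃ v, (∀ a ∈ A, a < v) ∧ ∀ b ∈ B, v < b := by
  rcases A.eq_empty_or_nonempty with rfl | hA'
  · rcases B.eq_empty_or_nonempty with rfl | hB'
    · exact ⟨0, by simp, by simp⟩
    · obtain ⟨b, hb, hmin⟩ := hB.exists_isLeast hB'
      exact ⟨b - 1, by simp, fun x hx => (sub_one_lt b).trans_le (hmin hx)⟩
  · obtain ⟨a, ha, hmax⟩ := hA.exists_isGreatest hA'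
    rcases B.eq_empty_or_nonempty with rfl | hB'
    · exact ⟨a + 1, fun x hx => (hmax hx).trans_lt (lt_add_one a), by simp⟩
    · obtain ⟨b, hb, hmin⟩ := hB.exists_isLeast hB'
      obtain ⟨v, hv1, hv2⟩ := exists_between (h a ha b hb)
      exact ⟨v, fun x hx => (hmax hx).trans_lt hv1, fun x hx => hv2.trans_le (hmin hx)⟩

/-! ### Gluing local separating functions into one graph. -/

section Glue

variable {M : Type*} [TopologicalSpace M] [ChartedSpace E2 M] {φ : M → S3} {κ s : M → ℝ}

/-- The pairs of a value `v` and a slope `ε` such that `v` separates the values of `κ` on the two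
sides of `s = 0` over the point `p`, with rate `ε`. -/
def separating (φ : M → S3) (κ s : M → ℝ) (p : E4) : Set (ℝ × ℝ) :=
  {w | 0 < w.2 ∧ ∀ x, (φ x : E4) = p →
    (0 ≤ s x → w.2 * s x ≤ κ x - w.1) ∧ (s x ≤ 0 → κ x - w.1 ≤ w.2 * s x)}

-- The conditions are affine in the value and the rate jointly. Recording the rate is what keeps the
-- derivative from degenerating when local choices are averaged.
omit [TopologicalSpace M] [ChartedSpace E2 M] in
theorem convex_separating (p : E4) : Convex ℝ (separating φ κ s p) := by
  rintro ⟨v, ε⟩ ⟨h1, h2⟩ ⟨v', ε'⟩ ⟨h1', h2'⟩ α β hα hβ hαβ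
  simp only at h1 h2 h1' h2'
  obtain rfl : β = 1 - α := by linarith
  refine ⟨?_, fun x hx => ⟨fun hs => ?_, fun hs => ?_⟩⟩
  · change 0 < α * ε + (1 - α) * ε'
    rcases hα.eq_or_lt with rfl | h
    · simpa using h1'
    · have := mul_pos h h1
      have := mul_nonneg hβ h1'.le
      linarith
  · change (α * ε + (1 - α) * ε') * s x ≤ κ x - (α * v + (1 - α) * v')
    have := mul_le_mul_of_nonneg_left ((h2 x hx).1 hs) hα
    have := mul_le_mul_of_nonneg_left ((h2' x hx).1 hs) hβ
    linarith
  · change κ x - (α * v + (1 - α) * v') ≤ (α * ε + (1 - α) * ε') * s x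
    have := mul_le_mul_of_nonneg_left ((h2 x hx).2 hs) hα
    have := mul_le_mul_of_nonneg_left ((h2' x hx).2 hs) hβ
    linarith

-- Off the curve a strict inequality survives any sufficiently small rate, and on the curve every
-- rate below the local one works. Compactness of the surface then gives one rate for all nearby
-- fibres.
omit [ChartedSpace E2 M] in
theorem exists_separating_near [CompactSpace M] (hφ : Continuous φ) (hκ : Continuous κ)
    (hs : Continuous s) {p : E4} {G : E4 → ℝ} (hG : ContinuousAt G p)
    (hneg : ∀ x, (φ x : E4) = p → s x < 0 → κ x < G p)
    (hpos : ∀ x, (φ x : E4) = p → 0 < s x → G p < κ x)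
    (hzero : ∀ x, (φ x : E4) = p → s x = 0 → ∃ ε > 0, ∀ᶠ y in 𝓝 x,
      (0 ≤ s y → ε * s y ≤ κ y - G (φ y)) ∧ (s y ≤ 0 → κ y - G (φ y) ≤ ε * s y)) :
    ∃ ε : ℝ, ∀ᶠ q in 𝓝 p, (G q, ε) ∈ separating φ κ s q := by
  have key : ∀ᶠ z : E4 × ℝ in 𝓝 (p, 0), ∀ x ∈ (univ : Set M), 0 < z.2 → (φ x : E4) = z.1 →
      (0 ≤ s x → z.2 * s x ≤ κ x - G z.1) ∧ (s x ≤ 0 → κ x - G z.1 ≤ z.2 * s x) := by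
    refine isCompact_univ.eventually_forall_of_forall_eventually fun x _ => ?_
    by_cases hx : (φ x : E4) = p
    · have hGc : ContinuousAt (fun z : (E4 × ℝ) × M => κ z.2 - G z.1.1) ((p, 0), x) := by
        refine (by fun_prop : Continuous fun z : (E4 × ℝ) × M => κ z.2).continuousAt.sub ?_
        exact ContinuousAt.comp (g := G) (f := fun z : (E4 × ℝ) × M => z.1.1) hG (by fun_prop)
      have hsc : ContinuousAt (fun z : (E4 × ℝ) × M => z.1.2 * s z.2) ((p, 0), x) := by
        fun_prop
      have hs2 : ContinuousAt (fun z : (E4 × ℝ) × M => s z.2) ((p, 0), x) := by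
        fun_prop
      rcases lt_trichotomy (s x) 0 with h | h | h
      · filter_upwards [hGc.eventually_lt hsc (by simpa using hneg x hx h),
          hs2.eventually_lt_const h] with z h1 h2 _ _
        exact ⟨fun h3 => absurd h2 h3.not_gt, fun _ => h1.le⟩
      · obtain ⟨ε, hε, hev⟩ := hzero x hx h
        have h1 : ∀ᶠ z : (E4 × ℝ) × M in 𝓝 ((p, 0), x), z.1.2 < ε :=
          (by fun_prop : ContinuousAt (fun z : (E4 × ℝ) × M => z.1.2) ((p, 0), x)).eventually_lt_const
            hε
        have h2 := (continuousAt_snd (p := ((p, (0 : ℝ)), x))).eventually hev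
        filter_upwards [h1, h2] with z z1 z2 z3 z4
        rw [← z4]
        refine ⟨fun hz => le_trans ?_ (z2.1 hz), fun hz => (z2.2 hz).trans ?_⟩
        · exact mul_le_mul_of_nonneg_right z1.le hz
        · exact mul_le_mul_of_nonpos_right z1.le hz
      · filter_upwards [hsc.eventually_lt hGc (by simpa using hpos x hx h),
          hs2.eventually_const_lt h] with z h1 h2 _ _
        exact ⟨fun _ => h1.le, fun h3 => absurd h2 h3.not_gt⟩
    · have : ∀ᶠ z : (E4 × ℝ) × M in 𝓝 ((p, 0), x), (φ z.2 : E4) ≠ z.1.1 :=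
        (isOpen_ne_fun (by fun_prop) (by fun_prop)).mem_nhds hx
      exact this.mono fun z hz _ h => absurd h hz
  rw [nhds_prod_eq, eventually_prod_iff] at key
  obtain ⟨P, hP, Q, hQ, H⟩ := key
  obtain ⟨ε, hε, hε0⟩ := ((hQ.filter_mono (nhdsWithin_le_nhds (s := Ioi 0))).and
    self_mem_nhdsWithin).exists
  refine ⟨ε, ?_⟩
  filter_upwards [hP] with q hq
  exact ⟨hε0, fun x hx => H hq hε x trivial hε0 hx⟩

omit [ChartedSpace E2 M] in
/-- If the values of `κ` on the two sides of `s = 0` are strictly ordered over each point of `S³`,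
then they are separated by a smooth function on `ℝ⁴`. -/
theorem exists_separating [CompactSpace M] (hφ : Continuous φ) (hκ : Continuous κ)
    (hs : Continuous s) (hls : ∀ x, s x = 0 → HasLocalSlope φ κ s x)
    (hinj : ∀ x y, s x = 0 → s y = 0 → φ x = φ y → x = y)
    (hlt : ∀ x y, s x ≤ 0 → 0 ≤ s y → φ x = φ y → (s x < 0 ∨ 0 < s y) → κ x < κ y) :
    ∃ G δ : E4 → ℝ, ContDiff ℝ ∞ G ∧ ContDiff ℝ ∞ δ ∧ ∀ p, (G p, δ p) ∈ separating φ κ s p := by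
  suffices h : ∃ g : C^∞⟮𝓘(ℝ, E4), E4; 𝓘(ℝ, ℝ × ℝ), ℝ × ℝ⟯, ∀ p, g p ∈ separating φ κ s p by
    obtain ⟨g, hg⟩ := h
    have := g.contMDiff.contDiff
    exact ⟨fun p => (g p).1, fun p => (g p).2, contDiff_fst.comp this, contDiff_snd.comp this, hg⟩
  refine exists_contMDiffMap_forall_mem_convex_of_local 𝓘(ℝ, E4) (n := (⊤ : ℕ∞))
    (fun p => convex_separating p) fun p => ?_
  obtain ⟨G, hG, ε, hε⟩ : ∃ G : E4 → ℝ, (∀ᶠ q in 𝓝 p, ContDiffAt ℝ ∞ G q) ∧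
      ∃ ε : ℝ, ∀ᶠ q in 𝓝 p, (G q, ε) ∈ separating φ κ s q := by
    by_cases hγ : ∃ x, (φ x : E4) = p ∧ s x = 0
    · obtain ⟨x, rfl, hx⟩ := hγ
      obtain ⟨G, hG, ε, hε, hev⟩ := hls x hx
      have h0 : κ x = G (φ x) := by
        have h1 := hev.self_of_nhds.1 hx.ge
        have h2 := hev.self_of_nhds.2 hx.le
        rw [hx] at h1 h2
        linarith
      refine ⟨G, hG, exists_separating_near hφ hκ hs hG.self_of_nhds.continuousAt ?_ ?_ ?_⟩
      · intro y hy hsy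
        rw [← h0]
        exact hlt y x hsy.le hx.ge (Subtype.ext hy) (Or.inl hsy)
      · intro y hy hsy
        rw [← h0]
        exact hlt x y hx.le hsy.le (Subtype.ext hy.symm) (Or.inr hsy)
      · intro y hy hsy
        obtain rfl := hinj x y hx hsy (Subtype.ext hy.symm)
        exact ⟨ε, hε, hev⟩
    · push Not at hγ
      -- No point of the curve lies over `p`, so the heights of the two sides over `p` are two
      -- compact sets in strict order, and a constant separates them.
      have hcl : IsClosed {x | (φ x : E4) = p} := isClosed_eq (by fun_prop) continuous_const
      obtain ⟨v, hv1, hv2⟩ := exists_between_of_isCompact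
        ((hcl.inter (isClosed_le hs continuous_const)).isCompact.image hκ)
        ((hcl.inter (isClosed_le continuous_const hs)).isCompact.image hκ)
        (A := κ '' ({x | (φ x : E4) = p} ∩ {x | s x ≤ 0}))
        (B := κ '' ({x | (φ x : E4) = p} ∩ {x | 0 ≤ s x})) (by
          rintro _ ⟨x, ⟨hx1, hx2⟩, rfl⟩ _ ⟨y, ⟨hy1, hy2⟩, rfl⟩
          exact hlt x y hx2 hy2 (Subtype.ext (hx1.trans hy1.symm))
            (Or.inl (lt_of_le_of_ne hx2 (hγ x hx1))))
      refine ⟨fun _ => v, Eventually.of_forall fun q => contDiffAt_const,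
        exists_separating_near hφ hκ hs continuousAt_const ?_ ?_ ?_⟩
      · exact fun x hx hsx => hv1 _ ⟨x, ⟨hx, hsx.le⟩, rfl⟩
      · exact fun x hx hsx => hv2 _ ⟨x, ⟨hx, hsx.le⟩, rfl⟩
      · exact fun x hx hsx => absurd hsx (hγ x hx)
  refine ⟨_, hG.and hε, fun q => (G q, ε), ?_, fun q hq => hq.2⟩
  exact fun q hq => (hq.1.prodMk contDiffAt_const).contMDiffAt.contMDiffWithinAt

/-- If the heights on the two sides of `s = 0` are strictly ordered over each point of `S³`, then
the projection of the curve `s = 0` is a slice. -/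
theorem isSlice_of_lt [IsManifold (𝓡 2) ∞ M] [CompactSpace M] {e : M → S4}
    (he : ContMDiff (𝓡 2) (𝓡 4) ∞ e)
    (hφ : ContMDiff (𝓡 2) (𝓡 3) ∞ φ) (hs : ContMDiff (𝓡 2) 𝓘(ℝ, ℝ) ∞ s)
    (hκ : ContMDiff (𝓡 2) 𝓘(ℝ, ℝ) ∞ fun x => slope (e x))
    (hover : ∀ x, LiesOver (e x) (φ x))
    (hls : ∀ x, s x = 0 → HasLocalSlope φ (fun x => slope (e x)) s x)
    (hds : ∀ x, s x = 0 → chartDeriv E2 s x ≠ 0)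
    (hinj : ∀ x y, s x = 0 → s y = 0 → φ x = φ y → x = y)
    (hlt : ∀ x y, s x ≤ 0 → 0 ≤ s y → φ x = φ y → (s x < 0 ∨ 0 < s y) →
      slope (e x) < slope (e y)) :
    IsSlice e (φ '' {x | s x = 0}) := by
  obtain ⟨G, δ, hG, hδ, h⟩ := exists_separating hφ.continuous hκ.continuous hs.continuous hls hinj hlt
  have hiff : ∀ x, slope (e x) = G (φ x) ↔ s x = 0 := by
    intro x
    obtain ⟨h1, h2⟩ := h (φ x)
    obtain ⟨h3, h4⟩ := h2 x rfl
    simp only at h1 h3 h4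
    constructor
    · intro h5
      rw [h5, sub_self] at h3 h4
      rcases lt_trichotomy (s x) 0 with h6 | h6 | h6
      · nlinarith [h4 h6.le, mul_neg_of_pos_of_neg h1 h6]
      · exact h6
      · nlinarith [h3 h6.le, mul_pos h1 h6]
    · intro h5
      have h3 := h3 h5.ge
      have h4 := h4 h5.le
      rw [h5] at h3 h4
      linarith
  have hset : {x | s x = 0} = {x | slope (e x) = G (φ x)} := by
    ext x; exact (hiff x).symm
  rw [hset]
  refine isSlice_of_graph he hover hG fun x hx => ?_
  have hx0 := (hiff x).1 hx
  obtain ⟨n, hn⟩ := exists_apply_pos (hds x hx0)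
  have hδx : 0 < δ (φ x) / 2 := half_pos (h (φ x)).1
  set η := δ (φ x) / 2
  have hGφ : ContMDiff (𝓡 2) 𝓘(ℝ, ℝ) ∞ fun y => G (φ y) :=
    hG.contMDiff.comp (contMDiff_coe_comp hφ)
  have hm : ContMDiff (𝓡 2) 𝓘(ℝ, ℝ) ∞ fun y => η * s y := contMDiff_const.mul hs
  have hdm : chartDeriv E2 (fun y => η * s y) x = η • chartDeriv E2 s x :=
    ((hasStrictFDerivAt_comp_chartAt_symm (hs x)).hasFDerivAt.const_mul η).fderiv
  -- On the positive side `κ - G ∘ φ` is at least `δ ∘ φ * s`. Halving the rate at `x` gives a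
  -- constant factor valid near `x`, hence a positive derivative.
  have hle := mfderiv_le_of_eventually_le (s := s) (k := fun y => slope (e y) - G (φ y))
    (m := fun y => η * s y) (hs x) ((hκ.sub hGφ) x) (hm x) (by simp [hx, hx0]) ?_ hn
  · intro h0
    rw [hdm, h0] at hle
    have : 0 < η * chartDeriv E2 s x n := mul_pos hδx hn
    exact absurd hle this.not_ge
  · have hc : ContinuousAt (fun y => δ (φ y)) x :=
      (hδ.continuous.comp (contMDiff_coe_comp hφ).continuous).continuousAt
    filter_upwards [hc.eventually_const_lt (half_lt_self (h (φ x)).1)] with y hy hsy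
    rw [hx0] at hsy
    exact (mul_le_mul_of_nonneg_right hy.le hsy.le).trans (((h (φ y)).2 y rfl).1 hsy.le)

end Glue

/-! ### Pushing a sheet off one side of the curve. -/

section OneSided

variable {E : Type*} [NormedAddCommGroup E] [NormedSpace ℝ E] [FiniteDimensional ℝ E]
  {M : Type*} [TopologicalSpace M] [ChartedSpace E M] [IsManifold 𝓘(ℝ, E) ∞ M] {s m : M → ℝ} {x : M}

/-- A continuous function without zeros on one side of a hypersurface has a constant sign there. -/
theorem eventually_nonpos_or_nonneg (hs : ContMDiff 𝓘(ℝ, E) 𝓘(ℝ, ℝ) ∞ s) (hs0 : s x = 0)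
    (hds : chartDeriv E s x ≠ 0) (hm : ∀ᶠ y in 𝓝 x, ContinuousAt m y)
    (hne : ∀ᶠ y in 𝓝 x, s y < 0 → m y ≠ 0) :
    (∀ᶠ y in 𝓝 x, s y ≤ 0 → m y ≤ 0) ∨ ∀ᶠ y in 𝓝 x, s y ≤ 0 → 0 ≤ m y := by
  obtain ⟨N, hN, hsub, hpre, -⟩ :=
    exists_nhds_isPreconnected_halves_manifold (hs x) hs0 hds (hm.and hne)
  have hcl : ∀ᶠ y in 𝓝 x, s y = 0 → y ∈ closure {z | s z < 0} := by
    have := eventually_mem_closure_pos (v := fun y => -s y) (contMDiffAt_neg (hs x))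
      (by rw [chartDeriv_neg]; exact neg_ne_zero.2 hds)
    simpa using this
  have hN' := eventually_eventually_nhds.2 hN
  have hcont : ContinuousOn m (N ∩ {y | s y < 0}) := fun y hy => (hsub hy.1).1.continuousWithinAt
  have hcases : (∀ y ∈ N ∩ {y | s y < 0}, m y ≤ 0) ∨ ∀ y ∈ N ∩ {y | s y < 0}, 0 ≤ m y := by
    by_contra! h
    obtain ⟨⟨y, hy, hmy⟩, ⟨z, hz, hmz⟩⟩ := h
    obtain ⟨w, hw, hw0⟩ := hpre.intermediate_value hz hy hcont ⟨hmz.le, hmy.le⟩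
    exact (hsub hw.1).2 hw.2 hw0
  -- Points with `s = 0` are limits of points with `s < 0`, so the sign extends to the closed side.
  have hfr : ∀ᶠ y in 𝓝 x, s y ≤ 0 → ∃ᶠ z in 𝓝 y, z ∈ N ∩ {y | s y < 0} := by
    filter_upwards [hcl, hN'] with y hcly hNy hsy
    have h2 : y ∈ closure {z | s z < 0} := hsy.lt_or_eq.elim (fun h => subset_closure h) hcly
    exact ((mem_closure_iff_frequently.1 h2).and_eventually hNy).mono fun z hz => ⟨hz.2, hz.1⟩
  refine hcases.imp (fun h => ?_) fun h => ?_
  · filter_upwards [hm, hfr] with y hmy hy hsy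
    by_contra! hlt
    obtain ⟨z, hz, hz'⟩ := ((hy hsy).and_eventually (hmy.eventually_const_lt hlt)).exists
    exact (h z hz).not_gt hz'
  · filter_upwards [hm, hfr] with y hmy hy hsy
    by_contra! hlt
    obtain ⟨z, hz, hz'⟩ := ((hy hsy).and_eventually (hmy.eventually_lt_const hlt)).exists
    exact (h z hz).not_gt hz'

-- Comparison with `0` gives the weak inequality for every direction in which `s` increases. This is
-- an open set of directions, and a nonzero functional which is nonnegative there is positive.
omit [FiniteDimensional ℝ E] in
theorem chartDeriv_pos_of_nonpos (hs : ContMDiff 𝓘(ℝ, E) 𝓘(ℝ, ℝ) ∞ s) (hs0 : s x = 0)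
    (hm : ContMDiffAt 𝓘(ℝ, E) 𝓘(ℝ, ℝ) ∞ m x) (hm0 : m x = 0) (hdm : chartDeriv E m x ≠ 0)
    (hle : ∀ᶠ y in 𝓝 x, s y ≤ 0 → m y ≤ 0) {n : E} (hn : 0 < chartDeriv E s x n) :
    0 < chartDeriv E m x n := by
  have key : ∀ n, 0 < chartDeriv E s x n → 0 ≤ chartDeriv E m x n := by
    intro n hn
    have h := mfderiv_le_of_eventually_le (s := fun y => -s y) (k := fun _ => (0 : ℝ)) (m := m)
      (n := -n) (contMDiffAt_neg (hs x)) contMDiffAt_const hm hm0.symm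
      (hle.mono fun y hy hsy => hy (by rw [hs0] at hsy; linarith))
      (by rw [chartDeriv_neg]; simpa using hn)
    have h0 : chartDeriv E (fun _ : M => (0 : ℝ)) x = 0 := fderiv_const_apply _
    rw [h0, map_neg] at h
    simpa using h
  refine lt_of_le_of_ne (key n hn) fun h0 => ?_
  obtain ⟨v, hv⟩ := exists_apply_pos hdm
  have hτ : 0 < chartDeriv E s x n / (2 * (|chartDeriv E s x v| + 1)) := by positivity
  set τ := chartDeriv E s x n / (2 * (|chartDeriv E s x v| + 1)) with hτdef
  have h1 := key (n - τ • v) (by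
    rw [map_sub, map_smul, smul_eq_mul]
    have h2 : τ * (2 * (|chartDeriv E s x v| + 1)) = chartDeriv E s x n :=
      div_mul_cancel₀ _ (by positivity)
    have h3 := mul_le_mul_of_nonneg_left (le_abs_self (chartDeriv E s x v)) hτ.le
    nlinarith [abs_nonneg (chartDeriv E s x v), mul_nonneg hτ.le (abs_nonneg (chartDeriv E s x v))])
  rw [map_sub, map_smul, smul_eq_mul, ← h0] at h1
  linarith [mul_pos hτ hv]

end OneSided

section Push

variable {M : Type*} [TopologicalSpace M] [ChartedSpace E2 M] [IsManifold (𝓡 2) ∞ M]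

/-- If the sheet through `x₀` and the sheet through `y₀` are transverse, and no point of the sheet
of `y₀` lies over the side `s < 0` of the sheet of `x₀`, then pushing the sheet of `y₀` in a
direction in which `s` increases makes it disjoint from the side `s ≤ 0`. -/
theorem eventually_ne_of_push {φ : M → S3} (hφ : ContMDiff (𝓡 2) (𝓡 3) ∞ φ) {s : M → ℝ}
    (hs : ContMDiff (𝓡 2) 𝓘(ℝ, ℝ) ∞ s) {x₀ y₀ : M} (hxy : φ x₀ = φ y₀)
    (hy : ImmersiveAt φ y₀) (htr : sheet3 φ x₀ ⊔ sheet3 φ y₀ = ⊤) (hs0 : s x₀ = 0)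
    (hds : chartDeriv E2 s x₀ ≠ 0)
    (hcross : ∀ᶠ p : M × M in 𝓝 (x₀, y₀), s p.1 < 0 → φ p.1 ≠ φ p.2)
    {V : M → E4} (hV : ContinuousAt V y₀) {n : E2} (hn : 0 < chartDeriv E2 s x₀ n)
    (hVn : V y₀ = chartDeriv E2 (fun y => (φ y : E4)) x₀ n) :
    ∀ᶠ p : ℝ × M × M in 𝓝 (0, x₀, y₀), 0 < p.1 → s p.2.1 ≤ 0 → ∀ t : ℝ, 0 < t →
      (φ p.2.1 : E4) ≠ t • ((φ p.2.2 : E4) + p.1 • V p.2.2) := by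
  obtain ⟨r, v, hrc, hry, hv, hvφ, hvr, hdv⟩ := exists_contMDiff_equation (by simp) hφ hy
  have hφc := hφ.continuous
  have hm : ∀ᶠ x in 𝓝 x₀, ContMDiffAt (𝓡 2) 𝓘(ℝ, ℝ) ∞ (fun x => v (φ x)) x := by
    have : ∀ᶠ x in 𝓝 x₀, ContMDiffAt (𝓡 3) 𝓘(ℝ, ℝ) ∞ v (φ x) :=
      hφc.continuousAt.eventually (by rw [hxy]; exact hv)
    filter_upwards [this] with x hx
    exact ContMDiffAt.comp x (g := v) (f := φ) hx (hφ x)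
  have hm0 : v (φ x₀) = 0 := by rw [hxy]; exact hvφ.self_of_nhds
  -- Otherwise both tangent planes would lie in the kernel of `dv`, against transversality.
  have hdm : chartDeriv E2 (fun x => v (φ x)) x₀ ≠ 0 := by
    intro h0
    apply hdv
    have hvd : MDifferentiableAt (𝓡 3) 𝓘(ℝ, ℝ) v (φ y₀) :=
      hv.self_of_nhds.mdifferentiableAt (by simp)
    let L : EuclideanSpace ℝ (Fin 3) →ₗ[ℝ] ℝ := (mfderiv (𝓡 3) 𝓘(ℝ, ℝ) v (φ y₀)).toLinearMap
    have hker : ∀ z, φ z = φ y₀ → chartDeriv E2 (fun x => v (φ x)) z = 0 → sheet3 φ z ≤ LinearMap.ker L := by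
      rintro z hz hz0 _ ⟨m, rfl⟩
      have h1 := mfderiv_comp z (g := v) (f := φ) (by rw [hz]; exact hvd)
        (hφ.mdifferentiableAt (by simp))
      have h2 : MDifferentiableAt (𝓡 2) 𝓘(ℝ, ℝ) (fun x => v (φ x)) z :=
        MDifferentiableAt.comp z (g := v) (f := φ) (by rw [hz]; exact hvd)
          (hφ.mdifferentiableAt (by simp))
      rw [chartDeriv_eq_mfderiv h2] at hz0
      have h3 : mfderiv (𝓡 2) 𝓘(ℝ, ℝ) (v ∘ φ) z = 0 := hz0
      rw [h1, hz] at h3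
      exact congrArg (fun T : E2 →L[ℝ] ℝ => T m) h3
    have htop : LinearMap.ker L = ⊤ := by
      rw [eq_top_iff, ← htr]
      refine sup_le (hker x₀ hxy h0) (hker y₀ rfl ?_)
      have : (fun x => v (φ x)) =ᶠ[𝓝 y₀] fun _ => 0 := hvφ
      refine HasFDerivAt.fderiv ((hasFDerivAt_const (0 : ℝ) _).congr_of_eventuallyEq
        (eventually_nhds_chartAt (E := E2) this))
    rw [chartDeriv_eq_mfderiv hvd]
    ext1 m
    have : m ∈ LinearMap.ker L := by rw [htop]; trivial
    exact this
  -- A zero of `v` on the sheet of `x₀` is a crossing with the sheet of `y₀`, which `hcross`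
  -- excludes on the side `s < 0`.
  have hne : ∀ᶠ x in 𝓝 x₀, s x < 0 → v (φ x) ≠ 0 := by
    have h1 : ∀ᶠ x in 𝓝 x₀, v (φ x) = 0 → φ (r (φ x)) = φ x :=
      hφc.continuousAt.eventually (by rw [hxy]; exact hvr)
    have h2 : ContinuousAt (fun x => (x, r (φ x))) x₀ := by
      refine continuousAt_id.prodMk (ContinuousAt.comp (g := r) (f := φ) ?_ hφc.continuousAt)
      rw [hxy]; exact hrc
    have h3 : ∀ᶠ x in 𝓝 x₀, s x < 0 → φ x ≠ φ (r (φ x)) :=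
      h2.eventually (show ∀ᶠ p in 𝓝 (x₀, r (φ x₀)), _ by rw [hxy, hry]; exact hcross)
    filter_upwards [h1, h3] with x h4 h5 h6 h7
    exact h5 h6 (h4 h7).symm
  obtain ⟨ρ, hρ, hρs⟩ := exists_contMDiff_retraction (φ y₀)
  have hρy : ρ (φ y₀) = φ y₀ := hρ.self_of_nhds
  -- So `v` has one sign on the closed side. Taken to be nonpositive there, it increases along the
  -- push, which moves the sheet of `y₀` from `v = 0` to `v > 0`.
  wlog hle : ∀ᶠ x in 𝓝 x₀, s x ≤ 0 → v (φ x) ≤ 0 generalizing v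
  · have hle' := (eventually_nonpos_or_nonneg hs hs0 hds (hm.mono fun x hx => hx.continuousAt)
      hne).resolve_left hle
    refine this (fun q => -v q) (hv.mono fun q hq => contMDiffAt_neg hq)
      (hvφ.mono fun x hx => by rw [hx, neg_zero])
      (hvr.mono fun q hq h => hq (neg_eq_zero.1 h))
      (by rw [chartDeriv_neg (E := EuclideanSpace ℝ (Fin 3))]; exact neg_ne_zero.2 hdv) (hm.mono fun x hx => contMDiffAt_neg hx)
      (by rw [hm0, neg_zero]) (by rw [chartDeriv_neg]; exact neg_ne_zero.2 hdm)
      (hne.mono fun x hx h => neg_ne_zero.2 (hx h))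
      (hle'.mono fun x hx h => neg_nonpos.2 (hx h))
  have hpos := chartDeriv_pos_of_nonpos hs hs0 hm.self_of_nhds hm0 hdm hle hn
  -- The extension of `v` constant on rays: pushed points leave the sphere, and the factor `t` must
  -- not matter.
  let L : E4 → ℝ := fun q => v (ρ (‖q‖⁻¹ • q))
  have hLφ : ∀ᶠ q : S3 in 𝓝 (φ y₀), L (q : E4) = v q := by
    filter_upwards [hρ] with q hq
    simp only [L]
    rw [S3.norm_eq, inv_one, one_smul, hq]
  have hnorm : ContDiffAt ℝ ∞ (fun q : E4 => ‖q‖⁻¹ • q) (φ y₀ : E4) :=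
    ((contDiffAt_norm ℝ (S3.ne_zero _)).inv (norm_ne_zero_iff.2 (S3.ne_zero _))).smul contDiffAt_id
  have hL : ContDiffAt ℝ ∞ L (φ y₀ : E4) := by
    have h0 : ‖(φ y₀ : E4)‖⁻¹ • (φ y₀ : E4) = φ y₀ := by rw [S3.norm_eq, inv_one, one_smul]
    rw [← contMDiffAt_iff_contDiffAt]
    refine ContMDiffAt.comp _ (I' := 𝓡 3) (g := v) (f := fun q : E4 => ρ (‖q‖⁻¹ • q)) ?_ ?_
    · rw [h0, hρy]; exact hv.self_of_nhds
    · refine ContMDiffAt.comp _ (I' := 𝓘(ℝ, E4)) (g := ρ) (f := fun q : E4 => ‖q‖⁻¹ • q) ?_ hnorm.contMDiffAt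
      rw [h0]; exact hρs.self_of_nhds
  have hLd : HasStrictFDerivAt L (fderiv ℝ L (φ y₀ : E4)) (φ y₀ : E4) :=
    hL.hasStrictFDerivAt (by simp)
  have hLn : 0 < fderiv ℝ L (φ y₀ : E4) (V y₀) := by
    have h1 : HasFDerivAt ((fun x => (φ x : E4)) ∘ (chartAt E2 x₀).symm)
        (chartDeriv E2 (fun y => (φ y : E4)) x₀) (chartAt E2 x₀ x₀) :=
      (hasStrictFDerivAt_comp_chartAt_symm (contMDiff_coe_comp hφ x₀)).hasFDerivAt
    have h2 : HasFDerivAt L (fderiv ℝ L (φ y₀ : E4))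
        (((fun x => (φ x : E4)) ∘ (chartAt E2 x₀).symm) (chartAt E2 x₀ x₀)) := by
      rw [comp_chartAt_symm_apply, hxy]; exact hLd.hasFDerivAt
    have h3 := h2.comp _ h1
    have h4 : ∀ᶠ x in 𝓝 x₀, v (φ x) = L (φ x) :=
      hφc.continuousAt.eventually (by rw [hxy]; exact hLφ.mono fun q hq => hq.symm)
    have h5 : chartDeriv E2 (fun x => v (φ x)) x₀ =
        (fderiv ℝ L (φ y₀ : E4)).comp (chartDeriv E2 (fun y => (φ y : E4)) x₀) :=
      (h3.congr_of_eventuallyEq (eventually_nhds_chartAt (E := E2) h4)).fderiv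
    rw [h5] at hpos
    rw [hVn]
    exact hpos
  have h1 := eventually_lt_of_hasStrictFDerivAt hLd hLn
  have h2 : Tendsto (fun p : ℝ × M × M => (p.1, (φ p.2.2 : E4), V p.2.2))
      (𝓝 (0, x₀, y₀)) (𝓝 0 ×ˢ 𝓝 (φ y₀ : E4) ×ˢ 𝓝 (V y₀)) := by
    rw [← nhds_prod_eq, ← nhds_prod_eq]
    refine ContinuousAt.tendsto (f := fun p : ℝ × M × M => (p.1, (φ p.2.2 : E4), V p.2.2))
      (x := (0, x₀, y₀)) (continuousAt_fst.prodMk ((by fun_prop : ContinuousAt _ _).prodMk ?_))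
    exact ContinuousAt.comp (g := V) (f := fun p : ℝ × M × M => p.2.2) hV (by fun_prop)
  have h3 : ∀ᶠ p : ℝ × E4 × E4 in 𝓝 0 ×ˢ 𝓝 (φ y₀ : E4) ×ˢ 𝓝 (V y₀), 0 < p.1 →
      L p.2.1 < L (p.2.1 + p.1 • p.2.2) := by
    rw [eventually_prod_iff] at h1 ⊢
    obtain ⟨P, hP, Q, hQ, H⟩ := h1
    exact ⟨fun τ => 0 < τ → P τ, eventually_nhdsWithin_iff.1 hP, Q, hQ,
      fun hτ _ hz hpos => H (hτ hpos) hz⟩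
  have h4 := h2.eventually h3
  have h5 : ∀ᶠ p : ℝ × M × M in 𝓝 (0, x₀, y₀), s p.2.1 ≤ 0 → v (φ p.2.1) ≤ 0 :=
    (by fun_prop : ContinuousAt (fun p : ℝ × M × M => p.2.1) (0, x₀, y₀)).eventually hle
  have h6 : ∀ᶠ p : ℝ × M × M in 𝓝 (0, x₀, y₀), v (φ p.2.2) = 0 ∧ L (φ p.2.2) = v (φ p.2.2) :=
    (by fun_prop : ContinuousAt (fun p : ℝ × M × M => p.2.2) (0, x₀, y₀)).eventually
      (hvφ.and (hφc.continuousAt.eventually hLφ))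
  have h7 : ∀ᶠ p : ℝ × M × M in 𝓝 (0, x₀, y₀), L (φ p.2.1) = v (φ p.2.1) :=
    (by fun_prop : ContinuousAt (fun p : ℝ × M × M => φ p.2.1) (0, x₀, y₀)).eventually
      (show ∀ᶠ q in 𝓝 (φ x₀), _ by rw [hxy]; exact hLφ)
  filter_upwards [h4, h5, h6, h7] with p p4 p5 p6 p7 hp hsp t ht heq
  have h8 : L (φ p.2.1) = L ((φ p.2.2 : E4) + p.1 • V p.2.2) := by
    rw [heq]
    simp only [L]
    congr 2
    rw [norm_smul, Real.norm_eq_abs, abs_of_pos ht, smul_smul, mul_inv, mul_comm t⁻¹, mul_assoc,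
      inv_mul_cancel₀ ht.ne', mul_one]
  have h9 : L (φ p.2.2) < L ((φ p.2.2 : E4) + p.1 • V p.2.2) := p4 hp
  rw [← h8, p7, p6.2, p6.1] at h9
  exact (p5 hsp).not_gt h9

end Push

/-! ### Order of heights near the curve, and the vector field of the push. -/

section Order

variable {M : Type*} [TopologicalSpace M] {φ : M → S3} {κ s : M → ℝ}

theorem HasLocalSlope.congr {φ φ' : M → S3} {κ κ' : M → ℝ} {x : M} (h : HasLocalSlope φ κ s x)
    (hφ : φ' =ᶠ[𝓝 x] φ) (hκ : κ' =ᶠ[𝓝 x] κ) : HasLocalSlope φ' κ' s x := by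
  obtain ⟨G, hG, ε, hε, h⟩ := h
  refine ⟨G, by rwa [hφ.self_of_nhds], ε, hε, ?_⟩
  filter_upwards [h, hφ, hκ] with y hy h1 h2
  rwa [h1, h2]

/-- A common value `G` separates the two sides, also for pairs of points of the same sheet near a
branch point, to which compactness arguments on distinct points do not apply. -/
theorem HasLocalSlope.eventually_le {x : M} (h : HasLocalSlope φ κ s x) :
    ∀ᶠ p : M × M in 𝓝 (x, x), s p.1 ≤ 0 → 0 ≤ s p.2 → φ p.1 = φ p.2 →
      κ p.1 ≤ κ p.2 ∧ (s p.1 < 0 ∨ 0 < s p.2 → κ p.1 < κ p.2) := by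
  obtain ⟨G, -, ε, hε, h⟩ := h
  rw [nhds_prod_eq]
  filter_upwards [h.prod_mk h] with p hp h1 h2 h3
  have h4 := hp.1.2 h1
  have h5 := hp.2.1 h2
  rw [← h3] at h5
  have h6 := mul_nonneg hε.le h2
  have h7 := mul_nonpos_of_nonneg_of_nonpos hε.le h1
  refine ⟨by linarith, fun h8 => ?_⟩
  rcases h8 with h8 | h8
  · have := mul_neg_of_pos_of_neg hε h8
    linarith
  · have := mul_pos hε h8
    linarith

/-- Close to the curve `s = 0`, the heights on the two sides are ordered. -/
theorem exists_pos_forall_le [CompactSpace M] (hφ : Continuous φ) (hκ : Continuous κ)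
    (hs : Continuous s) (hls : ∀ x, s x = 0 → HasLocalSlope φ κ s x)
    (hpair : ∀ x y, φ x = φ y → κ x = κ y → x = y)
    (hinj : ∀ x y, s x = 0 → s y = 0 → φ x = φ y → x = y)
    (horder : ∀ x y, x ≠ y → φ x = φ y → κ y < κ x → s x < 0 → s y < 0) :
    ∃ η > 0, ∀ x y, s x ≤ 0 → 0 ≤ s y → s y < η → φ x = φ y → κ x ≤ κ y := by
  have key : ∀ᶠ η : ℝ in 𝓝 0, ∀ p ∈ (univ : Set (M × M)), s p.1 ≤ 0 → 0 ≤ s p.2 → s p.2 < η →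
      φ p.1 = φ p.2 → κ p.1 ≤ κ p.2 := by
    refine isCompact_univ.eventually_forall_of_forall_eventually fun ⟨x, y⟩ _ => ?_
    have c1 : Continuous fun z : ℝ × M × M => s z.2.1 := by fun_prop
    have c2 : Continuous fun z : ℝ × M × M => s z.2.2 := by fun_prop
    have k1 : Continuous fun z : ℝ × M × M => κ z.2.1 := by fun_prop
    have k2 : Continuous fun z : ℝ × M × M => κ z.2.2 := by fun_prop
    have f1 : Continuous fun z : ℝ × M × M => φ z.2.1 := by fun_prop
    have f2 : Continuous fun z : ℝ × M × M => φ z.2.2 := by fun_prop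
    rcases lt_or_ge 0 (s x) with hx | hx
    · filter_upwards [(c1.continuousAt (x := (0, x, y))).eventually_const_lt hx] with z hz h1
      exact absurd hz h1.not_gt
    rcases lt_trichotomy (s y) 0 with hy | hy | hy
    · filter_upwards [(c2.continuousAt (x := (0, x, y))).eventually_lt_const hy] with z hz _ h1
      exact absurd hz h1.not_gt
    · by_cases hxy : φ x = φ y
      · rcases lt_or_ge (κ x) (κ y) with h | h
        · filter_upwards [(k1.continuousAt (x := (0, x, y))).eventually_lt k2.continuousAt h] with
            z hz _ _ _ _
          exact hz.le
        -- With `y` on the curve and not above `x`, the over/under condition, the distinctness of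
        -- heights and the injectivity of `φ` on the curve leave only `x = y`.
        · obtain rfl : x = y := by
            rcases h.lt_or_eq with h | h
            · by_contra hne
              rcases hx.lt_or_eq with h' | h'
              · exact (horder x y hne hxy h h').ne hy
              · exact hne (hinj x y h' hy hxy)
            · exact hpair x y hxy h.symm
          filter_upwards [continuousAt_snd.eventually (hls x hy).eventually_le] with z hz h1 h2 _ h3
          exact (hz h1 h2 h3).1
      · filter_upwards [(isOpen_ne_fun f1 f2).mem_nhds hxy] with z hz _ _ _ h
        exact absurd h hz
    -- If `s y > 0`, then nearby points violate `s < η` once `η` is small.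
    · filter_upwards [(continuous_fst.continuousAt (x := ((0 : ℝ), x, y))).eventually_lt
        c2.continuousAt hy] with z hz _ _ h
      exact absurd hz h.not_gt
  obtain ⟨η, hη, hη0⟩ := ((key.filter_mono (nhdsWithin_le_nhds (s := Ioi 0))).and
    self_mem_nhdsWithin).exists
  exact ⟨η, hη0, fun x y => hη (x, y) trivial⟩

end Order

section Field

variable {M : Type*} [TopologicalSpace M] [ChartedSpace E2 M] [IsManifold (𝓡 2) ∞ M]
  [CompactSpace M] {φ : M → S3} {s : M → ℝ}

/-- The velocities at `φ x` of the curves which cross `s = 0` at `x` towards `s > 0`. -/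
def crossing (φ : M → S3) (s : M → ℝ) (x : M) : Set E4 :=
  {w | ∃ n, 0 < chartDeriv E2 s x n ∧ w = chartDeriv E2 (fun y => (φ y : E4)) x n}

omit [IsManifold (𝓡 2) ∞ M] [CompactSpace M] in
theorem convex_crossing (x : M) : Convex ℝ (crossing φ s x) := by
  rintro _ ⟨n, hn, rfl⟩ _ ⟨n', hn', rfl⟩ α β hα hβ hαβ
  refine ⟨α • n + β • n', ?_, by simp⟩
  have := convex_Ioi (𝕜 := ℝ) (0 : ℝ) hn hn' hα hβ hαβ
  simpa using this

/-- A smooth section of the crossing velocities along the curve `s = 0`, near one of its points. -/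
theorem exists_local_crossing (hφ : ContMDiff (𝓡 2) (𝓡 3) ∞ φ)
    (hs : ContMDiff (𝓡 2) 𝓘(ℝ, ℝ) ∞ s) (hinj : ∀ x y, s x = 0 → s y = 0 → φ x = φ y → x = y)
    {x : M} (hx : ImmersiveAt φ x) (hs0 : s x = 0) (hds : chartDeriv E2 s x ≠ 0) :
    ∃ g : E4 → E4, (∀ᶠ q in 𝓝 (φ x : E4), ContDiffAt ℝ ∞ g q) ∧
      ∀ᶠ p in 𝓝 (φ x), ∀ y ∈ {y | s y = 0}, φ y = p → g p ∈ crossing φ s y := by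
  set a := chartAt E2 x with ha
  have hψ := eventually_contDiffAt_comp_chartAt_symm (E := E2) (k := fun y => (φ y : E4)) (x := x)
    (Eventually.of_forall fun y => contMDiff_coe_comp hφ y)
  obtain ⟨R, hR, hRs⟩ := exists_smooth_leftInverse hψ (injective_chartDeriv_coe hφ hx)
  obtain ⟨n, hn⟩ := exists_apply_pos hds
  have hRx : R (φ x) = a x := by
    have := hR.self_of_nhds
    rwa [comp_chartAt_symm_apply (E := E2)] at this
  rw [comp_chartAt_symm_apply (E := E2)] at hRs
  have hD : ∀ᶠ z in 𝓝 (a x), ContDiffAt ℝ ∞ (fderiv ℝ ((fun y => (φ y : E4)) ∘ a.symm)) z :=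
    hψ.mono fun z hz => hz.fderiv_right (by simp)
  -- The image under `dφ` of a direction constant in the chart, transported to `ℝ⁴` by a local left
  -- inverse of `φ`.
  refine ⟨fun q => fderiv ℝ ((fun y => (φ y : E4)) ∘ a.symm) (R q) n, ?_, ?_⟩
  · filter_upwards [hRs, hRs.self_of_nhds.continuousAt.eventually (hRx ▸ hD)] with q hq1 hq2
    exact (hq2.comp q hq1).clm_apply contDiffAt_const
  · have key : ∀ᶠ p in 𝓝 (φ x), ∀ y ∈ {y | s y = 0}, φ y = p →
        fderiv ℝ ((fun y => (φ y : E4)) ∘ a.symm) (R (φ y)) n ∈ crossing φ s y := by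
      refine eventually_forall_fiber (isClosed_eq hs.continuous continuous_const).isCompact
        hφ.continuous fun y hy hyx => ?_
      obtain rfl := hinj y x hy hs0 hyx
      have h1 : ∀ᶠ z in 𝓝 y, R (φ z) = a z := by
        refine eventually_nhds_of_chartAt (E := E2) ?_
        filter_upwards [hR, a.open_target.mem_nhds (mem_chart_target E2 y)] with z hz hzt
        rw [a.right_inv hzt]
        exact hz
      have h2 : ContinuousAt (fderiv ℝ (s ∘ a.symm)) (a y) := by
        have := (eventually_contDiffAt_comp_chartAt_symm (E := E2) (x := y)
          (Eventually.of_forall fun z => hs z)).self_of_nhds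
        exact (this.fderiv_right (m := 0) (by simp)).continuousAt
      have h3 : ∀ᶠ z in 𝓝 (a y), 0 < fderiv ℝ (s ∘ a.symm) z n :=
        (h2.clm_apply continuousAt_const).eventually_const_lt hn
      filter_upwards [h1, (a.continuousAt (mem_chart_source E2 y)).eventually h3,
        a.open_source.mem_nhds (mem_chart_source E2 y)] with z z1 z2 z3
      rw [fderiv_comp_chartAt_symm_eq z3 (hs z)] at z2
      rw [z1, fderiv_comp_chartAt_symm_eq z3 (contMDiff_coe_comp hφ z)]
      exact ⟨_, z2, rfl⟩
    filter_upwards [key] with p hp y hy hyp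
    rw [← hyp]
    exact hp y hy hyp

/-- The field lives on `ℝ⁵`, so that it can be prescribed on one sheet without touching the others
with the same projection. Vanishing and crossing conditions are convex and are imposed where `s ≤ η
/ 2` and `s ≥ η`, so a partition of unity applies. -/
theorem exists_crossing_field {e : M → S4} (he : Continuous e)
    (hei : Function.Injective e)
    (hover : ∀ x, LiesOver (e x) (φ x)) (hφ : ContMDiff (𝓡 2) (𝓡 3) ∞ φ)
    (hs : ContMDiff (𝓡 2) 𝓘(ℝ, ℝ) ∞ s) (hinj : ∀ x y, s x = 0 → s y = 0 → φ x = φ y → x = y)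
    (hds : ∀ x, s x = 0 → chartDeriv E2 s x ≠ 0)
    (himm : ∀ x y, x ≠ y → φ x = φ y → ImmersiveAt φ x) {η : ℝ} (hη : 0 < η) :
    ∃ W : E5 → E4, ContDiff ℝ ∞ W ∧ (∀ y, s y ≤ η / 2 → W (e y) = 0) ∧
      ∀ x y, s x = 0 → φ x = φ y → η ≤ s y → W (e y) ∈ crossing φ s x := by
  suffices h : ∃ W : C^∞⟮𝓘(ℝ, E5), E5; 𝓘(ℝ, E4), E4⟯, ∀ q, W q ∈
      {w | ∀ y, (e y : E5) = q → (s y ≤ η / 2 → w = 0) ∧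
        ∀ x, s x = 0 → φ x = φ y → η ≤ s y → w ∈ crossing φ s x} by
    obtain ⟨W, hW⟩ := h
    exact ⟨W, W.contMDiff.contDiff, fun y => (hW _ y rfl).1, fun x y h0 => (hW _ y rfl).2 x h0⟩
  have hec : Continuous fun y => (e y : E5) := continuous_subtype_val.comp he
  refine exists_contMDiffMap_forall_mem_convex_of_local 𝓘(ℝ, E5) (n := (⊤ : ℕ∞)) (fun q => ?_)
    fun q => ?_
  · intro w hw w' hw' α β hα hβ hαβ y hy
    refine ⟨fun h => ?_, fun x h1 h2 h3 => ?_⟩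
    · rw [(hw y hy).1 h, (hw' y hy).1 h, smul_zero, smul_zero, add_zero]
    · exact convex_crossing x ((hw y hy).2 x h1 h2 h3) ((hw' y hy).2 x h1 h2 h3) hα hβ hαβ
  have hloc : ∀ g : E5 → E4, (∀ᶠ p in 𝓝 q, ContDiffAt ℝ ∞ g p) →
      (∀ y, (e y : E5) = q → ∀ᶠ z in 𝓝 y, (s z ≤ η / 2 → g (e z) = 0) ∧
        ∀ x, s x = 0 → φ x = φ z → η ≤ s z → g (e z) ∈ crossing φ s x) →
      ∃ U ∈ 𝓝 q, ∃ g : E5 → E4, ContMDiffOn 𝓘(ℝ, E5) 𝓘(ℝ, E4) ∞ g U ∧ ∀ p ∈ U, g p ∈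
        {w | ∀ y, (e y : E5) = p → (s y ≤ η / 2 → w = 0) ∧
          ∀ x, s x = 0 → φ x = φ y → η ≤ s y → w ∈ crossing φ s x} := by
    intro g hg h
    have := eventually_forall_fiber isCompact_univ hec (p := q) fun y _ => h y
    refine ⟨_, hg.and this, g, fun p hp => hp.1.contMDiffAt.contMDiffWithinAt, ?_⟩
    rintro p hp y rfl
    exact hp.2 y trivial rfl
  by_cases hq : ∃ x y, s x = 0 ∧ φ x = φ y ∧ η ≤ s y ∧ (e y : E5) = q
  · obtain ⟨x, y, hx, hxy, hy, rfl⟩ := hq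
    obtain ⟨g, hg, hgx⟩ := exists_local_crossing hφ hs hinj
      (himm x y (by rintro rfl; linarith) hxy) hx (hds x hx)
    have hh : hor (e y : E5) ≠ 0 := (hover y).hor_ne_zero
    have hnorm : ∀ p : E5, hor p ≠ 0 → ContDiffAt ℝ ∞ (fun p : E5 => ‖hor p‖⁻¹ • hor p) p := by
      intro p hp
      exact (((contDiffAt_norm ℝ hp).comp p hor.contDiff.contDiffAt).inv
        (norm_ne_zero_iff.2 hp)).smul hor.contDiff.contDiffAt
    refine hloc (fun p => g (‖hor p‖⁻¹ • hor p)) ?_ fun z hz => ?_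
    · have h1 : ∀ᶠ p in 𝓝 (e y : E5), ContDiffAt ℝ ∞ g (‖hor p‖⁻¹ • hor p) :=
        (hnorm _ hh).continuousAt.eventually
          (show ∀ᶠ p in 𝓝 (‖hor (e y : E5)‖⁻¹ • hor (e y : E5)), _ by
            rw [(hover y).normalize_hor, ← hxy]; exact hg)
      filter_upwards [h1, hor.continuous.continuousAt.eventually_ne hh] with p p1 p2
      exact p1.comp p (hnorm p p2)
    -- Injectivity of `e`: the point `q` belongs to a single sheet.
    · obtain rfl : z = y := hei (Subtype.ext hz)
      have h1 : ∀ᶠ w in 𝓝 z, ∀ y ∈ {y | s y = 0}, φ y = φ w → g (φ w) ∈ crossing φ s y :=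
        hφ.continuous.continuousAt.eventually (by rw [← hxy]; exact hgx)
      filter_upwards [h1, hs.continuous.continuousAt.eventually_const_lt
        (show η / 2 < s z by linarith)] with w w1 w2
      refine ⟨fun h => absurd w2 h.not_gt, fun x' h1 h2 _ => ?_⟩
      rw [(hover w).normalize_hor]
      exact w1 x' h1 h2
  · push Not at hq
    refine hloc (fun _ => 0) (Eventually.of_forall fun p => contDiffAt_const) fun y hy => ?_
    rcases lt_or_ge (s y) η with h | h
    · filter_upwards [hs.continuous.continuousAt.eventually_lt_const h] with z hz
      exact ⟨fun _ => rfl, fun _ _ _ h => absurd hz h.not_gt⟩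
    · have h1 : ∀ᶠ p in 𝓝 (φ y), ∀ x ∈ {x | s x = 0}, φ x = p → False := by
        refine eventually_forall_fiber (isClosed_eq hs.continuous continuous_const).isCompact
          hφ.continuous fun x hx hxy => absurd hy (hq x y hx hxy h)
      filter_upwards [hφ.continuous.continuousAt.eventually h1] with z hz
      exact ⟨fun _ => rfl, fun x h1 h2 _ => (hz x h1 h2).elim⟩

end Field

theorem slope_smul {r : ℝ} (hr : 0 < r) (x : E5) : slope (r • x) = slope x := by
  rw [slope, slope, map_smul, map_smul, norm_smul, Real.norm_eq_abs, abs_of_pos hr, smul_eq_mul,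
    mul_inv, mul_comm r⁻¹, mul_assoc, inv_mul_cancel_left₀ hr.ne']

theorem LiesOver.hor_eq_smul {q : S4} {p : S3} (h : LiesOver q p) :
    hor (q : E5) = ‖hor (q : E5)‖ • (p : E4) := by
  rw [← h.normalize_hor, smul_smul, mul_inv_cancel₀ (norm_ne_zero_iff.2 h.hor_ne_zero), one_smul]

/-- Horizontal vector fields generate isotopies of `S⁴`. -/
theorem exists_isotopic_horizontal {W : E5 → E4} (hW : ContDiff ℝ ∞ W) :
    ∃ ε₀ > 0, ∀ ε : ℝ, 0 < ε → ε < ε₀ → ∃ B : S4 ≃ₘ^∞⟮𝓡 4, 𝓡 4⟯ S4, IsIsotopicToId B.symm ∧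
      ∀ q : S4, ∃ r : ℝ, 0 < r ∧ r • hor (B q : E5) = hor (q : E5) + ε • W q ∧
        r * ver (B q : E5) = ver (q : E5) := by
  -- The homogeneous extension of the horizontal field from the sphere.
  let W' : E5 → E5 := fun x => emb (‖x‖ • W (‖x‖⁻¹ • x), 0)
  have hsmooth : ContDiffOn ℝ ∞ W' {0}ᶜ := fun x hx => by
    have hx' : x ≠ 0 := hx
    have h1 : ContDiffAt ℝ ∞ (fun x : E5 => ‖x‖⁻¹ • x) x :=
      ((contDiffAt_norm ℝ hx').inv (norm_ne_zero_iff.2 hx')).smul contDiffAt_id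
    exact (emb.contDiff.contDiffAt.comp x (((contDiffAt_norm ℝ hx').smul
      (hW.contDiffAt.comp x h1)).prodMk contDiffAt_const)).contDiffWithinAt
  have hhom : ∀ r : ℝ, 0 < r → ∀ x, W' (r • x) = r • W' x := fun r hr x => by
    simp only [W']
    rw [← map_smul, Prod.smul_mk, smul_zero, smul_smul, norm_smul, Real.norm_eq_abs, abs_of_pos hr,
      mul_inv, smul_smul, mul_comm r⁻¹, mul_assoc, inv_mul_cancel₀ hr.ne', mul_one]
  obtain ⟨ε₀, hε₀, h⟩ := exists_isotopic_perturbation hsmooth hhom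
  refine ⟨ε₀, hε₀, fun ε h0 h1 => ?_⟩
  obtain ⟨Ψ, hΨ, hq⟩ := h ε h0 h1
  obtain ⟨B, hB, hB'⟩ := hΨ.exists_inverse
  refine ⟨B, hB', fun q => ?_⟩
  obtain ⟨r, hr, hr'⟩ := hq q
  simp only [W'] at hr'
  rw [← hB, S4.norm_eq, inv_one, one_smul, one_smul] at hr'
  refine ⟨r, hr, ?_, ?_⟩
  · have := congrArg hor hr'
    simpa using this.symm
  · have := congrArg ver hr'
    simpa using this.symm

/-! ### The push carried out on the whole surface. -/

section Perturbation

variable {M : Type*} [TopologicalSpace M] [ChartedSpace E2 M] [IsManifold (𝓡 2) ∞ M]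
  [CompactSpace M] {φ : M → S3} {κ s : M → ℝ}

/-- A small push of the sheets which lie over the curve `s = 0` makes the order of the heights on
the two sides strict. -/
theorem eventually_lt_of_push (hφ : IsGeneric φ) (hκ : Continuous κ)
    (hs : ContMDiff (𝓡 2) 𝓘(ℝ, ℝ) ∞ s) (hls : ∀ x, s x = 0 → HasLocalSlope φ κ s x)
    (hpair : ∀ x y, φ x = φ y → κ x = κ y → x = y)
    (hds : ∀ x, s x = 0 → chartDeriv E2 s x ≠ 0)
    (horder : ∀ x y, x ≠ y → φ x = φ y → κ y < κ x → s x < 0 → s y < 0)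
    {η : ℝ} (hη : 0 < η) (hle : ∀ x y, s x ≤ 0 → 0 ≤ s y → s y < η → φ x = φ y → κ x ≤ κ y)
    {V : M → E4} (hV : Continuous V) (hV0 : ∀ y, s y ≤ η / 2 → V y = 0)
    (hVη : ∀ x y, s x = 0 → φ x = φ y → η ≤ s y → V y ∈ crossing φ s x) :
    ∀ᶠ ε : ℝ in 𝓝 0, 0 < ε → (∀ x, (φ x : E4) + ε • V x ≠ 0) ∧ ∀ x y, s x ≤ 0 → 0 ≤ s y →
      (s x < 0 ∨ 0 < s y) →
      ‖(φ x : E4) + ε • V x‖⁻¹ • ((φ x : E4) + ε • V x) =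
        ‖(φ y : E4) + ε • V y‖⁻¹ • ((φ y : E4) + ε • V y) →
      ‖(φ x : E4) + ε • V x‖⁻¹ * κ x < ‖(φ y : E4) + ε • V y‖⁻¹ * κ y := by
  have hφc := hφ.smooth.continuous
  have hsc := hs.continuous
  obtain ⟨U, hU⟩ : ∃ U : ℝ → M → E4, ∀ ε x, U ε x = (φ x : E4) + ε • V x := ⟨_, fun _ _ => rfl⟩
  simp only [← hU]
  have hU0 : ∀ x, U 0 x = φ x := fun x => by simp [hU]
  have hUn : ∀ x, U 0 x ≠ 0 := fun x => by rw [hU0]; exact S3.ne_zero _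
  have hUc : Continuous fun z : ℝ × M => U z.1 z.2 := by
    simp only [hU]
    fun_prop
  have hne : ∀ x, ∀ᶠ z : ℝ × M in 𝓝 (0, x), U z.1 z.2 ≠ 0 := fun x =>
    (hUc.continuousAt (x := (0, x))).eventually_ne (hUn x)
  have hUnear : ∀ x, s x = 0 → ∀ᶠ y in 𝓝 x, ∀ ε, U ε y = φ y := fun x hx => by
    filter_upwards [hsc.continuousAt.eventually_lt_const (show s x < η / 2 by linarith)] with y hy ε
    rw [hU, hV0 y hy.le, smul_zero, add_zero]
  have key1 : ∀ᶠ ε : ℝ in 𝓝 0, ∀ x ∈ (univ : Set M), U ε x ≠ 0 :=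
    isCompact_univ.eventually_forall_of_forall_eventually fun x _ => hne x
  have key2 : ∀ᶠ ε : ℝ in 𝓝 0, ∀ p ∈ (univ : Set (M × M)), 0 < ε → s p.1 ≤ 0 → 0 ≤ s p.2 →
      (s p.1 < 0 ∨ 0 < s p.2) →
      ‖U ε p.1‖⁻¹ • U ε p.1 = ‖U ε p.2‖⁻¹ • U ε p.2 → ‖U ε p.1‖⁻¹ * κ p.1 < ‖U ε p.2‖⁻¹ * κ p.2 := by
    refine isCompact_univ.eventually_forall_of_forall_eventually fun ⟨x, y⟩ _ => ?_
    have p2 : ContinuousAt (fun z : ℝ × M × M => (z.1, z.2.2)) (0, x, y) := by fun_prop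
    have q1 : ContinuousAt (fun z : ℝ × M × M => z.2.1) (0, x, y) := by fun_prop
    have q2 : ContinuousAt (fun z : ℝ × M × M => z.2.2) (0, x, y) := by fun_prop
    have u1 : ContinuousAt (fun z : ℝ × M × M => U z.1 z.2.1) (0, x, y) :=
      (hUc.comp (by fun_prop : Continuous fun z : ℝ × M × M => (z.1, z.2.1))).continuousAt
    have u2 : ContinuousAt (fun z : ℝ × M × M => U z.1 z.2.2) (0, x, y) :=
      (hUc.comp (by fun_prop : Continuous fun z : ℝ × M × M => (z.1, z.2.2))).continuousAt
    have i1 : ContinuousAt (fun z : ℝ × M × M => ‖U z.1 z.2.1‖⁻¹) (0, x, y) :=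
      u1.norm.inv₀ (norm_ne_zero_iff.2 (hUn x))
    have i2 : ContinuousAt (fun z : ℝ × M × M => ‖U z.1 z.2.2‖⁻¹) (0, x, y) :=
      u2.norm.inv₀ (norm_ne_zero_iff.2 (hUn y))
    have k1 : ContinuousAt (fun z : ℝ × M × M => κ z.2.1) (0, x, y) := by fun_prop
    have k2 : ContinuousAt (fun z : ℝ × M × M => κ z.2.2) (0, x, y) := by fun_prop
    have s1 : ContinuousAt (fun z : ℝ × M × M => s z.2.1) (0, x, y) := by fun_prop
    have s2 : ContinuousAt (fun z : ℝ × M × M => s z.2.2) (0, x, y) := by fun_prop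
    rcases lt_or_ge 0 (s x) with hx | hx
    · filter_upwards [s1.eventually_const_lt hx] with z hz _ h
      exact absurd hz h.not_gt
    rcases lt_or_ge (s y) 0 with hy | hy
    · filter_upwards [s2.eventually_lt_const hy] with z hz _ _ h
      exact absurd hz h.not_gt
    by_cases hxy : φ x = φ y
    swap
    · have : ‖U 0 x‖⁻¹ • U 0 x ≠ ‖U 0 y‖⁻¹ • U 0 y := by
        rw [hU0, hU0, S3.norm_eq, S3.norm_eq, inv_one, one_smul, one_smul]
        exact fun h => hxy (Subtype.ext h)
      filter_upwards [((i1.smul u1).ne_iff_eventually_ne (i2.smul u2)).1 this] with z hz _ _ _ _ h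
      exact absurd h hz
    rcases lt_or_ge (κ x) (κ y) with hlt | hge
    · have : ‖U 0 x‖⁻¹ * κ x < ‖U 0 y‖⁻¹ * κ y := by
        rwa [hU0, hU0, S3.norm_eq, S3.norm_eq, inv_one, one_mul, one_mul]
      filter_upwards [(i1.mul k1).eventually_lt (i2.mul k2) this] with z hz _ _ _ _ _
      exact hz
    by_cases hne' : x = y
    · subst hne'
      have hx0 := le_antisymm hx hy
      filter_upwards [q1.eventually (hUnear x hx0), q2.eventually (hUnear x hx0),
        continuousAt_snd.eventually (hls x hx0).eventually_le] with z z1 z2 z3 _ h1 h2 h3 h4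
      rw [z1, z2, S3.norm_eq, S3.norm_eq, inv_one, one_smul, one_smul] at h4
      rw [z1, z2, S3.norm_eq, S3.norm_eq, inv_one, one_mul, one_mul]
      exact (z3 h1 h2 (Subtype.ext h4)).2 h3
    -- The remaining case is the obstruction: the over/under condition puts `x` on the curve, and
    -- the choice of `η` gives `η ≤ s y`. So the push fixes the sheet of `x` near `x` and moves that
    -- of `y` in a crossing direction, and the two no longer meet on the closed side.
    · have hgt : κ y < κ x := lt_of_le_of_ne hge fun h => hne' (hpair x y hxy h.symm)
      have hx0 : s x = 0 := by
        by_contra h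
        exact (horder x y hne' hxy hgt (lt_of_le_of_ne hx h)).not_ge hy
      have hyη : η ≤ s y := by
        by_contra! h
        exact (hle x y hx hy h hxy).not_gt hgt
      have himm : ImmersiveAt φ y := by
        by_contra h
        exact hne' ((hφ.branch y h).2 x hxy)
      obtain ⟨n, hn, hVn⟩ := hVη x y hx0 hxy hyη
      have hcross : ∀ᶠ p : M × M in 𝓝 (x, y), s p.1 < 0 → φ p.1 ≠ φ p.2 := by
        have c1 : ContinuousAt (fun p : M × M => κ p.1) (x, y) := by fun_prop
        have c2 : ContinuousAt (fun p : M × M => κ p.2) (x, y) := by fun_prop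
        have c3 : ContinuousAt (fun p : M × M => s p.2) (x, y) := by fun_prop
        filter_upwards [c2.eventually_lt c1 hgt, c3.eventually_const_lt (hη.trans_le hyη)] with
          p h1 h2 h3 h4
        refine (horder p.1 p.2 (fun h => ?_) h4 h1 h3).not_gt h2
        rw [h] at h3
        exact h3.not_gt h2
      filter_upwards [eventually_ne_of_push hφ.smooth hs hxy himm (hφ.double x y hne' hxy) hx0
        (hds x hx0) hcross hV.continuousAt hn hVn, q1.eventually (hUnear x hx0),
        p2.eventually (hne y)] with z z1 z2 z3 h1 h2 _ _ h3
      rw [z2, S3.norm_eq, inv_one, one_smul] at h3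
      nth_rewrite 2 [hU] at h3
      exact absurd h3 (z1 h1 h2 _ (inv_pos.2 (norm_pos_iff.2 z3)))
  filter_upwards [key1, key2] with ε h1 h2 hε
  exact ⟨fun x => h1 x trivial, fun x y => h2 (x, y) trivial hε⟩

/-- If the upper sheet lies on the side `s < 0` only where the lower sheet does, then the projection
of the curve `s = 0` is a slice, after an ambient isotopy. -/
theorem exists_isSlice {e : M → S4} (he : ContMDiff (𝓡 2) (𝓡 4) ∞ e)
    (hei : Function.Injective e)
    (hφ : IsGeneric φ) (hover : ∀ x, LiesOver (e x) (φ x))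
    (hs : ContMDiff (𝓡 2) 𝓘(ℝ, ℝ) ∞ s)
    (hκ : ContMDiff (𝓡 2) 𝓘(ℝ, ℝ) ∞ fun x => slope (e x))
    (hls : ∀ x, s x = 0 → HasLocalSlope φ (fun x => slope (e x)) s x)
    (hpair : ∀ x y, φ x = φ y → slope (e x) = slope (e y) → x = y)
    (hinj : ∀ x y, s x = 0 → s y = 0 → φ x = φ y → x = y)
    (hds : ∀ x, s x = 0 → chartDeriv E2 s x ≠ 0)
    (horder : ∀ x y, x ≠ y → φ x = φ y → slope (e y) < slope (e x) → s x < 0 → s y < 0) :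
    ∃ B : S4 ≃ₘ^∞⟮𝓡 4, 𝓡 4⟯ S4, IsIsotopicToId B.symm ∧ IsSlice (B ∘ e) (φ '' {x | s x = 0}) := by
  have hec := he.continuous
  have himm : ∀ x y, x ≠ y → φ x = φ y → ImmersiveAt φ x := fun x y hne hxy => by
    by_contra h
    exact hne ((hφ.branch x h).2 y hxy.symm).symm
  obtain ⟨η, hη, hle⟩ := exists_pos_forall_le hφ.smooth.continuous hκ.continuous hs.continuous hls
    hpair hinj horder
  obtain ⟨W, hW, hW0, hWη⟩ := exists_crossing_field hec hei hover hφ.smooth hs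
    hinj hds himm hη
  obtain ⟨ε₀, hε₀, hB⟩ := exists_isotopic_horizontal hW
  have hρ : ∀ x, 0 < ‖hor (e x : E5)‖ := fun x => norm_pos_iff.2 (hover x).hor_ne_zero
  -- The isotopy adds `ε • W` to `hor (e y)`, which is `‖hor (e y)‖` times `φ y`; dividing by this
  -- norm gives the displacement of `φ y`. Positive scaling preserves crossing directions.
  let V : M → E4 := fun y => ‖hor (e y : E5)‖⁻¹ • W (e y)
  have hV : Continuous V := by
    have h1 : Continuous fun y => (e y : E5) := continuous_subtype_val.comp hec
    exact ((hor.continuous.comp h1).norm.inv₀ fun x => (hρ x).ne').smul (hW.continuous.comp h1)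
  have hV0 : ∀ y, s y ≤ η / 2 → V y = 0 := fun y hy => by simp [V, hW0 y hy]
  have hVη : ∀ x y, s x = 0 → φ x = φ y → η ≤ s y → V y ∈ crossing φ s x := fun x y h1 h2 h3 => by
    obtain ⟨n, hn, h⟩ := hWη x y h1 h2 h3
    refine ⟨‖hor (e y : E5)‖⁻¹ • n, ?_, ?_⟩
    · rw [map_smul]; exact mul_pos (inv_pos.2 (hρ y)) hn
    · rw [map_smul, ← h]
  have hev := eventually_lt_of_push hφ hκ.continuous hs hls hpair hds horder hη hle hV hV0 hVη
  obtain ⟨ε, ⟨hev, hlt⟩, hpos⟩ := (((hev.and (eventually_lt_nhds hε₀)).filter_mono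
    (nhdsWithin_le_nhds (s := Ioi 0))).and self_mem_nhdsWithin).exists
  obtain ⟨hU, hord⟩ := hev hpos
  obtain ⟨B, hB1, hB2⟩ := hB ε hpos hlt
  refine ⟨B, hB1, ?_⟩
  set U : M → E4 := fun x => (φ x : E4) + ε • V x with hUdef
  have hUn : ∀ x, 0 < ‖U x‖ := fun x => norm_pos_iff.2 (hU x)
  have hBe : ∀ x, ∃ r : ℝ, 0 < r ∧ r • hor (B (e x) : E5) = ‖hor (e x : E5)‖ • U x ∧
      r * ver (B (e x) : E5) = ver (e x : E5) := fun x => by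
    obtain ⟨r, hr, h1, h2⟩ := hB2 (e x)
    refine ⟨r, hr, ?_, h2⟩
    rw [h1, hUdef]
    simp only [V]
    rw [smul_add, ← (hover x).hor_eq_smul, smul_smul, smul_smul, mul_right_comm,
      mul_inv_cancel₀ (hρ x).ne', one_mul]
  let φ' : M → S3 := fun x => ⟨‖U x‖⁻¹ • U x, by
    rw [mem_sphere_zero_iff_norm]; exact norm_normalize (hU x)⟩
  have hslope : ∀ x, slope (B (e x)) = ‖U x‖⁻¹ * slope (e x) := fun x => by
    obtain ⟨r, hr, h1, h2⟩ := hBe x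
    rw [← slope_smul hr, slope, map_smul, map_smul, h1, smul_eq_mul, h2, norm_smul, norm_norm, slope,
      mul_inv, mul_assoc, mul_left_comm]
  have hover' : ∀ x, LiesOver (B (e x)) (φ' x) := fun x => by
    obtain ⟨r, hr, h1, -⟩ := hBe x
    rw [liesOver_iff]
    refine ⟨r⁻¹ * (‖hor (e x : E5)‖ * ‖U x‖), mul_pos (inv_pos.2 hr) (mul_pos (hρ x) (hUn x)), ?_⟩
    change _ = _ • (‖U x‖⁻¹ • U x)
    rw [smul_smul, mul_assoc, mul_assoc, mul_inv_cancel₀ (hUn x).ne', mul_one, mul_smul, ← h1,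
      smul_smul, inv_mul_cancel₀ hr.ne', one_smul]
  have hBs : ContMDiff (𝓡 2) (𝓡 4) ∞ (B ∘ e) := B.contMDiff.comp he
  have hcoe : ContMDiff (𝓡 2) 𝓘(ℝ, E5) ∞ fun x => (B (e x) : E5) := contMDiff_coe_sphere.comp hBs
  have hφ' : ContMDiff (𝓡 2) (𝓡 3) ∞ φ' := by
    have : ContMDiff (𝓡 2) 𝓘(ℝ, E4) ∞ fun x => ‖hor (B (e x) : E5)‖⁻¹ • hor (B (e x) : E5) := by
      intro x
      have hx : hor (B (e x) : E5) ≠ 0 := (hover' x).hor_ne_zero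
      have h1 : ContDiffAt ℝ ∞ (fun p : E5 => ‖hor p‖⁻¹ • hor p) (B (e x) : E5) :=
        (((contDiffAt_norm ℝ hx).comp _ hor.contDiff.contDiffAt).inv
          (norm_ne_zero_iff.2 hx)).smul hor.contDiff.contDiffAt
      exact ContMDiffAt.comp x (g := fun p : E5 => ‖hor p‖⁻¹ • hor p) h1.contMDiffAt (hcoe x)
    have h2 : (fun x => ‖hor (B (e x) : E5)‖⁻¹ • hor (B (e x) : E5)) = fun x => (φ' x : E4) :=
      funext fun x => (hover' x).normalize_hor
    rw [h2] at this
    exact ContMDiff.codRestrict_sphere this fun x => (φ' x).2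
  have hκ' : ContMDiff (𝓡 2) 𝓘(ℝ, ℝ) ∞ fun x => slope (B (e x)) := fun x =>
    ContMDiffAt.comp x (g := slope) (contDiffAt_slope (hover' x).hor_ne_zero).contMDiffAt (hcoe x)
  have hUφ : ∀ x, s x ≤ η / 2 → U x = φ x := fun x hx => by
    simp only [hUdef]; rw [hV0 x hx, smul_zero, add_zero]
  have hφ'φ : ∀ x, s x ≤ η / 2 → φ' x = φ x := fun x hx => Subtype.ext (by
    change ‖U x‖⁻¹ • U x = φ x
    rw [hUφ x hx, S3.norm_eq, inv_one, one_smul])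
  have hκ'κ : ∀ x, s x ≤ η / 2 → slope (B (e x)) = slope (e x) := fun x hx => by
    rw [hslope, hUφ x hx, S3.norm_eq, inv_one, one_mul]
  have hnear : ∀ x, s x = 0 → ∀ᶠ y in 𝓝 x, s y ≤ η / 2 := fun x hx =>
    (hs.continuous.continuousAt.eventually_lt_const (show s x < η / 2 by linarith)).mono
      fun y hy => hy.le
  have hzero : ∀ x, s x = 0 → s x ≤ η / 2 := fun x hx => by linarith
  have himage : φ '' {x | s x = 0} = φ' '' {x | s x = 0} :=
    image_congr fun x hx => (hφ'φ x (hzero x hx)).symm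
  rw [himage]
  refine isSlice_of_lt hBs hφ' hs hκ' hover' (fun x hx => (hls x hx).congr ?_ ?_) hds ?_ ?_
  · filter_upwards [hnear x hx] with y hy using hφ'φ y hy
  · filter_upwards [hnear x hx] with y hy using hκ'κ y hy
  · intro x y hx hy hxy
    rw [hφ'φ x (hzero x hx), hφ'φ y (hzero y hy)] at hxy
    exact hinj x y hx hy hxy
  · intro x y hx hy hxy hsxy
    change slope (B (e x)) < slope (B (e y))
    rw [hslope, hslope]
    exact hord x y hx hy hsxy (congrArg Subtype.val hxy)

end Perturbation

/-! ### Comparison of slope with height, and the conclusion. -/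

section Height

theorem S4.hor_ver (q : S4) : ‖hor (q : E5)‖ ^ 2 + ver (q : E5) ^ 2 = 1 := by
  rw [← norm_sq_eq_hor_ver, S4.norm_eq, one_pow]

/-- On the unit half circle `r > 0` the quotient `v / r` increases with `v`. -/
theorem inv_mul_lt_inv_mul {r r' v v' : ℝ} (hr : 0 < r) (hr' : 0 < r') (h : r ^ 2 + v ^ 2 = 1)
    (h' : r' ^ 2 + v' ^ 2 = 1) (hv : v < v') : r⁻¹ * v < r'⁻¹ * v' := by
  rw [inv_mul_eq_div, inv_mul_eq_div, div_lt_div_iff₀ hr hr']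
  rcases le_or_gt 0 v with h0 | h0
  · have h1 : r' < r := lt_of_pow_lt_pow_left₀ 2 hr.le (by nlinarith)
    nlinarith [mul_le_mul_of_nonneg_left h1.le h0]
  · rcases le_or_gt 0 v' with h1 | h1
    · nlinarith [mul_neg_of_neg_of_pos h0 hr', mul_nonneg h1 hr.le]
    · have h2 : r < r' := lt_of_pow_lt_pow_left₀ 2 hr'.le (by nlinarith)
      nlinarith

theorem slope_lt_slope_iff {q q' : S4} (hq : hor (q : E5) ≠ 0) (hq' : hor (q' : E5) ≠ 0) :
    slope q < slope q' ↔ height q < height q' := by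
  have hr := norm_pos_iff.2 hq
  have hr' := norm_pos_iff.2 hq'
  rw [height_eq, height_eq]
  have hlt := inv_mul_lt_inv_mul hr hr' q.hor_ver q'.hor_ver
  refine ⟨fun h => ?_, hlt⟩
  rcases lt_trichotomy (ver (q : E5)) (ver (q' : E5)) with h1 | h1 | h1
  · exact h1
  · have h2 : ‖hor (q : E5)‖ = ‖hor (q' : E5)‖ := by
      have := q.hor_ver.trans q'.hor_ver.symm
      rw [h1, add_left_inj] at this
      exact (pow_left_inj₀ hr.le hr'.le two_ne_zero).1 this
    rw [slope, slope, h1, h2] at h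
    exact absurd h (lt_irrefl _)
  · exact absurd h (inv_mul_lt_inv_mul hr' hr q'.hor_ver q.hor_ver h1).not_gt

theorem LiesOver.eq_smul_emb {q : S4} {p : S3} (h : LiesOver q p) :
    (q : E5) = ‖emb ((p : E4), slope q)‖⁻¹ • emb ((p : E4), slope q) := by
  have h1 := slope_of_hor_eq (norm_pos_iff.2 h.hor_ne_zero) h.hor_eq_smul
  have h2 := congrArg norm h1
  rw [S4.norm_eq, norm_smul, norm_norm] at h2
  rwa [← eq_inv_of_mul_eq_one_left h2.symm]

theorem LiesOver.ext {q q' : S4} {p : S3} (h : LiesOver q p) (h' : LiesOver q' p)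
    (hs : slope q = slope q') : q = q' :=
  Subtype.ext (by rw [h.eq_smul_emb, h'.eq_smul_emb, hs])

theorem slope_reflect (q : S4) : slope (reflect q) = -slope q := by
  rw [coe_reflect, slope, slope, hor_emb, ver_emb, mul_neg]

theorem LiesOver.reflect {q : S4} {p : S3} (h : LiesOver q p) : LiesOver (reflect q) p := by
  rw [liesOver_iff] at h ⊢
  rwa [coe_reflect, hor_emb]

end Height

section Surface

variable {M : Type*} [TopologicalSpace M] [ChartedSpace E2 M] [IsManifold (𝓡 2) ∞ M]

omit [IsManifold (𝓡 2) ∞ M] in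
theorem contMDiff_slope {e : M → S4} {φ : M → S3} (he : ContMDiff (𝓡 2) (𝓡 4) ∞ e)
    (hover : ∀ x, LiesOver (e x) (φ x)) : ContMDiff (𝓡 2) 𝓘(ℝ, ℝ) ∞ fun x => slope (e x) := fun x =>
  ContMDiffAt.comp x (g := slope) (contDiffAt_slope (hover x).hor_ne_zero).contMDiffAt
    (contMDiff_coe_comp he x)

/-- The map `e` is a smooth function of `φ` and the slope, namely the normalization of `emb (φ x,
slope (e x))`. A direction killed by both derivatives is therefore killed by the injective `de`. -/
theorem eq_zero_of_chartDeriv_eq_zero {e : M → S4} {φ : M → S3} (he : ContMDiff (𝓡 2) (𝓡 4) ∞ e)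
    (hφ : ContMDiff (𝓡 2) (𝓡 3) ∞ φ) (hover : ∀ x, LiesOver (e x) (φ x)) {x : M}
    (hei : Function.Injective (mfderiv (𝓡 2) (𝓡 4) e x)) {n : E2}
    (h1 : chartDeriv E2 (fun y => (φ y : E4)) x n = 0)
    (h2 : chartDeriv E2 (fun y => slope (e y)) x n = 0) : n = 0 := by
  refine (injective_iff_map_eq_zero _).1 (injective_chartDeriv_coe he hei) n ?_
  have hp := ((hasStrictFDerivAt_comp_chartAt_symm (contMDiff_coe_comp hφ x)).hasFDerivAt.prodMk
    (hasStrictFDerivAt_comp_chartAt_symm (contMDiff_slope he hover x)).hasFDerivAt)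
  have hne : emb ((φ x : E4), slope (e x)) ≠ 0 := fun h => S3.ne_zero (φ x) (by
    have := congrArg hor h
    simpa using this)
  have hN : DifferentiableAt ℝ (fun w : E4 × ℝ => ‖emb w‖⁻¹ • emb w) ((φ x : E4), slope (e x)) :=
    ((((contDiffAt_norm ℝ hne).comp _ emb.contDiff.contDiffAt).inv
      (norm_ne_zero_iff.2 hne)).smul emb.contDiff.contDiffAt :
        ContDiffAt ℝ 1 (fun w : E4 × ℝ => ‖emb w‖⁻¹ • emb w) _).differentiableAt (by simp)
  have hN' := hN.hasFDerivAt
  set L := fderiv ℝ (fun w : E4 × ℝ => ‖emb w‖⁻¹ • emb w) ((φ x : E4), slope (e x))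
  have hN'' : HasFDerivAt (fun w : E4 × ℝ => ‖emb w‖⁻¹ • emb w) L
      (((fun y => (φ y : E4)) ∘ (chartAt E2 x).symm) (chartAt E2 x x),
        ((fun y => slope (e y)) ∘ (chartAt E2 x).symm) (chartAt E2 x x)) := by
    rw [comp_chartAt_symm_apply, comp_chartAt_symm_apply]
    exact hN'
  have hc := HasFDerivAt.comp (chartAt E2 x x) hN'' hp
  have heq : (fun y => (e y : E5)) ∘ (chartAt E2 x).symm =
      (fun w : E4 × ℝ => ‖emb w‖⁻¹ • emb w) ∘ fun z =>
        (((fun y => (φ y : E4)) ∘ (chartAt E2 x).symm) z,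
          ((fun y => slope (e y)) ∘ (chartAt E2 x).symm) z) := by
    funext z
    exact (hover _).eq_smul_emb
  rw [← heq] at hc
  have hd : chartDeriv E2 (fun y => (e y : E5)) x = _ := hc.fderiv
  rw [hd, ContinuousLinearMap.comp_apply, ContinuousLinearMap.prod_apply, h1, h2]
  exact map_zero _

/-- The projection of a separating curve is a slice, if the upper sheet lies over the first side
only where the lower sheet does. -/
theorem exists_isSlice_of_separates [T2Space M] [CompactSpace M] [PreconnectedSpace M] {e : M → S4}
    {φ : M → S3} (he : ContMDiff (𝓡 2) (𝓡 4) ∞ e) (hei : Function.Injective e)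
    (hed : ∀ x, Function.Injective (mfderiv (𝓡 2) (𝓡 4) e x)) (hφ : IsGeneric φ)
    (hover : ∀ x, LiesOver (e x) (φ x)) {c : Circle → M}
    (hc : Manifold.IsSmoothEmbedding (𝓡 1) (𝓡 2) ∞ c)
    (hK : Manifold.IsSmoothEmbedding (𝓡 1) (𝓡 3) ∞ (φ ∘ c)) {F₁ F₂ : Set M}
    (hsep : Separates (range c) F₁ F₂)
    (horder : ∀ x y, x ≠ y → φ x = φ y → slope (e y) < slope (e x) → x ∈ F₁ → y ∈ F₁) :
    ∃ B : S4 ≃ₘ^∞⟮𝓡 4, 𝓡 4⟯ S4, IsIsotopicToId B.symm ∧ IsSlice (B ∘ e) (range (φ ∘ c)) := by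
  obtain ⟨s, hs, hs1, -, hs0, hds⟩ := exists_defining_function hc hsep
  have hκ := contMDiff_slope he hover
  have horder' : ∀ x y, x ≠ y → φ x = φ y → slope (e y) < slope (e x) → s x < 0 → s y < 0 := by
    simpa only [hs1] using horder
  have hrange : range (φ ∘ c) = φ '' {x | s x = 0} := by
    rw [range_comp]
    congr 1
    ext x
    exact (hs0 x).symm
  rw [hrange]
  refine exists_isSlice he hei hφ hover hs hκ (fun x hx => ?_) (fun x y hxy h => ?_) ?_ hds horder'
  · by_cases hi : ImmersiveAt φ x
    · exact .of_immersiveAt hφ.smooth hκ hs hi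
    · exact .of_isBranchPoint hφ.smooth hκ hs
        (fun x n => eq_zero_of_chartDeriv_eq_zero he hφ.smooth hover (hed x)) horder' hc hK hs0 hx
        (hds x hx) (hφ.branch x hi).1
  · exact hei ((hover x).ext (hxy ▸ hover y) h)
  · intro x y hx hy hxy
    obtain ⟨θ, rfl⟩ := (hs0 x).1 hx
    obtain ⟨θ', rfl⟩ := (hs0 y).1 hy
    exact congrArg c (hK.isEmbedding.injective hxy)

theorem BrokenSurfaceDiagram.IsDeckerSet.exists_identifies {D : BrokenSurfaceDiagram M} {n : ℕ}
    {P : Fin n → DeckerPair M} (hP : D.IsDeckerSet P) {x y : M} (h : D.isOver x y) :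
    ∃ i, (P i).Identifies x y := by
  obtain ⟨⟨i, t⟩, ⟨ht, hα, hβ⟩, -⟩ := hP.exists_unique x y h
  refine ⟨i, t, ?_, hα, hβ⟩
  rcases ht with ⟨-, ht⟩ | ⟨-, ht⟩
  · exact Ico_subset_Icc_self ht
  · exact Ioo_subset_Icc_self ht

end Surface

end SurfaceSlice
theorem mainTheorem2 {M : Type*} [TopologicalSpace M] [ChartedSpace (EuclideanSpace ℝ (Fin 2)) M]
    [IsManifold (𝓡 2) ∞ M] [T2Space M] [CompactSpace M] [ConnectedSpace M]
    -- the knotted surface `f(M)`, a broken surface diagram of it, and the decker set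
    (f : M → S4) (hf : Manifold.IsSmoothEmbedding (𝓡 2) (𝓡 4) ∞ f)
    (D : BrokenSurfaceDiagram M) (hD : D.Represents f)
    (n : ℕ) (P : Fin n → DeckerPair M) (hP : D.IsDeckerSet P)
    -- the separating curve `γ = c(S¹)`, which represents a knot in `S³`
    (c : Circle → M) (hc : Manifold.IsSmoothEmbedding (𝓡 1) (𝓡 2) ∞ c)
    (hK : Manifold.IsSmoothEmbedding (𝓡 1) (𝓡 3) ∞ (D.proj ∘ c))
    (F₁ F₂ : Set M) (hsep : Separates (Set.range c) F₁ F₂)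
    (h : (∀ i x y, (P i).Identifies x y → x ∈ F₁ → y ∈ F₁) ∨
      (∀ i x y, (P i).Identifies x y → y ∈ F₁ → x ∈ F₁)) :
    IsSlice f (Set.range (D.proj ∘ c)) := by
  obtain ⟨Ψ, e, hΨ, he, hrange, hover, hisOver⟩ := hD
  obtain ⟨Φ, hΦ, hΦ'⟩ := hΨ.exists_inverse
  have hΦf : Φ '' Set.range f = Set.range e := by rw [hrange, funext hΦ]
  have hed := fun x => mfderiv_injective_of_isImmersionAt (he.isImmersion.isImmersionAt x)
  have hei := he.isEmbedding.injective
  have hslope : ∀ x y, slope (e y) < slope (e x) ↔ height (e y) < height (e x) := fun x y =>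
    slope_lt_slope_iff (hover y).hor_ne_zero (hover x).hor_ne_zero
  rcases h with h | h
  · obtain ⟨B, hB, hslice⟩ := exists_isSlice_of_separates he.contMDiff hei hed D.generic hover hc hK
      hsep fun x y hne hxy hlt hx => by
        obtain ⟨i, hi⟩ := hP.exists_identifies
          ((hisOver x y).2 ⟨hne, hxy, (hslope x y).1 hlt⟩)
        exact h i x y hi hx
    refine hslice.of_diffeomorph hf he (Φ.trans B) B (fun j hj => (hj.comp hB).comp hΦ') ?_
    rw [Diffeomorph.coe_trans, Set.range_comp, Set.image_comp, hΦf]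
  -- After reflection the lower point becomes the upper one, so the second alternative supplies the
  -- order condition of the first. The reflection is undone on equatorial spheres by
  -- `isEquatorial_reflect`.
  · obtain ⟨B, hB, hslice⟩ := exists_isSlice_of_separates (e := reflect ∘ e)
      (reflect.contMDiff.comp he.contMDiff) (reflect.injective.comp hei)
      (fun x => by
        rw [mfderiv_comp x (reflect.contMDiff.mdifferentiableAt (by simp))
          (he.contMDiff.mdifferentiableAt (by simp))]
        exact (Diffeomorph.injective_mfderiv reflect _).comp (hed x))
      D.generic (fun x => (hover x).reflect) hc hK hsep fun x y hne hxy hlt hx => by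
        simp only [Function.comp_apply, slope_reflect, neg_lt_neg_iff] at hlt
        obtain ⟨i, hi⟩ := hP.exists_identifies
          ((hisOver y x).2 ⟨hne.symm, hxy.symm, (hslope y x).1 hlt⟩)
        exact h i y x hi hx
    refine IsSlice.of_diffeomorph hf he (Φ.trans (reflect.trans B)) (reflect.trans B)
      (fun j hj => (isEquatorial_reflect (hj.comp hB)).comp hΦ') ?_ hslice
    rw [Diffeomorph.coe_trans Φ, Set.range_comp, Set.image_comp, hΦf]
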